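/- **Setting.** Let $(Z_t)_{t\in\mathbb Z}$ be i.i.d. real random variables with $\mathbb E Z_0=0$, $\mathbb E Z_0^2=1$. Let $\theta_0=(\alpha_0,\beta_0,\gamma_0,\delta_0)\in\mathbb R^4$ with $|\beta_0|<1$, let $(\log\sigma_t^2)_{t\in\mathbb Z}$ be the stationary non-anticipative ($\sigma_t^2$ independent of $(Z_t,Z_{t+1},\dots)$) solution of $$\log\sigma_{t+1}^2=\alpha_0+\beta_0\log\sigma_t^2+\gamma_0Z_t+\delta_0|Z_t|,\qquad t\in\mathbb Z,$$ and let $X_t=\sigma_tZ_t$ (EGARCH(1,1) model). Let $\Theta\subset\mathbb R^4$ be compact with $0\le\beta<1$ for all $\theta=(\alpha,\beta,\gamma,\delta)\in\Theta$, and let $\varepsilon>0$. Put $$\Lambda_t(\theta)=\max\{\beta,\;2^{-1}(\gamma X_t+\delta|X_t|)\exp(-2^{-1}\alpha/(1-\beta))-\beta\},\qquad \log 0=-\infty .$$ Condition INV($\theta$): $\delta\ge|\gamma|$ and $\mathbb E[\log\Lambda_0(\theta)]<0$ (the value $-\infty$ is allowed). For an initial value $s$ put $\hat g_0(\theta)=s$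 and $$\hat g_{t+1}(\theta)=\alpha+\beta\hat g_t(\theta)+(\gamma X_t+\delta|X_t|)\exp(-\hat g_t(\theta)/2),\quad t\ge0,\qquad \hat\sigma_t^2(\theta)=\exp(\hat g_t(\theta));$$ $s=h(\theta)$ may depend on $\theta$ through a continuous initial function $h$. The empirical constraint set is $$\Theta_n^S=\Big\{\theta\in\Theta:\ \delta\ge|\gamma|,\ \sum_{t=1}^n\log\Lambda_t(\theta)\le-\varepsilon\Big\}.$$ A stable QMLE (SQMLE) for $h$ is a sequence of random variables $\hat\theta_n^S$ such that, for each $n$, almost surely, if $\Theta_n^S\neq\emptyset$ then $\hat\theta_n^S$ minimizes $\sum_{t=1}^n2^{-1}\big(X_t^2\exp(-\hat g_t(\theta))+\hat g_t(\theta)\big)$ over $\theta\in\Theta_n^S$, where $\hat g_0=h$. **Theorem.** 1. Suppose that the model is identifiable, i.e. the law of $Z_0$ is not concentrated on two points and $(\gamma_0,\delta_0)\ne(0,0)$. If INV($\theta_0$) holds and $\theta_0\in\Theta$, then $\hat\theta_n^S\to\theta_0$ almost surely, for every continuous initial function $h$ and every SQMLE for $h$. 2. Suppose that almost surely $\Theta_n^S\ne\emptyset$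 for all large $n$. Then, whether or not INV($\theta_0$) holds (in particular when it fails), the asymptotic law of the volatility forecast $\hat\sigma_t^2(\hat\theta_n^S)$ does not depend on the initial value: (a) There are probability laws $(\pi_\theta)$ on $\mathbb R$ such that, for every continuous $h$ and every SQMLE $\hat\theta_n^S$ for $h$, almost surely for all large $n$ the following holds at the deterministic parameter $\theta$ equal to the realized value of $\hat\theta_n^S$: for every initial value $s\in\mathbb R$, the law of $\hat\sigma_t^2(\theta)$ started from $s$ converges weakly to $\pi_\theta$ as $t\to\infty$. (b) Let $\hat\theta_n,\hat\theta_n'$ be SQMLEs for continuous initial functions $h,h'$ with $\hat\theta_n-\hat\theta_n'\to0$ in probability (for instance $\hat\theta_n'=\hat\theta_n$, $h'=h$). For all continuous initial functions $k,k'$, the forecast $\hat\sigma_t^2(\hat\theta_n)$ computed from $\hat g_0=k$ and the forecast $\hat\sigma_t'^2(\hat\theta_n')$ computed from $\hat g_0=k'$ satisfy $\mathbb E f(\hat\sigma_t^2(\hat\theta_n))-\mathbb E f(\hat\sigma_t'^2(\hat\theta_n'))\to0$ as $t,n\to\infty$ jointly (in particular for $t=n$), for every bounded continuous $f:\mathbb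 R\to\mathbb R$. -/

import Mathlib

open MeasureTheory ProbabilityTheory Filter Topology

noncomputable section

namespace EGARCH

/-- Parameters `θ = (α, β, γ, δ) ∈ ℝ⁴`. -/
abbrev Param : Type := EuclideanSpace ℝ (Fin 4)

def alpha (θ : Param) : ℝ := θ 0
def beta (θ : Param) : ℝ := θ 1
def gamma (θ : Param) : ℝ := θ 2
def delta (θ : Param) : ℝ := θ 3

/-- `Z` is an i.i.d. sequence of centered random variables with unit variance. -/
structure IsInnovation {Ω : Type*} [MeasurableSpace Ω] (μ : Measure Ω) (Z : ℤ → Ω → ℝ) : Prop where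
  measurable : ∀ t, Measurable (Z t)
  indep : iIndepFun Z μ
  identDistrib : ∀ t, IdentDistrib (Z t) (Z 0) μ μ
  memLp : MemLp (Z 0) 2 μ
  mean_zero : ∫ ω, Z 0 ω ∂μ = 0
  var_one : ∫ ω, (Z 0 ω) ^ 2 ∂μ = 1

/-- `V = (log σ_t²)` is the stationary non-anticipative solution of the EGARCH(1,1) recursion
`V_{t+1} = α₀ + β₀ V_t + γ₀ Z_t + δ₀ |Z_t|`, with `|β₀| < 1`, driven by the innovations `Z`. -/
structure IsEGARCH {Ω : Type*} [MeasurableSpace Ω] (μ : Measure Ω) (Z V : ℤ → Ω → ℝ)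
    (θ₀ : Param) : Prop where
  innovation : IsInnovation μ Z
  abs_beta_lt_one : |beta θ₀| < 1
  measurable : ∀ t, Measurable (V t)
  recursion : ∀ t, ∀ᵐ ω ∂μ,
    V (t + 1) ω = alpha θ₀ + beta θ₀ * V t ω + gamma θ₀ * Z t ω + delta θ₀ * |Z t ω|
  stationary : ∀ k : ℤ, IdentDistrib (fun ω t => V (t + k) ω) (fun ω t => V t ω) μ μ
  nonanticipative : ∀ t : ℤ, IndepFun (V t) (fun ω (k : ℕ) => Z (t + k) ω) μ

/-- The observations `X_t = σ_t Z_t`, where `σ_t = exp (V_t / 2)`. -/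
def obs {Ω : Type*} (Z V : ℤ → Ω → ℝ) (t : ℤ) (ω : Ω) : ℝ :=
  Real.exp (V t ω / 2) * Z t ω

/-- The observed path `X_0, X_1, X_2, …`. -/
def path {Ω : Type*} (Z V : ℤ → Ω → ℝ) (ω : Ω) (t : ℕ) : ℝ := obs Z V (t : ℤ) ω

/-- `φ(y, θ) = α + β y + (γ x + δ |x|) exp (-y / 2)`, the inverted recursion at observation `x`. -/
def phi (θ : Param) (x y : ℝ) : ℝ :=
  alpha θ + beta θ * y + (gamma θ * x + delta θ * |x|) * Real.exp (-y / 2)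

/-- `ĝ_t(θ)`, computed from the observations `x` and the initial value `ĝ_0(θ) = s`. -/
def gHat (x : ℕ → ℝ) (θ : Param) (s : ℝ) : ℕ → ℝ
  | 0 => s
  | t + 1 => phi θ (x t) (gHat x θ s t)

/-- `max {β, 2⁻¹ (γ x + δ |x|) exp (-2⁻¹ α / (1 - β)) - β}`. -/
def lipCoeff (θ : Param) (x : ℝ) : ℝ :=
  max (beta θ)
    ((1 / 2) * (gamma θ * x + delta θ * |x|) * Real.exp (-(1 / 2) * (alpha θ / (1 - beta θ)))
      - beta θ)

/-- The logarithm of `lipCoeff`, with the convention `log 0 = -∞`. -/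
def logLip (θ : Param) (x : ℝ) : EReal := ENNReal.log (ENNReal.ofReal (lipCoeff θ x))

/-- `INV(θ)`: `δ ≥ |γ|` and `E[log max {…}] < 0`. The expectation lies in `[-∞, 0)`:
the integral of the positive part is smaller than the (possibly infinite) integral of the
negative part. -/
def INV {Ω : Type*} [MeasurableSpace Ω] (μ : Measure Ω) (X : Ω → ℝ) (θ : Param) : Prop :=
  |gamma θ| ≤ delta θ ∧
    ∫⁻ ω, (logLip θ (X ω)).toENNReal ∂μ < ∫⁻ ω, (-logLip θ (X ω)).toENNReal ∂μ

/-- The empirical constraint set `Θ^S`, based on the observations `x_1, …, x_n`. -/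
def stableSet (Θ : Set Param) (ε : ℝ) (x : ℕ → ℝ) (n : ℕ) : Set Param :=
  {θ ∈ Θ | |gamma θ| ≤ delta θ ∧ ∑ t ∈ Finset.Icc 1 n, logLip θ (x t) ≤ ((-ε : ℝ) : EReal)}

/-- The quasi-likelihood criterion based on the initial function `h = ĝ_0`. -/
def QL (h : Param → ℝ) (x : ℕ → ℝ) (n : ℕ) (θ : Param) : ℝ :=
  ∑ t ∈ Finset.Icc 1 n,
    (1 / 2) * ((x t) ^ 2 * Real.exp (-gHat x θ (h θ) t) + gHat x θ (h θ) t)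

/-- `θhat` is a stable QMLE for the initial function `h`: a random variable that minimizes the
quasi-likelihood over `Θ^S` whenever `Θ^S` is non-empty. -/
structure IsSQMLE {Ω : Type*} [MeasurableSpace Ω] (μ : Measure Ω) (X : Ω → ℕ → ℝ)
    (Θ : Set Param) (ε : ℝ) (h : Param → ℝ) (θhat : ℕ → Ω → Param) : Prop where
  measurable : ∀ n, Measurable (θhat n)
  argmin : ∀ n, ∀ᵐ ω ∂μ, (stableSet Θ ε (X ω) n).Nonempty →
    θhat n ω ∈ stableSet Θ ε (X ω) n ∧
      IsMinOn (QL h (X ω) n) (stableSet Θ ε (X ω) n) (θhat n ω)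

/-- The volatility `σ̂_t²(θ) = exp ĝ_t(θ)` computed from the initial value `ĝ_0(θ) = s`. -/
def volHat (x : ℕ → ℝ) (θ : Param) (s : ℝ) (t : ℕ) : ℝ := Real.exp (gHat x θ s t)

end EGARCH

end

/-! The inverted recursion `y ↦ α + β y + (γ x + δ |x|) exp (-y / 2)` has derivative `β - (γ x + δ
|x|) exp (-y / 2) / 2`. As the shocks are nonnegative, trajectories end up above any level below `α
/ (1 - β)`, and above `α / (1 - β)` itself the derivative is bounded in absolute value by the
coefficient `Λ` (`abs_phi_sub_phi_le`). If `E log Λ < 0`, Birkhoff's theorem sends products of these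
bounds to `0`. Trajectories then forget their initial value and approach a stationary solution
`statG`, locally uniformly in the parameter. By `IsEGARCH.ae_eq_arVol` the whole model is a function
of the innovations, so all this takes place on the space of i.i.d. sequences with its ergodic shift.

The crux is `exists_isContractive_stableSet_subset`: almost surely, the empirical constraint set
eventually lies in a fixed compact set over which the recursions contract uniformly. By compactness
this is a local question at each parameter. If `E log Λ < 0`, contraction persists nearby. If `E log
Λ > 0`, the empirical sums become positive on a whole neighbourhood, which the constraint forbids.
If `E log Λ = 0`, the constraint decides nothing, but the bound `Λ` is not sharp: a past shock lifts
the trajectory strictly above the fixed point, and a later Lipschitz bound shrinks by a factor `damp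
< 1`. With a suitable lag this happens with positive probability, the corrected logarithmic mean is
strictly negative, and the boundary is contractive too (`hasContraction_of_integral_eq_zero`).

For consistency, let `u` be the true log-volatility minus the stationary solution at another
parameter. Given the past, twice the expected excess of the criterion is `exp u - 1 - u`, which is
positive unless `u = 0`. Vanishing of `u` identifies the parameter, because `1, y, |y|` are linearly
independent when the innovations are not concentrated on two points (`eq_of_ae_affine`). As `exp u`
need not be integrable, gaps are truncated from above. A modulus of continuity valid off a small
event (`exists_modulus`) makes the comparison uniform on a ball, and compactness finishes
(`ae_eventually_QL_lt`).

For the forecasts, contraction reduces everything to `statG` at time `t`, whose law is the same for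
every `t`. At a random parameter, the same modulus, transported by stationarity, is uniform in `t`.
-/

noncomputable section

namespace EGARCH

/-! ### Birkhoff's ergodic theorem through running maxima. -/

section Birkhoff

variable {S : Type*} {T : S → S} {f : S → ℝ}

/-- The running maximum of `0` and the Birkhoff sums of `f`. -/
def birkhoffMax (T : S → S) (f : S → ℝ) : ℕ → S → ℝ
  | 0 => fun _ => 0
  | n + 1 => fun z => max 0 (f z + birkhoffMax T f n (T z))

lemma birkhoffMax_nonneg (n : ℕ) (z : S) : 0 ≤ birkhoffMax T f n z := by
  cases n <;> simp [birkhoffMax]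

lemma birkhoffMax_le_succ (n : ℕ) : ∀ z, birkhoffMax T f n z ≤ birkhoffMax T f (n + 1) z := by
  induction n with
  | zero => intro z; simp [birkhoffMax]
  | succ n ih =>
    intro z
    change max 0 (f z + birkhoffMax T f n (T z)) ≤ max 0 (f z + birkhoffMax T f (n + 1) (T z))
    exact max_le_max le_rfl (by linarith [ih (T z)])

lemma birkhoffMax_mono (z : S) : Monotone fun n => birkhoffMax T f n z :=
  monotone_nat_of_le_succ fun n => birkhoffMax_le_succ n z

lemma birkhoffSum_le_birkhoffMax (n : ℕ) : ∀ z, birkhoffSum T f n z ≤ birkhoffMax T f n z := by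
  induction n with
  | zero => intro z; simp [birkhoffMax]
  | succ n ih =>
    intro z
    rw [birkhoffSum_succ']
    exact le_max_of_le_right (by linarith [ih (T z)])

variable [MeasurableSpace S] {P : Measure S}

lemma measurable_birkhoffMax (hT : Measurable T) (hf : Measurable f) (n : ℕ) :
    Measurable (birkhoffMax T f n) := by
  induction n with
  | zero => exact measurable_const
  | succ n ih => exact measurable_const.max (hf.add (ih.comp hT))

lemma integrable_birkhoffMax (hT : MeasurePreserving T P P) (hf : Integrable f P) (n : ℕ) :
    Integrable (birkhoffMax T f n) P := by
  induction n with
  | zero => exact integrable_zero _ _ _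
  | succ n ih => exact (integrable_zero S ℝ P).sup (hf.add (hT.integrable_comp_of_integrable ih))

/-- Garsia's argument: the set of bounded running maxima is invariant, hence null or conull. Were it
null, the nonnegative integrals in `key` would converge to `∫ f < 0`. -/
lemma birkhoffMax_bddAbove_of_integral_neg [IsProbabilityMeasure P] (hT : Ergodic T P)
    (hfm : Measurable f) (hf : Integrable f P) (hneg : ∫ z, f z ∂P < 0) :
    ∀ᵐ z ∂P, ∃ k : ℕ, ∀ n, birkhoffMax T f n z ≤ k := by
  set A : Set S := {z | ∃ k : ℕ, ∀ n, birkhoffMax T f n z ≤ k} with hA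
  have hAm : MeasurableSet A := by
    have : A = ⋃ k : ℕ, ⋂ n, {z | birkhoffMax T f n z ≤ k} := by ext; simp [hA]
    rw [this]
    exact MeasurableSet.iUnion fun k => MeasurableSet.iInter fun n =>
      measurableSet_le (measurable_birkhoffMax hT.measurable hfm n) measurable_const
  have hinv : T ⁻¹' A = A := by
    ext z
    constructor
    · rintro ⟨k, hk⟩
      obtain ⟨j, hj⟩ := exists_nat_ge (max 0 (f z + k))
      refine ⟨j, fun n => ?_⟩
      cases n with
      | zero => simp [birkhoffMax]
      | succ n => exact (max_le_max le_rfl (by linarith [hk n])).trans hj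
    · rintro ⟨k, hk⟩
      obtain ⟨j, hj⟩ := exists_nat_ge (k - f z)
      refine ⟨j, fun n => ?_⟩
      have := (le_max_right _ _).trans (hk (n + 1))
      linarith
  rcases hT.toPreErgodic.ae_mem_or_ae_notMem hAm hinv with h | h
  · exact h
  exfalso
  -- The integrand equals `birkhoffMax T f (n + 1) - birkhoffMax T f n ∘ T`, and `T` preserves `P`,
  -- so the integral is the increment of the means of the maxima.
  have key : ∀ n, 0 ≤ ∫ z, max (-birkhoffMax T f n (T z)) (f z) ∂P := by
    intro n
    have hi := integrable_birkhoffMax hT.toMeasurePreserving hf n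
    have hi' := integrable_birkhoffMax hT.toMeasurePreserving hf (n + 1)
    have e : ∀ z, max (-birkhoffMax T f n (T z)) (f z)
        = birkhoffMax T f (n + 1) z - birkhoffMax T f n (T z) := by
      intro z
      change _ = max 0 _ - _
      rw [max_sub_sub_right 0 _ _ |>.symm]
      congr 1 <;> ring
    simp_rw [e]
    have hi2 : Integrable (fun z => birkhoffMax T f n (T z)) P :=
      hT.toMeasurePreserving.integrable_comp_of_integrable hi
    rw [integral_sub hi' hi2]
    have : ∫ z, birkhoffMax T f n (T z) ∂P = ∫ z, birkhoffMax T f n z ∂P := by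
      have h1 := integral_map (μ := P) hT.measurable.aemeasurable
        (f := birkhoffMax T f n) (by rw [hT.map_eq]; exact hi.1)
      rw [hT.map_eq] at h1
      exact h1.symm
    rw [this, sub_nonneg]
    exact integral_mono hi hi' fun z => birkhoffMax_le_succ n z
  have lim : Tendsto (fun n => ∫ z, max (-birkhoffMax T f n (T z)) (f z) ∂P) atTop
      (𝓝 (∫ z, f z ∂P)) := by
    refine tendsto_integral_of_dominated_convergence (fun z => |f z|) ?_ hf.abs ?_ ?_
    · intro n
      exact (((measurable_birkhoffMax hT.measurable hfm n).comp hT.measurable).neg.max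
        hfm).aestronglyMeasurable
    · intro n
      refine ae_of_all _ fun z => ?_
      have h0 : 0 ≤ birkhoffMax T f n (T z) := birkhoffMax_nonneg _ _
      rw [Real.norm_eq_abs, abs_le]
      exact ⟨le_max_of_le_right (neg_abs_le _),
        max_le (by linarith [abs_nonneg (f z)]) (le_abs_self _)⟩
    -- The maxima at `T z` are unbounded, so the first argument of the `max` finally drops below `f
    -- z` and the integrand is `f z` itself.
    · filter_upwards [h] with z hz
      have hz' : T z ∉ A := fun h' => hz (hinv ▸ h')
      simp only [hA, Set.mem_ofPred_eq, not_exists, not_forall, not_le] at hz'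
      obtain ⟨k, hk⟩ := exists_nat_ge (-f z)
      obtain ⟨N, hN⟩ := hz' k
      refine tendsto_const_nhds.congr' ?_
      filter_upwards [eventually_ge_atTop N] with n hn
      have := birkhoffMax_mono (T := T) (f := f) (T z) hn
      simp only at this
      rw [max_eq_right]
      linarith
  exact absurd (ge_of_tendsto' lim key) (not_le.mpr hneg)

/-- Eventual upper bound for Birkhoff averages. -/
lemma eventually_birkhoffAverage_le [IsProbabilityMeasure P] (hT : Ergodic T P)
    (hfm : Measurable f) (hf : Integrable f P) {c : ℝ} (hc : ∫ z, f z ∂P < c) :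
    ∀ᵐ z ∂P, ∀ᶠ n : ℕ in atTop, birkhoffAverage ℝ T f n z ≤ c := by
  -- The sums of `f - d` are bounded by a random constant `k`; the room `c - d` absorbs `k / n`.
  obtain ⟨d, hd, hdc⟩ := exists_between hc
  have h := birkhoffMax_bddAbove_of_integral_neg hT (f := fun z => f z - d)
    (hfm.sub_const d) (hf.sub (integrable_const d)) (by
      rw [integral_sub hf (integrable_const d)]; simp; linarith)
  filter_upwards [h] with z hz
  obtain ⟨k, hk⟩ := hz
  have hlim : Tendsto (fun n : ℕ => (k : ℝ) / n) atTop (𝓝 0) :=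
    tendsto_const_div_atTop_nhds_zero_nat _
  filter_upwards [hlim.eventually (gt_mem_nhds (show 0 < c - d by linarith)),
    eventually_gt_atTop 0] with n hn hn0
  have h1 := (birkhoffSum_le_birkhoffMax n z).trans (hk n)
  have e : birkhoffSum T (fun z => f z - d) n z = birkhoffSum T f n z - n * d := by
    simp [birkhoffSum, Finset.sum_sub_distrib]
  rw [e] at h1
  have hn' : (0 : ℝ) < n := by exact_mod_cast hn0
  rw [birkhoffAverage, smul_eq_mul, inv_mul_le_iff₀ hn']
  rw [div_lt_iff₀ hn'] at hn
  nlinarith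

/-- **Birkhoff's pointwise ergodic theorem** for an ergodic transformation. -/
theorem ae_tendsto_birkhoffAverage [IsProbabilityMeasure P] (hT : Ergodic T P)
    (hfm : Measurable f) (hf : Integrable f P) :
    ∀ᵐ z ∂P, Tendsto (fun n => birkhoffAverage ℝ T f n z) atTop (𝓝 (∫ z, f z ∂P)) := by
  have hu : ∀ᵐ z ∂P, ∀ k : ℕ, ∀ᶠ n : ℕ in atTop,
      birkhoffAverage ℝ T f n z ≤ ∫ z, f z ∂P + 1 / ((k : ℝ) + 1) :=
    ae_all_iff.2 fun k => eventually_birkhoffAverage_le hT hfm hf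
      (by linarith [Nat.one_div_pos_of_nat (α := ℝ) (n := k)])
  have hl : ∀ᵐ z ∂P, ∀ k : ℕ, ∀ᶠ n : ℕ in atTop,
      birkhoffAverage ℝ T (fun z => -f z) n z ≤ -∫ z, f z ∂P + 1 / ((k : ℝ) + 1) :=
    ae_all_iff.2 fun k => eventually_birkhoffAverage_le hT hfm.neg hf.neg
      (by
        simp only [Pi.neg_apply, integral_neg]
        linarith [Nat.one_div_pos_of_nat (α := ℝ) (n := k)])
  filter_upwards [hu, hl] with z h1 h2
  rw [Metric.tendsto_atTop']
  intro ε hε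
  obtain ⟨k, hk⟩ := exists_nat_one_div_lt hε
  obtain ⟨N, hN⟩ := eventually_atTop.1 ((h1 k).and (h2 k))
  refine ⟨N, fun n hn => ?_⟩
  obtain ⟨a, b⟩ := hN n hn.le
  have e : birkhoffAverage ℝ T (fun z => -f z) n z = -birkhoffAverage ℝ T f n z := by
    simp [birkhoffAverage, birkhoffSum]
  rw [e] at b
  rw [Real.dist_eq, abs_lt]
  constructor <;> linarith

end Birkhoff

/-! ### Ergodicity of the shift on i.i.d. sequences. -/

section Shift

/-- The shift by `t` on two-sided sequences. -/
def shift (t : ℤ) (z : ℤ → ℝ) : ℤ → ℝ := fun k => z (k + t)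

lemma shift_apply (t : ℤ) (z : ℤ → ℝ) (k : ℤ) : shift t z k = z (k + t) := rfl

lemma shift_shift (s t : ℤ) (z : ℤ → ℝ) : shift s (shift t z) = shift (s + t) z := by
  ext k; simp [shift, add_assoc]

@[simp] lemma shift_zero (z : ℤ → ℝ) : shift 0 z = z := by ext k; simp [shift]

lemma measurable_shift (t : ℤ) : Measurable (shift t) :=
  measurable_pi_lambda _ fun _ => measurable_pi_apply _

lemma shift_iterate (t : ℤ) (n : ℕ) : (shift t)^[n] = shift (n * t) := by
  induction n with
  | zero => ext z; simp
  | succ n ih =>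
    ext1 z
    rw [Function.iterate_succ_apply', ih, shift_shift]
    congr 1; push_cast; ring

variable (ν : Measure ℝ) [IsProbabilityMeasure ν]

/-- The law of a two-sided i.i.d. sequence. -/
abbrev iidLaw : Measure (ℤ → ℝ) := Measure.infinitePi fun _ : ℤ => ν

lemma measurePreserving_shift (t : ℤ) :
    MeasurePreserving (shift t) (iidLaw ν) (iidLaw ν) :=
  ⟨measurable_shift t, Measure.map_infinitePi_infinitePi_of_inj (P := fun _ : ℤ => ν)
    (f := fun k : ℤ => k + t) (add_left_injective t)⟩

lemma iIndepFun_coord : iIndepFun (fun (k : ℤ) (z : ℤ → ℝ) => z k) (iidLaw ν) :=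
  iIndepFun_infinitePi (X := fun _ ω => ω) fun _ => measurable_id

/-- A cylinder and a distant translate of it are independent. -/
lemma exists_measure_inter_shift_cylinder (I : Finset ℤ) {S : Set (I → ℝ)}
    (hS : MeasurableSet S) :
    ∃ n : ℤ, (iidLaw ν).real (cylinder I S ∩ shift n ⁻¹' cylinder I S)
      = (iidLaw ν).real (cylinder I S) ^ 2 := by
  obtain ⟨B, hB⟩ : ∃ B : ℕ, ∀ i ∈ I, |i| ≤ B := by
    refine ⟨∑ i ∈ I, i.natAbs, fun i hi => ?_⟩
    rw [Int.abs_eq_natAbs]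
    exact_mod_cast Finset.single_le_sum (f := fun i : ℤ => i.natAbs) (fun _ _ => Nat.zero_le _) hi
  let n : ℤ := 2 * B + 1
  refine ⟨n, ?_⟩
  set J : Finset ℤ := I.image (fun k => k + n) with hJ
  have hdisj : Disjoint I J := by
    rw [Finset.disjoint_left]
    intro i hi hi'
    obtain ⟨j, hj, rfl⟩ := Finset.mem_image.1 hi'
    have h1 := abs_le.1 (hB _ hi)
    have h2 := abs_le.1 (hB _ hj)
    omega
  have hind := (iIndepFun_coord ν).indepFun_finset I J hdisj (fun i => measurable_pi_apply i)
  let e : (J → ℝ) → (I → ℝ) := fun w i => w ⟨i + n, Finset.mem_image_of_mem _ i.2⟩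
  have he : Measurable e := measurable_pi_lambda _ fun _ => measurable_pi_apply _
  have h := hind.measure_inter_preimage_eq_mul S (e ⁻¹' S) hS (he hS)
  have h2 : (fun (a : ℤ → ℝ) (i : J) => a i) ⁻¹' (e ⁻¹' S) = shift n ⁻¹' cylinder I S := rfl
  have h1 : (fun (a : ℤ → ℝ) (i : I) => a i) ⁻¹' S = cylinder I S := rfl
  rw [h2, h1, (measurePreserving_shift ν n).measure_preimage hS.cylinder.nullMeasurableSet] at h
  rw [measureReal_def, h, ENNReal.toReal_mul, sq]; rfl

/-- An invariant event is approximated by a cylinder and, by invariance, equally well by a distant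
translate of that cylinder. The two are independent, so the probability of the event equals its
square. -/
lemma ergodic_shift_one : Ergodic (shift 1) (iidLaw ν) := by
  refine { toMeasurePreserving := measurePreserving_shift ν 1, aeconst_set := ?_ }
  intro s hs hinv
  set P := iidLaw ν
  have hinv' : ∀ n : ℕ, shift n ⁻¹' s = s ∧ shift (-n) ⁻¹' s = s := by
    intro n
    have h1 : shift n ⁻¹' s = s := by
      induction n with
      | zero => ext z; simp
      | succ n ih =>
        ext z
        have : z ∈ shift (n + 1 : ℕ) ⁻¹' s ↔ shift n z ∈ shift 1 ⁻¹' s := by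
          simp only [Set.mem_preimage, shift_shift]; push_cast; rw [add_comm]
        rw [this, hinv]
        exact Set.ext_iff.1 ih z
    refine ⟨h1, ?_⟩
    ext z
    have := Set.ext_iff.1 h1 (shift (-n) z)
    simp only [Set.mem_preimage, shift_shift, add_neg_cancel, shift_zero] at this
    exact this.symm
  have hinvZ : ∀ n : ℤ, shift n ⁻¹' s = s := by
    intro n
    rcases Int.eq_nat_or_neg n with ⟨k, rfl | rfl⟩
    exacts [(hinv' k).1, (hinv' k).2]
  have key : ∀ ε : ℝ, 0 < ε → |P.real s - P.real s ^ 2| ≤ 4 * ε := by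
    intro ε hε
    obtain ⟨t, ht, hts⟩ := exists_measure_symmDiff_lt_of_generateFrom_isSetRing (μ := P)
      (isSetRing_measurableCylinders (α := fun _ : ℤ => ℝ))
      ⟨{Set.univ}, Set.countable_singleton _, by
        simpa using univ_mem_measurableCylinders (fun _ : ℤ => ℝ), by simp⟩
      generateFrom_measurableCylinders.symm hs (ε := ENNReal.ofReal ε) (by simpa)
    obtain ⟨I, S, hS, rfl⟩ := (mem_measurableCylinders (α := fun _ : ℤ => ℝ) t).1 ht
    obtain ⟨n, hn⟩ := exists_measure_inter_shift_cylinder ν I hS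
    set t := cylinder (α := fun _ : ℤ => ℝ) I S
    have htm : MeasurableSet t := hS.cylinder
    have hd : P.real (symmDiff t s) ≤ ε :=
      ENNReal.toReal_le_of_le_ofReal hε.le hts.le
    have hd' : P.real (symmDiff (shift n ⁻¹' t) s) ≤ ε := by
      have : symmDiff (shift n ⁻¹' t) s = shift n ⁻¹' (symmDiff t s) := by
        conv_lhs => rw [← hinvZ n]
        rfl
      rw [this, (measurePreserving_shift ν n).measureReal_preimage
        (htm.symmDiff hs).nullMeasurableSet]
      exact hd
    have a1 : |P.real t - P.real s| ≤ ε :=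
      (abs_measureReal_sub_le_measureReal_symmDiff htm.nullMeasurableSet
        hs.nullMeasurableSet).trans hd
    have a2 : |P.real (t ∩ shift n ⁻¹' t) - P.real s| ≤ 2 * ε := by
      refine (abs_measureReal_sub_le_measureReal_symmDiff
        (htm.inter (measurable_shift n htm)).nullMeasurableSet hs.nullMeasurableSet).trans ?_
      have hsub : symmDiff (t ∩ shift n ⁻¹' t) s
          ⊆ symmDiff t s ∪ symmDiff (shift n ⁻¹' t) s := by
        intro z
        simp only [Set.mem_symmDiff, Set.mem_inter_iff, Set.mem_union]
        tauto
      calc _ ≤ P.real (symmDiff t s ∪ symmDiff (shift n ⁻¹' t) s) := measureReal_mono hsub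
        _ ≤ _ := measureReal_union_le _ _
        _ ≤ 2 * ε := by linarith
    rw [hn] at a2
    have b0 : 0 ≤ P.real t := measureReal_nonneg
    have b1 : P.real t ≤ 1 := measureReal_le_one
    have c0 : 0 ≤ P.real s := measureReal_nonneg
    have c1 : P.real s ≤ 1 := measureReal_le_one
    rw [abs_le] at *
    constructor <;> nlinarith
  have h0 : P.real s - P.real s ^ 2 = 0 := by
    by_contra hne
    have := key (|P.real s - P.real s ^ 2| / 8) (by positivity)
    have : 0 < |P.real s - P.real s ^ 2| := abs_pos.2 hne
    linarith
  have h01 : P.real s = 0 ∨ P.real s = 1 := by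
    have : P.real s * (1 - P.real s) = 0 := by linarith
    rcases mul_eq_zero.1 this with h | h
    · exact Or.inl h
    · exact Or.inr (by linarith)
  rw [eventuallyConst_set']
  rcases h01 with h | h
  · left
    rwa [ae_eq_empty, ← measureReal_eq_zero_iff]
  · right
    rw [ae_eq_univ, prob_compl_eq_zero_iff hs]
    rwa [measureReal_def, ENNReal.toReal_eq_one_iff] at h

/-- Both shifts have the same invariant sets. The backward version serves averages and recurrence
over the past. -/
lemma ergodic_shift_neg_one : Ergodic (shift (-1)) (iidLaw ν) := by
  refine { toMeasurePreserving := measurePreserving_shift ν (-1), aeconst_set := ?_ }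
  intro s hs hinv
  refine (ergodic_shift_one ν).aeconst_set hs ?_
  conv_lhs => rw [← hinv]
  ext z
  simp [shift_shift]

variable {ν} {f : (ℤ → ℝ) → ℝ}

lemma birkhoffAverage_shift (t : ℤ) (n : ℕ) (z : ℤ → ℝ) :
    birkhoffAverage ℝ (shift t) f n z = (∑ i ∈ Finset.range n, f (shift (i * t) z)) / n := by
  simp only [birkhoffAverage, birkhoffSum, shift_iterate, smul_eq_mul]
  rw [div_eq_inv_mul]

/-- Forward averages along the shift. -/
lemma ae_tendsto_average_shift (hfm : Measurable f) (hf : Integrable f (iidLaw ν)) :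
    ∀ᵐ z ∂(iidLaw ν), Tendsto (fun n : ℕ => (∑ i ∈ Finset.range n, f (shift i z)) / n) atTop
      (𝓝 (∫ z, f z ∂(iidLaw ν))) := by
  filter_upwards [ae_tendsto_birkhoffAverage (ergodic_shift_one ν) hfm hf] with z hz
  simpa [birkhoffAverage_shift] using hz

/-- Backward averages along the shift. -/
lemma ae_tendsto_average_shift_neg (hfm : Measurable f) (hf : Integrable f (iidLaw ν)) :
    ∀ᵐ z ∂(iidLaw ν), Tendsto (fun n : ℕ => (∑ i ∈ Finset.range n, f (shift (-i) z)) / n) atTop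
      (𝓝 (∫ z, f z ∂(iidLaw ν))) := by
  filter_upwards [ae_tendsto_birkhoffAverage (ergodic_shift_neg_one ν) hfm hf] with z hz
  simpa [birkhoffAverage_shift] using hz

lemma ae_all_shift {p : (ℤ → ℝ) → Prop} (h : ∀ᵐ z ∂(iidLaw ν), p z) :
    ∀ᵐ z ∂(iidLaw ν), ∀ t : ℤ, p (shift t z) :=
  ae_all_iff.2 fun t => (measurePreserving_shift ν t).quasiMeasurePreserving.ae h

end Shift

/-! ### Geometric moving averages along the shift. -/

section GeometricSeries

/-- The geometric moving average `∑ b ^ k y(T ^ (-1-k) z)` along the shift `T`. -/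
def geoSum (b : ℝ) (y : (ℤ → ℝ) → ℝ) (z : ℤ → ℝ) : ℝ :=
  ∑' k : ℕ, b ^ k * y (shift (-1 - k) z)

variable {b : ℝ} {y : (ℤ → ℝ) → ℝ} {z : ℤ → ℝ} {ν : Measure ℝ} [IsProbabilityMeasure ν]

lemma measurable_geoSum (hy : Measurable y) : Measurable (geoSum b y) :=
  Measurable.tsum fun k : ℕ => (hy.comp (measurable_shift (-1 - k))).const_mul (b ^ k)

lemma hasSum_geoSum (h : Summable fun k : ℕ => b ^ k * y (shift (-1 - k) z)) :
    HasSum (fun k : ℕ => b ^ k * y (shift (-1 - k) z)) (geoSum b y z) := h.hasSum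

lemma geoSum_term_shift (z : ℤ → ℝ) (k : ℕ) :
    b ^ (k + 1) * y (shift (-1 - (k + 1 : ℕ)) (shift 1 z))
      = b * (b ^ k * y (shift (-1 - k) z)) := by
  rw [shift_shift, pow_succ]
  have : (-1 - ((k + 1 : ℕ) : ℤ) + 1) = -1 - k := by push_cast; ring
  rw [this]; ring

lemma summable_geoSum_shift (h : Summable fun k : ℕ => b ^ k * y (shift (-1 - k) z)) :
    Summable fun k : ℕ => b ^ k * y (shift (-1 - k) (shift 1 z)) := by
  rw [← summable_nat_add_iff 1]
  simp_rw [geoSum_term_shift]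
  exact h.mul_left b

lemma geoSum_shift (h : Summable fun k : ℕ => b ^ k * y (shift (-1 - k) z)) :
    geoSum b y (shift 1 z) = y z + b * geoSum b y z := by
  have h1 := hasSum_geoSum (summable_geoSum_shift h)
  rw [← hasSum_nat_add_iff' 1] at h1
  simp_rw [geoSum_term_shift] at h1
  have h2 := h1.unique ((hasSum_geoSum h).mul_left b)
  simp [shift_shift] at h2
  linarith

/-- By Tonelli and shift invariance the `k`-th term has `L¹` norm `|b| ^ k ‖y‖₁`. Almost sure
summability and integrability of the sum both follow from this. -/
lemma lintegral_geoSum_ne_top (hb : |b| < 1) (hym : Measurable y)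
    (hy : Integrable y (iidLaw ν)) :
    ∫⁻ z, ∑' k : ℕ, ‖b ^ k * y (shift (-1 - k) z)‖ₑ ∂(iidLaw ν) ≠ ⊤ := by
  have hmk : ∀ k : ℕ, Measurable fun z => ‖b ^ k * y (shift (-1 - k) z)‖ₑ := fun k =>
    ((hym.comp (measurable_shift (-1 - k))).const_mul (b ^ k)).enorm
  rw [lintegral_tsum fun k => (hmk k).aemeasurable]
  have e : ∀ k : ℕ, ∫⁻ z, ‖b ^ k * y (shift (-1 - k) z)‖ₑ ∂(iidLaw ν)
      = ‖b‖ₑ ^ k * ∫⁻ z, ‖y z‖ₑ ∂(iidLaw ν) := by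
    intro k
    simp_rw [enorm_mul, enorm_pow]
    have hy' : Measurable fun z => ‖y (shift (-1 - k) z)‖ₑ :=
      (hym.comp (measurable_shift _)).enorm
    rw [lintegral_const_mul _ hy']
    congr 1
    exact (measurePreserving_shift ν _).lintegral_comp hym.enorm
  simp_rw [e]
  rw [ENNReal.tsum_mul_right]
  refine ENNReal.mul_ne_top ?_ hy.2.ne
  rw [ENNReal.tsum_geometric]
  refine ENNReal.inv_ne_top.2 (tsub_pos_iff_lt.2 ?_).ne'
  rw [Real.enorm_eq_ofReal_abs]
  exact ENNReal.ofReal_lt_one.2 hb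

lemma ae_summable_geoSum (hb : |b| < 1) (hym : Measurable y) (hy : Integrable y (iidLaw ν)) :
    ∀ᵐ z ∂(iidLaw ν), Summable fun k : ℕ => b ^ k * y (shift (-1 - k) z) := by
  have hmk : ∀ k : ℕ, Measurable fun z => ‖b ^ k * y (shift (-1 - k) z)‖ₑ := fun k =>
    ((hym.comp (measurable_shift (-1 - k))).const_mul (b ^ k)).enorm
  have := ae_lt_top' (Measurable.tsum hmk).aemeasurable
    (lintegral_geoSum_ne_top hb hym hy)
  filter_upwards [this] with z hz
  refine Summable.of_norm ?_
  have h2 := ENNReal.summable_toReal hz.ne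
  refine h2.congr fun k => ?_
  simp

lemma integrable_geoSum (hb : |b| < 1) (hym : Measurable y) (hy : Integrable y (iidLaw ν)) :
    Integrable (geoSum b y) (iidLaw ν) := by
  refine ⟨(measurable_geoSum hym).aestronglyMeasurable, ?_⟩
  refine lt_of_le_of_lt (lintegral_mono_ae ?_) (lintegral_geoSum_ne_top hb hym hy).lt_top
  filter_upwards [ae_summable_geoSum hb hym hy] with z hz
  rw [← (hasSum_geoSum hz).tsum_eq]
  exact enorm_tsum_le_tsum_enorm

end GeometricSeries

/-! ### The model as a function of the innovations. -/

section Canonical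

/-- The innovation `α + γ y + δ |y|` of the log-volatility recursion. -/
def xi (θ : Param) (y : ℝ) : ℝ := alpha θ + gamma θ * y + delta θ * |y|

/-- The stationary log-volatility as a function of the innovations. -/
def arVol (θ : Param) : (ℤ → ℝ) → ℝ := geoSum (beta θ) fun z => xi θ (z 0)

/-- The observation as a function of the innovations. -/
def obsOf (θ : Param) (z : ℤ → ℝ) : ℝ := Real.exp (arVol θ z / 2) * z 0

/-- The moment conditions on the law of the innovations. -/
structure IsStdLaw (ν : Measure ℝ) : Prop where
  prob : IsProbabilityMeasure ν
  integrable : Integrable (fun y => y) ν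
  integrable_sq : Integrable (fun y => y ^ 2) ν
  mean : ∫ y, y ∂ν = 0
  var : ∫ y, y ^ 2 ∂ν = 1

variable {θ : Param} {ν : Measure ℝ}

lemma measurable_xi : Measurable (xi θ) := by unfold xi; fun_prop

lemma measurable_arVol : Measurable (arVol θ) :=
  measurable_geoSum (measurable_xi.comp (measurable_pi_apply 0))

lemma measurable_obsOf : Measurable (obsOf θ) :=
  (Real.measurable_exp.comp (measurable_arVol.div_const 2)).mul (measurable_pi_apply 0)

lemma integrable_comp_coord [IsProbabilityMeasure ν] {g : ℝ → ℝ} (hg : Integrable g ν) (k : ℤ) :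
    Integrable (fun z : ℤ → ℝ => g (z k)) (iidLaw ν) :=
  (measurePreserving_eval_infinitePi (fun _ : ℤ => ν) k).integrable_comp_of_integrable hg

variable [IsProbabilityMeasure ν]

lemma integrable_xi (hν : IsStdLaw ν) :
    Integrable (fun z : ℤ → ℝ => xi θ (z 0)) (iidLaw ν) :=
  integrable_comp_coord (g := xi θ) (((integrable_const _).add (hν.integrable.const_mul _)).add
    (hν.integrable.abs.const_mul _)) 0

lemma ae_summable_arVol (hν : IsStdLaw ν) (hθ : |beta θ| < 1) :
    ∀ᵐ z ∂(iidLaw ν), Summable fun k : ℕ => beta θ ^ k * xi θ (shift (-1 - k) z 0) :=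
  ae_summable_geoSum (y := fun z => xi θ (z 0)) hθ (measurable_xi.comp (measurable_pi_apply 0))
    (integrable_xi hν)

lemma integrable_arVol (hν : IsStdLaw ν) (hθ : |beta θ| < 1) : Integrable (arVol θ) (iidLaw ν) :=
  integrable_geoSum hθ (measurable_xi.comp (measurable_pi_apply 0)) (integrable_xi hν)

lemma ae_arVol_shift (hν : IsStdLaw ν) (hθ : |beta θ| < 1) :
    ∀ᵐ z ∂(iidLaw ν), ∀ t : ℤ,
      arVol θ (shift (t + 1) z) = xi θ (z t) + beta θ * arVol θ (shift t z) := by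
  filter_upwards [ae_all_shift (ae_summable_arVol hν hθ)] with z hz t
  have := geoSum_shift (b := beta θ) (y := fun z => xi θ (z 0)) (hz t)
  rw [shift_shift, add_comm 1 t] at this
  simpa [shift_apply] using! this

/-- Only a logarithmic moment is asked of the observations, since `exp (arVol / 2)` need not be
integrable: `1 + exp (a / 2) |y| ≤ exp |a| (1 + |y|) ≤ exp (|a| + |y|)`. -/
lemma integrable_log_obsOf (hν : IsStdLaw ν) (hθ : |beta θ| < 1) :
    Integrable (fun z => Real.log (1 + |obsOf θ z|)) (iidLaw ν) := by
  refine Integrable.mono' ((integrable_arVol hν hθ).abs.add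
    (integrable_comp_coord hν.integrable.abs 0)) ?_ (ae_of_all _ fun z => ?_)
  · exact (Real.measurable_log.comp (measurable_obsOf.abs.const_add 1)).aestronglyMeasurable
  · have h0 : 0 ≤ |obsOf θ z| := abs_nonneg _
    rw [Real.norm_eq_abs, abs_of_nonneg (Real.log_nonneg (by linarith))]
    change _ ≤ |arVol θ z| + |z 0|
    rw [Real.log_le_iff_le_exp (by linarith), Real.exp_add, obsOf, abs_mul, Real.abs_exp]
    have h1 : Real.exp (arVol θ z / 2) ≤ Real.exp |arVol θ z| :=
      Real.exp_le_exp.2 (by linarith [le_abs_self (arVol θ z), abs_nonneg (arVol θ z)])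
    have h2 : 1 ≤ Real.exp |arVol θ z| := Real.one_le_exp (abs_nonneg _)
    have h3 := Real.add_one_le_exp |z 0|
    have h4 := abs_nonneg (z 0)
    calc 1 + Real.exp (arVol θ z / 2) * |z 0| ≤ Real.exp |arVol θ z|
          + Real.exp |arVol θ z| * |z 0| := by gcongr
      _ = Real.exp |arVol θ z| * (|z 0| + 1) := by ring
      _ ≤ _ := by gcongr

/-- The part of a sequence before time `0`. -/
def past (z : ℤ → ℝ) : ℤ → ℝ := fun k => if k < 0 then z k else 0

/-- Functions of the past are independent of the coordinate `0`. -/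
lemma indepFun_coord_zero {g : (ℤ → ℝ) → ℝ} (hg : Measurable g) (hp : ∀ z, g (past z) = g z) :
    IndepFun g (fun z : ℤ → ℝ => z 0) (iidLaw ν) := by
  have h := indep_iSup_of_disjoint (m := fun k : ℤ =>
    MeasurableSpace.comap (fun z : ℤ → ℝ => z k) inferInstance)
    (fun k => (measurable_pi_apply k).comap_le) (iIndepFun_coord ν)
    (S := Set.Iio 0) (T := {0}) (by simp)
  rw [IndepFun_iff_Indep]
  refine indep_of_indep_of_le_right (indep_of_indep_of_le_left h ?_) ?_
  · have e : g = g ∘ past := by ext z; exact (hp z).symm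
    rw [e, ← MeasurableSpace.comap_comp]
    refine (MeasurableSpace.comap_mono hg.comap_le).trans ?_
    rw [MeasurableSpace.pi, MeasurableSpace.comap_iSup]
    refine iSup_le fun k => ?_
    rw [MeasurableSpace.comap_comp]
    by_cases hk : k < 0
    · refine le_iSup₂_of_le k hk (le_of_eq ?_)
      congr 1; ext z; simp [past, hk]
    · have : (fun z : ℤ → ℝ => z k) ∘ past = fun _ => 0 := by ext z; simp [past, hk]
      rw [this, MeasurableSpace.comap_const]
      exact bot_le
  · exact le_iSup₂_of_le 0 rfl le_rfl

/-- The series `geoSum` starts at time `-1`, so the volatility at time `0` is independent of the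
innovation at time `0`. -/
lemma arVol_past (z : ℤ → ℝ) : arVol θ (past z) = arVol θ z := by
  unfold arVol geoSum
  congr 1; ext k
  dsimp only
  rw [shift_apply, shift_apply, past, if_pos (by omega)]

end Canonical

/-! ### From the given probability space to sequence space. -/

section Transfer

variable {Ω : Type*} [MeasurableSpace Ω] {μ : Measure Ω} {Z V : ℤ → Ω → ℝ} {θ₀ : Param}

/-- The path of the innovations. -/
def innov (Z : ℤ → Ω → ℝ) (ω : Ω) : ℤ → ℝ := fun k => Z k ω

lemma IsInnovation.isStdLaw [IsProbabilityMeasure μ] (h : IsInnovation μ Z) :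
    IsStdLaw (μ.map (Z 0)) := by
  have hm := (h.measurable 0).aemeasurable (μ := μ)
  have hi : Integrable (Z 0) μ := h.memLp.integrable (by norm_num)
  refine ⟨Measure.isProbabilityMeasure_map hm, ?_, ?_, ?_, ?_⟩
  · exact (integrable_map_measure (f := Z 0) (g := fun y => y)
      measurable_id.aestronglyMeasurable hm).2 hi
  · exact (integrable_map_measure (f := Z 0) (g := fun y => y ^ 2)
      (by fun_prop) hm).2 h.memLp.integrable_sq
  · rw [integral_map (f := fun y => y) hm measurable_id.aestronglyMeasurable]; exact h.mean_zero
  · rw [integral_map hm (by fun_prop)]; exact h.var_one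

lemma IsInnovation.measurePreserving (h : IsInnovation μ Z)
    [IsProbabilityMeasure (μ.map (Z 0))] :
    MeasurePreserving (innov Z) μ (iidLaw (μ.map (Z 0))) := by
  refine ⟨measurable_pi_lambda _ h.measurable, ?_⟩
  have := h.indep.map_fun_eq_infinitePi_map h.measurable
  change μ.map (fun ω i => Z i ω) = _
  rw [this]
  congr 1
  ext1 i
  exact (h.identDistrib i).map_eq

lemma IsEGARCH.ae_eq_partialSum (h : IsEGARCH μ Z V θ₀) (t : ℤ) :
    ∀ᵐ ω ∂μ, ∀ n : ℕ, V t ω = ∑ k ∈ Finset.range n, beta θ₀ ^ k * xi θ₀ (Z (t - 1 - k) ω)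
      + beta θ₀ ^ n * V (t - n) ω := by
  filter_upwards [ae_all_iff.2 h.recursion] with ω hω n
  induction n with
  | zero => simp
  | succ n ih =>
    rw [ih, Finset.sum_range_succ]
    have := hω (t - 1 - n)
    rw [show t - 1 - (n : ℤ) + 1 = t - n by ring] at this
    rw [this, xi, show t - ((n + 1 : ℕ) : ℤ) = t - 1 - n by push_cast; ring]
    ring

/-- Unrolling the recursion `n` times leaves the remainder `β₀ ^ n V_{t-n}`, which vanishes in
probability. The partial sums converge almost surely to the series, and limits in measure are
unique. -/
lemma IsEGARCH.ae_eq_arVol [IsProbabilityMeasure μ] (h : IsEGARCH μ Z V θ₀)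
    [IsProbabilityMeasure (μ.map (Z 0))] :
    ∀ᵐ ω ∂μ, ∀ t : ℤ, V t ω = arVol θ₀ (shift t (innov Z ω)) := by
  have hν := h.innovation.isStdLaw
  have hmp := h.innovation.measurePreserving
  have hsum : ∀ᵐ ω ∂μ, ∀ t : ℤ, Summable fun k : ℕ =>
      beta θ₀ ^ k * xi θ₀ (shift (-1 - k) (shift t (innov Z ω)) 0) :=
    hmp.quasiMeasurePreserving.ae (ae_all_shift (ae_summable_arVol hν h.abs_beta_lt_one))
  refine ae_all_iff.2 fun t => ?_
  have h1 : TendstoInMeasure μ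
      (fun (n : ℕ) ω => ∑ k ∈ Finset.range n, beta θ₀ ^ k * xi θ₀ (Z (t - 1 - k) ω)) atTop
      (fun ω => arVol θ₀ (shift t (innov Z ω))) := by
    refine tendstoInMeasure_of_tendsto_ae (fun n => ?_) ?_
    · refine Measurable.aestronglyMeasurable ?_
      exact Finset.measurable_sum _ fun k _ =>
        (measurable_xi.comp (h.innovation.measurable _)).const_mul _
    · filter_upwards [hsum] with ω hω
      have := (hasSum_geoSum (y := fun z => xi θ₀ (z 0)) (hω t)).tendsto_sum_nat
      refine this.congr fun n => Finset.sum_congr rfl fun k _ => ?_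
      simp only [shift_apply, innov]
      congr 3; ring
  have h2 : TendstoInMeasure μ
      (fun (n : ℕ) ω => ∑ k ∈ Finset.range n, beta θ₀ ^ k * xi θ₀ (Z (t - 1 - k) ω)) atTop
      (V t) := by
    rw [tendstoInMeasure_iff_dist]
    intro ε hε
    have hlaw : ∀ s : ℤ, μ.map (V s) = μ.map (V 0) := fun s => by
      have := (h.stationary s).comp (u := fun v : ℤ → ℝ => v 0) (measurable_pi_apply 0)
      simpa [Function.comp_def] using this.map_eq
    have hb0 : Tendsto (fun n : ℕ => |beta θ₀| ^ n) atTop (𝓝 0) :=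
      tendsto_pow_atTop_nhds_zero_of_lt_one (abs_nonneg _) h.abs_beta_lt_one
    have h3 : Tendsto (fun n : ℕ => μ {ω | ε ≤ |beta θ₀ ^ n * V 0 ω|}) atTop (𝓝 0) := by
      have : TendstoInMeasure μ (fun (n : ℕ) ω => beta θ₀ ^ n * V 0 ω) atTop (fun _ => 0) := by
        refine tendstoInMeasure_of_tendsto_ae
          (fun n => ((h.measurable 0).const_mul _).aestronglyMeasurable) (ae_of_all _ fun ω => ?_)
        have := (tendsto_pow_atTop_nhds_zero_of_abs_lt_one h.abs_beta_lt_one).mul_const (V 0 ω)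
        simpa using this
      rw [tendstoInMeasure_iff_dist] at this
      simpa using this ε hε
    refine h3.congr fun n => ?_
    have hms : MeasurableSet {v : ℝ | ε ≤ |beta θ₀ ^ n * v|} :=
      measurableSet_le measurable_const (measurable_id.const_mul _).abs
    -- Stationarity trades the moving variable `V (t - n)` for the fixed variable `V 0`, for which
    -- the convergence is pointwise.
    have e1 : μ {ω | ε ≤ |beta θ₀ ^ n * V 0 ω|} = μ {ω | ε ≤ |beta θ₀ ^ n * V (t - n) ω|} := by
      have a := Measure.map_apply (μ := μ) (h.measurable 0) hms
      have b := Measure.map_apply (μ := μ) (h.measurable (t - n)) hms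
      rw [hlaw] at b
      exact a.symm.trans b
    rw [e1]
    refine measure_congr ?_
    filter_upwards [h.ae_eq_partialSum t] with ω hω
    have e := hω n
    refine propext ?_
    change ε ≤ |_| ↔ ε ≤ dist _ _
    rw [Real.dist_eq, abs_sub_comm]
    conv_rhs => rw [e, add_sub_cancel_left]
  exact tendstoInMeasure_ae_unique h2 h1

lemma IsEGARCH.ae_obs_eq [IsProbabilityMeasure μ] (h : IsEGARCH μ Z V θ₀)
    [IsProbabilityMeasure (μ.map (Z 0))] :
    ∀ᵐ ω ∂μ, ∀ t : ℤ, obs Z V t ω = obsOf θ₀ (shift t (innov Z ω)) := by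
  filter_upwards [h.ae_eq_arVol] with ω hω t
  simp [obs, obsOf, hω t, shift_apply, innov]

end Transfer

/-! ### Deterministic estimates for the inverted recursion at one parameter. -/

section Recursion

/-- The shock `γ x + δ |x|`. -/
def drive (θ : Param) (x : ℝ) : ℝ := gamma θ * x + delta θ * |x|

/-- The fixed point `α / (1 - β)` of the recursion without shocks. -/
def fixpt (θ : Param) : ℝ := alpha θ / (1 - beta θ)

variable {θ : Param} {x : ℕ → ℝ} {s : ℝ}

lemma drive_nonneg (h : |gamma θ| ≤ delta θ) (y : ℝ) : 0 ≤ drive θ y := by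
  have h1 : |gamma θ * y| ≤ delta θ * |y| := by rw [abs_mul]; gcongr
  have := neg_abs_le (gamma θ * y)
  unfold drive; linarith

lemma phi_sub_fixpt (hβ : beta θ < 1) (c y : ℝ) :
    phi θ c y - fixpt θ = beta θ * (y - fixpt θ) + drive θ c * Real.exp (-y / 2) := by
  have h : alpha θ = fixpt θ * (1 - beta θ) := by
    rw [fixpt, div_mul_cancel₀]; linarith
  rw [phi, h, drive]; ring

lemma gHat_add (i j : ℕ) :
    gHat x θ s (i + j) = gHat (fun k => x (i + k)) θ (gHat x θ s i) j := by
  induction j with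
  | zero => rfl
  | succ j ih =>
    change phi θ (x (i + j)) (gHat x θ s (i + j)) = phi θ (x (i + j)) _
    rw [ih]

lemma gHat_congr {x' : ℕ → ℝ} {n : ℕ} (h : ∀ i < n, x i = x' i) :
    gHat x θ s n = gHat x' θ s n := by
  induction n with
  | zero => rfl
  | succ n ih =>
    change phi θ (x n) (gHat x θ s n) = phi θ (x' n) (gHat x' θ s n)
    rw [ih fun i hi => h i (by omega), h n (by omega)]

/-- Shocks only push upwards, so a deficit below the fixed point shrinks at least geometrically. -/
lemma le_gHat_sub_fixpt (h0 : 0 ≤ beta θ) (h1 : beta θ < 1) (hc : |gamma θ| ≤ delta θ) (n : ℕ) :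
    beta θ ^ n * (s - fixpt θ) ≤ gHat x θ s n - fixpt θ := by
  induction n with
  | zero => simp [gHat]
  | succ n ih =>
    change _ ≤ phi θ (x n) (gHat x θ s n) - fixpt θ
    rw [phi_sub_fixpt h1, pow_succ']
    have := mul_le_mul_of_nonneg_left ih h0
    have : 0 ≤ drive θ (x n) * Real.exp (-gHat x θ s n / 2) :=
      mul_nonneg (drive_nonneg hc _) (Real.exp_pos _).le
    linarith

/-- The slope in `y` is `β` minus a term between `0` and `drive θ c * exp (-l / 2) / 2`. At `l =
fixpt θ` the constant is `lipCoeff`; a higher floor `l` gives a smaller one, which is what the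
boundary case exploits. -/
lemma abs_phi_sub_phi_le (hc : |gamma θ| ≤ delta θ) {l c y y' : ℝ}
    (hy : l ≤ y) (hy' : l ≤ y') :
    |phi θ c y - phi θ c y'|
      ≤ max (beta θ) ((1 / 2) * drive θ c * Real.exp (-l / 2) - beta θ) * |y - y'| := by
  wlog hle : y' ≤ y generalizing y y'
  · rw [abs_sub_comm, abs_sub_comm y]
    exact this hy' hy (le_of_not_ge hle)
  set R := max (beta θ) ((1 / 2) * drive θ c * Real.exp (-l / 2) - beta θ)
  have hd := drive_nonneg hc c
  have e : phi θ c y - phi θ c y'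
      = beta θ * (y - y') - drive θ c * (Real.exp (-y' / 2) - Real.exp (-y / 2)) := by
    simp only [phi, drive]; ring
  have e0 : 0 ≤ Real.exp (-y' / 2) - Real.exp (-y / 2) :=
    sub_nonneg.2 (Real.exp_le_exp.2 (by linarith))
  have e1 : Real.exp (-y' / 2) - Real.exp (-y / 2) ≤ Real.exp (-l / 2) * ((y - y') / 2) := by
    have h2 : Real.exp (-y / 2) = Real.exp (-y' / 2) * Real.exp (-(y - y') / 2) := by
      rw [← Real.exp_add]; congr 1; ring
    have h3 : 1 - Real.exp (-(y - y') / 2) ≤ (y - y') / 2 := by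
      have := Real.add_one_le_exp (-(y - y') / 2)
      linarith
    have h4 : Real.exp (-y' / 2) ≤ Real.exp (-l / 2) := Real.exp_le_exp.2 (by linarith)
    rw [h2, show Real.exp (-y' / 2) - Real.exp (-y' / 2) * Real.exp (-(y - y') / 2)
      = Real.exp (-y' / 2) * (1 - Real.exp (-(y - y') / 2)) by ring]
    calc _ ≤ Real.exp (-y' / 2) * ((y - y') / 2) := by gcongr
      _ ≤ _ := by
        have : 0 ≤ (y - y') / 2 := by linarith
        gcongr
  have hyy : 0 ≤ y - y' := by linarith
  rw [e, abs_of_nonneg hyy, abs_le]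
  have m1 := mul_le_mul_of_nonneg_left e1 hd
  have m0 := mul_nonneg hd e0
  have r1 := mul_le_mul_of_nonneg_right (le_max_left (beta θ)
    ((1 / 2) * drive θ c * Real.exp (-l / 2) - beta θ)) hyy
  have r2 := mul_le_mul_of_nonneg_right (le_max_right (beta θ)
    ((1 / 2) * drive θ c * Real.exp (-l / 2) - beta θ)) hyy
  constructor
  · change -(R * (y - y')) ≤ _
    nlinarith
  · change _ ≤ R * (y - y')
    linarith

end Recursion

/-! ### Contraction uniform over a neighbourhood, for a fixed observed path. -/

/-- Constants of a neighbourhood of a parameter `center`: `radius` bounds the distance to the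
center, `upper` the autoregressive parameter, `shift` and `slope` the affine recursion dominating
the volatility, `gain` the memory over `lag` steps, and `Real.exp (-floor)` is the smallest
contraction rate recorded. -/
structure Nbhd where
  center : Param
  radius : ℝ
  upper : ℝ
  intercept : ℝ
  slope : ℝ
  gain : ℝ
  floor : ℝ
  lag : ℕ
  radius_pos : 0 < radius
  radius_le_one : radius ≤ 1
  upper_nonneg : 0 ≤ upper
  upper_lt_one : upper < 1
  intercept_nonneg : 0 ≤ intercept
  slope_nonneg : 0 ≤ slope
  gain_nonneg : 0 ≤ gain
  center_le : |gamma center| ≤ delta center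

namespace Nbhd

/-- The parameters controlled by the constants `B`. -/
structure Mem (B : Nbhd) (θ : Param) : Prop where
  beta_nonneg : 0 ≤ beta θ
  beta_le : beta θ ≤ B.upper
  abs_beta_sub : |beta θ - beta B.center| ≤ B.radius
  abs_alpha : |alpha θ| ≤ B.intercept
  gamma_le : |gamma θ| ≤ delta θ
  drive_le : ∀ x, drive θ x ≤ drive B.center x + 2 * B.radius * |x|
  le_drive : ∀ x, drive B.center x / 2 ≤ drive θ x
  drive_exp_le : ∀ x, drive θ x * Real.exp (-(fixpt B.center - 2 * B.radius) / 2) ≤ B.slope * |x|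
  le_fixpt : fixpt B.center - B.radius ≤ fixpt θ
  gain_le : B.gain ≤ beta θ ^ B.lag

/-- A bound for the fixed points. -/
def fixBound (B : Nbhd) : ℝ := B.intercept / (1 - B.upper)

/-- The reduction of the contraction rate by a past shock `x`, when the dominating process
is `u`. -/
def damp (B : Nbhd) (x u : ℝ) : ℝ :=
  Real.exp (-(1 / 2) * (B.gain * Real.exp (-(u + 1) / 2) * min (drive B.center x / 2) 1))

/-- The contraction rate at the observation `x`, after the observation `x'` and the value `u` of
the dominating process `lag + 1` steps before. -/
def rate (B : Nbhd) (x x' u : ℝ) : ℝ :=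
  max (Real.exp (-B.floor)) (max (beta B.center + B.radius)
    ((1 / 2) * (drive B.center x + 2 * B.radius * |x|)
      * Real.exp (-(fixpt B.center - 2 * B.radius) / 2) * B.damp x' u
      - (beta B.center - B.radius)))

/-- The dominating process along the observations `x`. -/
def Dominates (B : Nbhd) (x U : ℕ → ℝ) : Prop :=
  (∀ i, B.fixBound ≤ U i) ∧ ∀ i, U (i + 1) = B.intercept + B.slope * |x i| + B.upper * U i

variable {B : Nbhd} {θ : Param} {x U : ℕ → ℝ} {s s' : ℝ}

lemma fixBound_nonneg (B : Nbhd) : 0 ≤ B.fixBound :=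
  div_nonneg B.intercept_nonneg (by linarith [B.upper_lt_one])

lemma rate_pos (x x' u : ℝ) : 0 < B.rate x x' u := lt_max_of_lt_left (Real.exp_pos _)

lemma Mem.beta_lt_one (h : B.Mem θ) : beta θ < 1 := h.beta_le.trans_lt B.upper_lt_one

lemma Mem.abs_fixpt_le (h : B.Mem θ) : |fixpt θ| ≤ B.fixBound := by
  have h1 := h.beta_lt_one
  have h2 := B.upper_lt_one
  rw [fixpt, abs_div, abs_of_pos (by linarith : 0 < 1 - beta θ), fixBound]
  have := h.beta_le
  exact div_le_div₀ B.intercept_nonneg h.abs_alpha (by linarith) (by linarith)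

lemma Mem.le_gHat (h : B.Mem θ) (hs : fixpt θ - B.radius ≤ s) (n : ℕ) :
    fixpt θ - B.radius ≤ gHat x θ s n := by
  have h1 := le_gHat_sub_fixpt (x := x) (s := s) h.beta_nonneg h.beta_lt_one h.gamma_le n
  have h2 : beta θ ^ n ≤ 1 := pow_le_one₀ h.beta_nonneg h.beta_lt_one.le
  have h3 : 0 ≤ beta θ ^ n := pow_nonneg h.beta_nonneg n
  have h4 := B.radius_pos
  nlinarith

lemma Mem.fixpt_le_gHat (h : B.Mem θ) (hs : fixpt θ ≤ s) (n : ℕ) : fixpt θ ≤ gHat x θ s n := by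
  have h1 := le_gHat_sub_fixpt (x := x) (s := s) h.beta_nonneg h.beta_lt_one h.gamma_le n
  have h3 : 0 ≤ beta θ ^ n * (s - fixpt θ) :=
    mul_nonneg (pow_nonneg h.beta_nonneg n) (by linarith)
  linarith

/-- Above the lower barrier the exponential factor is bounded, so the nonlinear step is dominated by
an affine one with constants common to the neighbourhood. -/
lemma Mem.phi_le (h : B.Mem θ) {c y : ℝ} (hy : fixpt θ - B.radius ≤ y) :
    phi θ c y ≤ B.intercept + B.slope * |c| + B.upper * max y 0 := by
  have h1 : drive θ c * Real.exp (-y / 2) ≤ B.slope * |c| := by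
    refine le_trans ?_ (h.drive_exp_le c)
    have := h.le_fixpt
    have := drive_nonneg h.gamma_le c
    gcongr
    linarith
  have h2 : beta θ * y ≤ B.upper * max y 0 :=
    calc beta θ * y ≤ beta θ * max y 0 := by
          have := h.beta_nonneg; gcongr; exact le_max_left _ _
      _ ≤ _ := by have := h.beta_le; gcongr
  have h3 := (le_abs_self _).trans h.abs_alpha
  simp only [drive] at h1
  simp only [phi]
  linarith

/-- The excess `w` of the start over the dominating process decays like `B.upper ^ n`, so a single
process eventually bounds all trajectories up to `1`. -/
lemma Mem.gHat_le (h : B.Mem θ) (hU : B.Dominates x U) (hs : fixpt θ - B.radius ≤ s) {w : ℝ}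
    (hw : 0 ≤ w) (hsw : s ≤ U 0 + w) (n : ℕ) : gHat x θ s n ≤ U n + B.upper ^ n * w := by
  induction n with
  | zero => simpa [gHat] using hsw
  | succ n ih =>
    refine (h.phi_le (h.le_gHat hs n)).trans ?_
    rw [hU.2, pow_succ']
    have h0 : 0 ≤ U n + B.upper ^ n * w :=
      add_nonneg (B.fixBound_nonneg.trans (hU.1 n)) (mul_nonneg (pow_nonneg B.upper_nonneg n) hw)
    have := mul_le_mul_of_nonneg_left (max_le ih h0) B.upper_nonneg
    linarith

lemma Dominates.shift (hU : B.Dominates x U) (n : ℕ) :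
    B.Dominates (fun i => x (n + i)) (fun i => U (n + i)) :=
  ⟨fun _ => hU.1 _, fun _ => hU.2 _⟩

/-- The improved lower bound due to the shock at time `0`. -/
lemma Mem.improved_le_gHat (h : B.Mem θ) (hs : fixpt θ - B.radius ≤ s) {u : ℝ} (hu : s ≤ u + 1) :
    fixpt B.center - 2 * B.radius
      + B.gain * Real.exp (-(u + 1) / 2) * min (drive B.center (x 0) / 2) 1
      ≤ gHat x θ s (1 + B.lag) := by
  rw [gHat_add]
  have h1 := le_gHat_sub_fixpt (x := fun k => x (1 + k)) (s := gHat x θ s 1)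
    h.beta_nonneg h.beta_lt_one h.gamma_le B.lag
  have e1 : gHat x θ s 1 - fixpt θ
      = beta θ * (s - fixpt θ) + drive θ (x 0) * Real.exp (-s / 2) :=
    phi_sub_fixpt h.beta_lt_one _ _
  rw [e1] at h1
  have hp0 : 0 ≤ beta θ ^ B.lag := pow_nonneg h.beta_nonneg _
  have hp1 : beta θ ^ B.lag ≤ 1 := pow_le_one₀ h.beta_nonneg h.beta_lt_one.le
  -- This is one of the two radii lost in the bound: the initial deficit. The other is the distance
  -- from `fixpt θ` down to `fixpt B.center`.
  have h2 : -B.radius ≤ beta θ ^ B.lag * (beta θ * (s - fixpt θ)) := by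
    have a1 : -B.radius ≤ beta θ * (s - fixpt θ) := by
      have := h.beta_nonneg; have := h.beta_lt_one; have := B.radius_pos
      nlinarith
    have := B.radius_pos
    nlinarith
  have hm0 : 0 ≤ min (drive B.center (x 0) / 2) 1 :=
    le_min (by linarith [drive_nonneg B.center_le (x 0)]) zero_le_one
  have h3 : B.gain * Real.exp (-(u + 1) / 2) * min (drive B.center (x 0) / 2) 1
      ≤ beta θ ^ B.lag * (drive θ (x 0) * Real.exp (-s / 2)) := by
    have a1 : min (drive B.center (x 0) / 2) 1 ≤ drive θ (x 0) :=
      (min_le_left _ _).trans (h.le_drive _)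
    have a2 : Real.exp (-(u + 1) / 2) ≤ Real.exp (-s / 2) := Real.exp_le_exp.2 (by linarith)
    calc _ = B.gain * (min (drive B.center (x 0) / 2) 1 * Real.exp (-(u + 1) / 2)) := by ring
      _ ≤ beta θ ^ B.lag * (drive θ (x 0) * Real.exp (-s / 2)) := by
        have := h.gain_le
        have := drive_nonneg h.gamma_le (x 0)
        gcongr
  have := h.le_fixpt
  nlinarith

lemma damp_pos (x u : ℝ) : 0 < B.damp x u := Real.exp_pos _

/-- One step of contraction between two trajectories in the controlled region. -/
lemma Mem.abs_phi_sub_phi_le_rate (h : B.Mem θ) {c c' u y y' : ℝ}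
    (hy : fixpt B.center - 2 * B.radius
      + B.gain * Real.exp (-(u + 1) / 2) * min (drive B.center c' / 2) 1 ≤ y)
    (hy' : fixpt B.center - 2 * B.radius
      + B.gain * Real.exp (-(u + 1) / 2) * min (drive B.center c' / 2) 1 ≤ y') :
    |phi θ c y - phi θ c y'| ≤ B.rate c c' u * |y - y'| := by
  refine (abs_phi_sub_phi_le h.gamma_le hy hy').trans ?_
  gcongr
  refine le_max_of_le_right (max_le_max ?_ ?_)
  · have := (abs_le.1 h.abs_beta_sub).2; linarith
  · have e : Real.exp (-(fixpt B.center - 2 * B.radius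
        + B.gain * Real.exp (-(u + 1) / 2) * min (drive B.center c' / 2) 1) / 2)
        = Real.exp (-(fixpt B.center - 2 * B.radius) / 2) * B.damp c' u := by
      rw [damp, ← Real.exp_add]; congr 1; ring
    rw [e, ← mul_assoc]
    have h1 := (abs_le.1 h.abs_beta_sub).1
    have h2 := h.drive_le c
    have h3 := B.damp_pos c' u
    gcongr ?_ - ?_
    · gcongr
    · linarith

/-- Contraction between two trajectories in the controlled region. -/
lemma Mem.abs_gHat_sub_le_prod (h : B.Mem θ) (hU : B.Dominates x U)
    (hs : fixpt θ - B.radius ≤ s) (hs' : fixpt θ - B.radius ≤ s')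
    (hsu : s ≤ U 0 + 1) (hsu' : s' ≤ U 0 + 1) (n : ℕ) :
    |gHat x θ s (1 + B.lag + n) - gHat x θ s' (1 + B.lag + n)|
      ≤ (U (1 + B.lag) + B.fixBound + 2)
        * ∏ i ∈ Finset.range n, B.rate (x (1 + B.lag + i)) (x i) (U i) := by
  have up : ∀ s, fixpt θ - B.radius ≤ s → s ≤ U 0 + 1 → ∀ i, gHat x θ s i ≤ U i + 1 := by
    intro s hs hsu i
    have := h.gHat_le hU hs zero_le_one hsu i
    have : B.upper ^ i ≤ 1 := pow_le_one₀ B.upper_nonneg B.upper_lt_one.le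
    linarith
  induction n with
  | zero =>
    simp only [Finset.range_zero, Finset.prod_empty, mul_one, add_zero]
    have a1 := h.le_gHat (x := x) hs (1 + B.lag)
    have a2 := h.le_gHat (x := x) hs' (1 + B.lag)
    have a3 := up s hs hsu (1 + B.lag)
    have a4 := up s' hs' hsu' (1 + B.lag)
    have a5 := (abs_le.1 h.abs_fixpt_le).1
    have a6 := B.radius_le_one
    rw [abs_le]; constructor <;> linarith
  | succ n ih =>
    -- The lift at time `1 + B.lag + n` comes from the shock at time `n`; hence the `1 + B.lag`
    -- warm-up steps before the first factor.
    have low : ∀ s, fixpt θ - B.radius ≤ s → s ≤ U 0 + 1 → fixpt B.center - 2 * B.radius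
        + B.gain * Real.exp (-(U n + 1) / 2) * min (drive B.center (x n) / 2) 1
        ≤ gHat x θ s (1 + B.lag + n) := by
      intro s hs hsu
      rw [add_comm _ n, gHat_add]
      exact h.improved_le_gHat (x := fun k => x (n + k)) (h.le_gHat hs n) (up s hs hsu n)
    rw [Finset.prod_range_succ, ← mul_assoc, mul_comm _ (B.rate _ _ _)]
    refine (h.abs_phi_sub_phi_le_rate (low s hs hsu) (low s' hs' hsu')).trans ?_
    exact mul_le_mul_of_nonneg_left ih (B.rate_pos _ _ _).le

/-- Trajectories started from a bounded set are bounded, uniformly in the parameter. -/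
lemma exists_abs_gHat_le (B : Nbhd) (x : ℕ → ℝ) (C : ℝ) (n : ℕ) :
    ∃ C', ∀ θ, B.Mem θ → ∀ s, |s| ≤ C → |gHat x θ s n| ≤ C' := by
  induction n with
  | zero => exact ⟨C, fun θ _ s hs => hs⟩
  | succ n ih =>
    obtain ⟨C', hC'⟩ := ih
    refine ⟨B.intercept + B.upper * C'
      + (drive B.center (x n) + 2 * B.radius * |x n|) * Real.exp (C' / 2), fun θ h s hs => ?_⟩
    have h1 := hC' θ h s hs
    have h2 := drive_nonneg h.gamma_le (x n)
    change |alpha θ + beta θ * gHat x θ s n + drive θ (x n) * Real.exp (-gHat x θ s n / 2)| ≤ _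
    refine (abs_add_le _ _).trans
      (add_le_add ((abs_add_le _ _).trans (add_le_add h.abs_alpha ?_)) ?_)
    · rw [abs_mul, abs_of_nonneg h.beta_nonneg]
      have := h.beta_le
      have := B.upper_nonneg
      gcongr
    · rw [abs_mul, abs_of_nonneg h2, Real.abs_exp]
      have h3 := h.drive_le (x n)
      have h4 := (abs_le.1 h1).1
      have h5 : -gHat x θ s n ≤ C' := by linarith
      have h6 := h2.trans h3
      gcongr

/-- Uniform forgetting of the initial value. -/
lemma eventually_abs_gHat_sub_le (hU : B.Dominates x U)
    (hprod : Tendsto (fun n => ∏ i ∈ Finset.range n,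
      B.rate (x (1 + B.lag + i)) (x i) (U i)) atTop (𝓝 0)) (C : ℝ) {ε : ℝ} (hε : 0 < ε) :
    ∀ᶠ n in atTop, ∀ θ, B.Mem θ → ∀ s s', |s| ≤ C → |s'| ≤ C →
      |gHat x θ s n - gHat x θ s' n| ≤ ε := by
  have hpow : Tendsto (fun n : ℕ => B.upper ^ n) atTop (𝓝 0) :=
    tendsto_pow_atTop_nhds_zero_of_lt_one B.upper_nonneg B.upper_lt_one
  -- After `i₀` steps every trajectory is above the lower barrier; after `i₁` more, its excess over
  -- `U` is at most `1`. From time `T = i₀ + i₁` on the contraction estimate applies.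
  obtain ⟨i₀, hi₀⟩ : ∃ i₀ : ℕ, B.upper ^ i₀ * (|C| + B.fixBound) ≤ B.radius := by
    have := hpow.mul_const (|C| + B.fixBound)
    rw [zero_mul] at this
    exact (this.eventually (ge_mem_nhds B.radius_pos)).exists
  obtain ⟨C', hC'⟩ := exists_abs_gHat_le B x C i₀
  obtain ⟨i₁, hi₁⟩ : ∃ i₁ : ℕ, B.upper ^ i₁ * |C'| ≤ 1 := by
    have := hpow.mul_const |C'|
    rw [zero_mul] at this
    exact (this.eventually (ge_mem_nhds one_pos)).exists
  set T := i₀ + i₁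
  have start : ∀ θ, B.Mem θ → ∀ s, |s| ≤ C →
      fixpt θ - B.radius ≤ gHat x θ s T ∧ gHat x θ s T ≤ U T + 1 := by
    intro θ h s hs
    have low : fixpt θ - B.radius ≤ gHat x θ s i₀ := by
      have h1 := le_gHat_sub_fixpt (x := x) (s := s) h.beta_nonneg h.beta_lt_one h.gamma_le i₀
      have h2 : |s - fixpt θ| ≤ |C| + B.fixBound :=
        (abs_sub _ _).trans (add_le_add (hs.trans (le_abs_self C)) h.abs_fixpt_le)
      have h3 : |beta θ ^ i₀ * (s - fixpt θ)| ≤ B.radius := by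
        rw [abs_mul, abs_of_nonneg (pow_nonneg h.beta_nonneg _)]
        refine le_trans ?_ hi₀
        have := h.beta_nonneg
        have := h.beta_le
        have := pow_nonneg B.upper_nonneg i₀
        gcongr
      have := (abs_le.1 h3).1
      linarith
    rw [gHat_add]
    refine ⟨h.le_gHat low _, ?_⟩
    refine (h.gHat_le (hU.shift i₀) low (abs_nonneg C') ?_ i₁).trans ?_
    · have a1 := (le_abs_self _).trans (hC' θ h s hs)
      have a2 := B.fixBound_nonneg.trans (hU.1 i₀)
      have a3 := le_abs_self C'
      simp only [add_zero]
      linarith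
    · simp only [T]; linarith
  have hlim : Tendsto (fun n => (U (T + (1 + B.lag)) + B.fixBound + 2)
      * ∏ i ∈ Finset.range n, B.rate (x (T + (1 + B.lag + i))) (x (T + i)) (U (T + i)))
      atTop (𝓝 0) := by
    -- The first `T` factors are divided out. This is legitimate because the floor in `rate` keeps
    -- them positive.
    set p := ∏ i ∈ Finset.range T, B.rate (x (1 + B.lag + i)) (x i) (U i) with hp
    have hp0 : 0 < p := Finset.prod_pos fun i _ => B.rate_pos _ _ _
    have h1 : Tendsto (fun n => p⁻¹ * ∏ i ∈ Finset.range (n + T),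
        B.rate (x (1 + B.lag + i)) (x i) (U i)) atTop (𝓝 (p⁻¹ * 0)) :=
      ((tendsto_add_atTop_iff_nat T).2 hprod).const_mul _
    rw [mul_zero] at h1
    have h2 := h1.const_mul (U (T + (1 + B.lag)) + B.fixBound + 2)
    rw [mul_zero] at h2
    refine h2.congr fun n => ?_
    rw [add_comm n T, Finset.prod_range_add, ← hp, inv_mul_cancel_left₀ hp0.ne']
    congr 1
    refine Finset.prod_congr rfl fun i _ => ?_
    rw [show 1 + B.lag + (T + i) = T + (1 + B.lag + i) by ring]
  have hev := hlim.eventually (ge_mem_nhds hε)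
  obtain ⟨N, hN⟩ := eventually_atTop.1 hev
  refine eventually_atTop.2 ⟨T + (1 + B.lag + N), fun n hn θ h s s' hs hs' => ?_⟩
  obtain ⟨k, rfl⟩ := Nat.exists_eq_add_of_le hn
  obtain ⟨a1, a2⟩ := start θ h s hs
  obtain ⟨b1, b2⟩ := start θ h s' hs'
  have := h.abs_gHat_sub_le_prod (hU.shift T) a1 b1 a2 b2 (N + k)
  rw [← gHat_add, ← gHat_add] at this
  rw [show T + (1 + B.lag + N) + k = T + (1 + B.lag + (N + k)) by ring]
  exact this.trans (hN (N + k) (by omega))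

end Nbhd

/-! ### Backward iterates and the stationary solution. -/

section Stationary

/-- The inverted recursion at time `0`, started from the fixed point at time `-n`. -/
def back (x : (ℤ → ℝ) → ℝ) (θ : Param) (n : ℕ) (z : ℤ → ℝ) : ℝ :=
  gHat (fun i => x (shift (-n + i) z)) θ (fixpt θ) n

/-- The stationary solution of the inverted recursion. -/
def statG (x : (ℤ → ℝ) → ℝ) (θ : Param) (z : ℤ → ℝ) : ℝ := limsup (fun n => back x θ n z) atTop

/-- The path of the observations. -/
def orbit (x : (ℤ → ℝ) → ℝ) (z : ℤ → ℝ) (t : ℕ) : ℝ := x (shift t z)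

variable {x : (ℤ → ℝ) → ℝ} {z : ℤ → ℝ} {θ : Param}

lemma back_succ_shift (n : ℕ) :
    back x θ (n + 1) (shift 1 z) = phi θ (x z) (back x θ n z) := by
  change phi θ _ (gHat _ θ _ n) = _
  simp only [shift_shift]
  congr 1
  · congr 1
    have : (-((n + 1 : ℕ) : ℤ) + n + 1) = 0 := by push_cast; ring
    rw [this, shift_zero]
  · refine gHat_congr fun i _ => ?_
    congr 2; push_cast; ring

lemma back_eq_gHat {p N : ℕ} (h : N ≤ p) :
    back x θ p z = gHat (fun i => x (shift (-N + i) z)) θ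
      (gHat (fun i => x (shift (-p + i) z)) θ (fixpt θ) (p - N)) N := by
  obtain ⟨k, rfl⟩ := Nat.exists_eq_add_of_le' h
  rw [back, gHat_add, Nat.add_sub_cancel]
  refine gHat_congr fun i _ => ?_
  congr 2; push_cast; ring

end Stationary

/-! ### Convergence of backward and forward iterates at good sample points. -/

namespace Nbhd

variable (B : Nbhd) (x : (ℤ → ℝ) → ℝ)

/-- The dominating process. -/
def dom : (ℤ → ℝ) → ℝ := geoSum B.upper fun z => B.intercept + B.slope * |x z|

/-- The contraction rate at time `0`. -/
def rateAt (z : ℤ → ℝ) : ℝ :=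
  B.rate (x z) (x (shift (-(1 + B.lag)) z)) (B.dom x (shift (-(1 + B.lag)) z))

/-- The sample points from which the inverted recursions contract. -/
structure Good (z : ℤ → ℝ) : Prop where
  summable : Summable fun k : ℕ =>
    B.upper ^ k * (B.intercept + B.slope * |x (shift (-1 - k) z)|)
  forward : Tendsto (fun n : ℕ => ∏ i ∈ Finset.range n, B.rateAt x (shift i z)) atTop (𝓝 0)
  backward : ∀ ε > 0, ∃ n : ℕ, (B.dom x (shift (-n) z) + B.fixBound + 2)
    * ∏ i ∈ Finset.range n, B.rateAt x (shift (-1 - i) z) < ε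

variable {B x} {z : ℤ → ℝ} {θ : Param}

lemma fixBound_le_dom (h : B.Good x z) : B.fixBound ≤ B.dom x z := by
  have h1 := hasSum_geoSum (y := fun z => B.intercept + B.slope * |x z|) h.summable
  have h2 := (hasSum_geometric_of_lt_one B.upper_nonneg B.upper_lt_one).mul_right B.intercept
  have e : (1 - B.upper)⁻¹ * B.intercept = B.fixBound := by rw [fixBound]; field_simp
  rw [e] at h2
  refine hasSum_le (fun k => ?_) h2 h1
  have := pow_nonneg B.upper_nonneg k
  have := mul_nonneg B.slope_nonneg (abs_nonneg (x (EGARCH.shift (-1 - k) z)))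
  gcongr
  linarith

lemma dominates_orbit (h : ∀ t : ℤ, B.Good x (shift t z)) (t : ℤ) :
    B.Dominates (fun i => x (shift (t + i) z)) (fun i => B.dom x (shift (t + i) z)) := by
  refine ⟨fun i => fixBound_le_dom (h _), fun i => ?_⟩
  have := geoSum_shift (y := fun z => B.intercept + B.slope * |x z|) (h (t + i)).summable
  rw [shift_shift] at this
  dsimp only
  rw [dom, show t + ((i + 1 : ℕ) : ℤ) = 1 + (t + i) by push_cast; ring]
  exact this

lemma prod_rateAt_backward (n : ℕ) (z : ℤ → ℝ) :
    ∏ i ∈ Finset.range n, B.rateAt x (shift (-n + i) z)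
      = ∏ i ∈ Finset.range n, B.rateAt x (shift (-1 - i) z) := by
  rw [← Finset.prod_range_reflect]
  refine Finset.prod_congr rfl fun i hi => ?_
  have := Finset.mem_range.1 hi
  congr 2
  omega

lemma Mem.back_mem (hθ : B.Mem θ) (h : ∀ t : ℤ, B.Good x (shift t z)) (n : ℕ) :
    fixpt θ ≤ back x θ n z ∧ back x θ n z ≤ B.dom x z := by
  refine ⟨hθ.fixpt_le_gHat le_rfl n, ?_⟩
  have h0 := fixBound_le_dom (h (-n))
  have := hθ.gHat_le (dominates_orbit h (-n)) (s := fixpt θ) (by linarith [B.radius_pos]) le_rfl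
    (by simpa using ((le_abs_self _).trans hθ.abs_fixpt_le).trans h0) n
  simpa [back] using this

/-- Two backward iterates started long ago are both in the controlled region at time `-N`, and from
there they contract at rates that depend neither on the parameter nor on the starting times. -/
lemma exists_abs_back_sub_le (h : ∀ t : ℤ, B.Good x (shift t z)) {ε : ℝ} (hε : 0 < ε) :
    ∃ N, ∀ p ≥ N, ∀ q ≥ N, ∀ θ, B.Mem θ → |back x θ p z - back x θ q z| ≤ ε := by
  obtain ⟨n, hn⟩ := (h 0).backward ε hε
  simp only [shift_zero] at hn
  -- The first `1 + B.lag` steps are the warm-up, the other `n` contract.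
  set N := 1 + B.lag + n
  refine ⟨N, fun p hp q hq θ hθ => ?_⟩
  have start : ∀ p ≥ N, fixpt θ - B.radius
        ≤ gHat (fun i => x (shift (-p + i) z)) θ (fixpt θ) (p - N) ∧
      gHat (fun i => x (shift (-p + i) z)) θ (fixpt θ) (p - N)
        ≤ B.dom x (shift (-N + (0 : ℕ)) z) + 1 := by
    intro p hp
    refine ⟨hθ.le_gHat (by linarith [B.radius_pos]) _, ?_⟩
    have h0 := fixBound_le_dom (h (-p))
    have h1 := hθ.gHat_le (dominates_orbit h (-p)) (s := fixpt θ) (by linarith [B.radius_pos])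
      le_rfl (by simpa using ((le_abs_self _).trans hθ.abs_fixpt_le).trans h0) (p - N)
    have e : -(p : ℤ) + ((p - N : ℕ) : ℤ) = -N + (0 : ℕ) := by
      rw [Nat.cast_sub hp]; push_cast; ring
    rw [e] at h1
    linarith
  have key := hθ.abs_gHat_sub_le_prod (dominates_orbit h (-N)) (start p hp).1 (start q hq).1
    (start p hp).2 (start q hq).2 n
  rw [back_eq_gHat hp, back_eq_gHat hq]
  refine key.trans (le_trans (le_of_eq ?_) hn.le)
  rw [← prod_rateAt_backward]
  have e1 : -(N : ℤ) + ((1 + B.lag : ℕ) : ℤ) = -n := by simp only [N]; push_cast; ring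
  rw [e1]
  congr 1
  refine Finset.prod_congr rfl fun i _ => ?_
  rw [rateAt, shift_shift]
  have e2 : -(1 + (B.lag : ℤ)) + (-n + i) = -N + i := by simp only [N]; push_cast; ring
  have e3 : -(N : ℤ) + ((1 + B.lag + i : ℕ) : ℤ) = -n + i := by simp only [N]; push_cast; ring
  rw [e2, e3]

lemma Mem.tendsto_back (hθ : B.Mem θ) (h : ∀ t : ℤ, B.Good x (shift t z)) :
    Tendsto (fun n => back x θ n z) atTop (𝓝 (statG x θ z)) := by
  have : CauchySeq fun n => back x θ n z := by
    rw [Metric.cauchySeq_iff]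
    intro ε hε
    obtain ⟨N, hN⟩ := exists_abs_back_sub_le h (half_pos hε)
    exact ⟨N, fun p hp q hq => (hN p hp q hq θ hθ).trans_lt (half_lt_self hε)⟩
  obtain ⟨l, hl⟩ := cauchySeq_tendsto_of_complete this
  rw [statG, hl.limsup_eq]
  exact hl

lemma eventually_abs_back_sub_statG_le (h : ∀ t : ℤ, B.Good x (shift t z)) {ε : ℝ} (hε : 0 < ε) :
    ∀ᶠ n in atTop, ∀ θ, B.Mem θ → |back x θ n z - statG x θ z| ≤ ε := by
  obtain ⟨N, hN⟩ := exists_abs_back_sub_le h hε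
  refine eventually_atTop.2 ⟨N, fun n hn θ hθ => ?_⟩
  have := ((hθ.tendsto_back h).const_sub (back x θ n z)).abs
  exact le_of_tendsto this (eventually_atTop.2 ⟨N, fun q hq => hN n hn q hq θ hθ⟩)

lemma Mem.statG_mem (hθ : B.Mem θ) (h : ∀ t : ℤ, B.Good x (shift t z)) :
    fixpt θ ≤ statG x θ z ∧ statG x θ z ≤ B.dom x z :=
  ⟨ge_of_tendsto' (hθ.tendsto_back h) fun n => (hθ.back_mem h n).1,
    le_of_tendsto' (hθ.tendsto_back h) fun n => (hθ.back_mem h n).2⟩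

lemma good_shift (h : ∀ t : ℤ, B.Good x (shift t z)) (s : ℤ) :
    ∀ t : ℤ, B.Good x (shift t (shift s z)) := fun t => by rw [shift_shift]; exact h _

lemma continuous_phi (c : ℝ) : Continuous fun p : Param × ℝ => phi p.1 c p.2 := by
  unfold phi alpha beta gamma delta
  fun_prop

lemma Mem.statG_shift_one (hθ : B.Mem θ) (h : ∀ t : ℤ, B.Good x (shift t z)) :
    statG x θ (shift 1 z) = phi θ (x z) (statG x θ z) := by
  have h1 := (tendsto_add_atTop_iff_nat 1).2 (hθ.tendsto_back (good_shift h 1))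
  simp_rw [back_succ_shift] at h1
  have h2 : Continuous fun y => phi θ (x z) y :=
    (continuous_phi (x z)).comp (Continuous.prodMk_right θ)
  exact tendsto_nhds_unique h1 ((h2.tendsto _).comp (hθ.tendsto_back h))

lemma Mem.statG_shift (hθ : B.Mem θ) (h : ∀ t : ℤ, B.Good x (shift t z)) (n : ℕ) :
    statG x θ (shift n z) = gHat (orbit x z) θ (statG x θ z) n := by
  induction n with
  | zero => simp [gHat]
  | succ n ih =>
    have := hθ.statG_shift_one (good_shift h n)
    rw [shift_shift, add_comm] at this
    change _ = phi θ (x (shift n z)) (gHat (orbit x z) θ (statG x θ z) n)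
    rw [← ih, ← this]; push_cast; rfl

/-- Started from any bounded set, the inverted recursion approaches its stationary solution,
uniformly over the neighbourhood. -/
lemma eventually_abs_gHat_sub_statG_le (h : ∀ t : ℤ, B.Good x (shift t z)) (C : ℝ) {ε : ℝ}
    (hε : 0 < ε) :
    ∀ᶠ n : ℕ in atTop, ∀ θ, B.Mem θ → ∀ s, |s| ≤ C →
      |gHat (orbit x z) θ s n - statG x θ (shift n z)| ≤ ε := by
  have hU := dominates_orbit h 0
  simp only [zero_add] at hU
  have hp : Tendsto (fun n : ℕ => ∏ i ∈ Finset.range n, B.rate (orbit x z (1 + B.lag + i))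
      (orbit x z i) (B.dom x (shift i z))) atTop (𝓝 0) := by
    refine ((h (1 + B.lag)).forward).congr fun n => Finset.prod_congr rfl fun i _ => ?_
    rw [rateAt, shift_shift, shift_shift, orbit, orbit]
    have e1 : -(1 + (B.lag : ℤ)) + (i + (1 + B.lag)) = i := by ring
    have e2 : (i : ℤ) + (1 + B.lag) = ((1 + B.lag + i : ℕ) : ℤ) := by push_cast; ring
    rw [e1, e2]
  have := eventually_abs_gHat_sub_le hU hp (max C (B.fixBound + |B.dom x z|)) hε
  filter_upwards [this] with n hn θ hθ s hs
  rw [hθ.statG_shift h]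
  refine hn θ hθ s _ (hs.trans (le_max_left _ _)) (le_max_of_le_right ?_)
  obtain ⟨a, b⟩ := hθ.statG_mem h
  have := (abs_le.1 hθ.abs_fixpt_le).1
  have := le_abs_self (B.dom x z)
  have := abs_nonneg (B.dom x z)
  have := B.fixBound_nonneg
  rw [abs_le]; constructor <;> linarith

end Nbhd

/-! ### Joint measurability, and continuity in the parameter. -/

section Regularity

lemma measurable_gHat {S : Type*} [MeasurableSpace S] {X : S → ℕ → ℝ} {θ : S → Param} {s : S → ℝ}
    (hX : ∀ i, Measurable fun ω => X ω i) (hθ : Measurable θ) (hs : Measurable s) (n : ℕ) :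
    Measurable fun ω => gHat (X ω) (θ ω) (s ω) n := by
  have hc : ∀ i : Fin 4, Measurable fun ω => (θ ω) i := fun i => by fun_prop
  induction n with
  | zero => exact hs
  | succ n ih =>
    change Measurable fun ω => phi (θ ω) (X ω n) (gHat (X ω) (θ ω) (s ω) n)
    have h0 := hc 0
    have h1 := hc 1
    have h2 := hc 2
    have h3 := hc 3
    have hx := hX n
    unfold phi alpha beta gamma delta
    fun_prop

lemma continuous_gHat (x : ℕ → ℝ) (n : ℕ) :
    Continuous fun p : Param × ℝ => gHat x p.1 p.2 n := by
  induction n with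
  | zero => exact continuous_snd
  | succ n ih => exact (Nbhd.continuous_phi (x n)).comp (continuous_fst.prodMk ih)

lemma continuous_coord (i : Fin 4) : Continuous fun θ : Param => θ i := by fun_prop

lemma continuousOn_fixpt {C : Set Param} (hC : ∀ θ ∈ C, beta θ < 1) : ContinuousOn fixpt C := by
  refine ContinuousOn.div (continuous_coord 0).continuousOn
    (continuous_const.sub (continuous_coord 1)).continuousOn fun θ hθ => ?_
  have : beta θ < 1 := hC θ hθ
  change 1 - beta θ ≠ 0
  linarith

lemma measurable_fixpt : Measurable fixpt := by
  unfold fixpt alpha beta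
  fun_prop

/-- Defining `statG` as a `limsup` pays off here: joint measurability holds everywhere, also at
random parameters, with no convergence to check. -/
lemma measurable_statG {S : Type*} [MeasurableSpace S] {x : (ℤ → ℝ) → ℝ} (hx : Measurable x)
    {θ : S → Param} {z : S → ℤ → ℝ} (hθ : Measurable θ) (hz : Measurable z) :
    Measurable fun ω => statG x (θ ω) (z ω) :=
  Measurable.limsup fun n =>
    measurable_gHat (X := fun ω (i : ℕ) => x (shift (-n + i) (z ω)))
      (fun _ => hx.comp ((measurable_shift _).comp hz)) hθ (measurable_fixpt.comp hθ) n

/-- The backward iterates are continuous in the parameter and converge uniformly over the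
neighbourhood. -/
lemma Nbhd.continuousOn_statG {B : Nbhd} {x : (ℤ → ℝ) → ℝ} {z : ℤ → ℝ}
    (h : ∀ t : ℤ, B.Good x (shift t z)) :
    ContinuousOn (fun θ => statG x θ z) {θ | B.Mem θ} := by
  have hu : TendstoUniformlyOn (fun n θ => back x θ n z) (fun θ => statG x θ z) atTop
      {θ | B.Mem θ} := by
    rw [Metric.tendstoUniformlyOn_iff]
    intro ε hε
    filter_upwards [eventually_abs_back_sub_statG_le h (half_pos hε)] with n hn θ hθ
    rw [dist_comm]
    exact (hn θ hθ).trans_lt (half_lt_self hε)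
  refine hu.continuousOn (Frequently.of_forall fun n => ?_)
  exact (continuous_gHat _ n).comp_continuousOn
    (continuousOn_id.prodMk (continuousOn_fixpt fun θ hθ => hθ.beta_lt_one))

end Regularity

/-! ### Divergence, recurrence and vanishing products from ergodic averages. -/

section ErgodicConsequences

variable {ν : Measure ℝ} [IsProbabilityMeasure ν]

lemma tendsto_atBot_of_average {S : ℕ → ℝ} {m : ℝ} (hm : m < 0)
    (h : Tendsto (fun n : ℕ => S n / n) atTop (𝓝 m)) : Tendsto S atTop atBot := by
  have h1 : Tendsto (fun n : ℕ => (n : ℝ) * (S n / n)) atTop atBot :=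
    tendsto_natCast_atTop_atTop.atTop_mul_neg hm h
  refine h1.congr' ?_
  filter_upwards [eventually_gt_atTop 0] with n hn
  have : (n : ℝ) ≠ 0 := by exact_mod_cast hn.ne'
  field_simp

lemma tendsto_atTop_of_average {S : ℕ → ℝ} {m : ℝ} (hm : 0 < m)
    (h : Tendsto (fun n : ℕ => S n / n) atTop (𝓝 m)) : Tendsto S atTop atTop := by
  have h1 : Tendsto (fun n : ℕ => (n : ℝ) * (S n / n)) atTop atTop :=
    tendsto_natCast_atTop_atTop.atTop_mul_pos hm h
  refine h1.congr' ?_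
  filter_upwards [eventually_gt_atTop 0] with n hn
  have : (n : ℝ) ≠ 0 := by exact_mod_cast hn.ne'
  field_simp

/-- The quotient is the average of order `n + 1` minus `n / (n + 1)` times the average of order `n`.
-/
lemma tendsto_div_of_average {a : ℕ → ℝ} {m : ℝ}
    (h : Tendsto (fun n : ℕ => (∑ i ∈ Finset.range n, a i) / n) atTop (𝓝 m)) :
    Tendsto (fun n : ℕ => a n / (n + 1)) atTop (𝓝 0) := by
  have h1 := (tendsto_add_atTop_iff_nat 1).2 h
  have h2 : Tendsto (fun n : ℕ => (n : ℝ) / (n + 1)) atTop (𝓝 1) :=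
    tendsto_natCast_div_add_atTop 1
  have h3 := h1.sub (h.mul h2)
  rw [mul_one, sub_self] at h3
  refine h3.congr' ?_
  filter_upwards [eventually_gt_atTop 0] with n hn
  have hn0 : (n : ℝ) ≠ 0 := by exact_mod_cast hn.ne'
  have hn1 : (n : ℝ) + 1 ≠ 0 := by positivity
  rw [Finset.sum_range_succ]
  push_cast
  field_simp
  ring

/-- Recurrence: the frequency of past visits tends to the positive probability of `A`, so the visits
cannot stop. -/
lemma ae_frequently_shift_neg_mem {A : Set (ℤ → ℝ)} (hA : MeasurableSet A)
    (h : iidLaw ν A ≠ 0) : ∀ᵐ z ∂(iidLaw ν), ∃ᶠ n : ℕ in atTop, shift (-n) z ∈ A := by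
  have hm : Measurable (A.indicator fun _ => (1 : ℝ)) := measurable_const.indicator hA
  have hi : Integrable (A.indicator fun _ => (1 : ℝ)) (iidLaw ν) :=
    (integrable_const 1).indicator hA
  filter_upwards [ae_tendsto_average_shift_neg hm hi] with z hz
  rw [integral_indicator_const _ hA, smul_eq_mul, mul_one] at hz
  have hpos : 0 < (iidLaw ν).real A := ENNReal.toReal_pos h (measure_ne_top _ _)
  have h1 := tendsto_atTop_of_average hpos hz
  intro hev
  obtain ⟨N, hN⟩ := eventually_atTop.1 hev
  obtain ⟨n, hn⟩ := ((tendsto_atTop.1 h1 (N + 1)).and (eventually_ge_atTop N)).exists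
  obtain ⟨k, rfl⟩ := Nat.exists_eq_add_of_le hn.2
  rw [Finset.sum_range_add] at hn
  have e : ∑ i ∈ Finset.range k, A.indicator (fun _ => (1 : ℝ)) (shift (-((N + i : ℕ) : ℤ)) z)
      = 0 :=
    Finset.sum_eq_zero fun i _ => Set.indicator_of_notMem (hN (N + i) (by omega)) _
  have e2 : ∑ i ∈ Finset.range N, A.indicator (fun _ => (1 : ℝ)) (shift (-(i : ℤ)) z) ≤ N := by
    refine (Finset.sum_le_card_nsmul _ _ 1 fun i _ => ?_).trans (by simp)
    exact Set.indicator_le_self' (fun _ _ => zero_le_one) _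
  linarith [hn.1]

lemma ae_tendsto_prod_shift {R : (ℤ → ℝ) → ℝ} (hR : Measurable R) (hpos : ∀ z, 0 < R z)
    (hi : Integrable (fun z => Real.log (R z)) (iidLaw ν))
    (hneg : ∫ z, Real.log (R z) ∂(iidLaw ν) < 0) :
    ∀ᵐ z ∂(iidLaw ν),
      Tendsto (fun n : ℕ => ∏ i ∈ Finset.range n, R (shift i z)) atTop (𝓝 0) ∧
      Tendsto (fun n : ℕ => ∏ i ∈ Finset.range n, R (shift (-1 - i) z)) atTop (𝓝 0) := by
  have hm : Measurable fun z => Real.log (R z) := Real.measurable_log.comp hR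
  filter_upwards [ae_tendsto_average_shift hm hi,
    ae_all_shift (ae_tendsto_average_shift_neg hm hi)] with z h1 h2
  have h2 := h2 (-1)
  simp only [shift_shift] at h2
  have e : ∀ i : ℕ, -(i : ℤ) + -1 = -1 - i := fun i => by ring
  simp_rw [e] at h2
  have key : ∀ u : ℕ → ℤ → ℝ,
      Tendsto (fun n : ℕ => (∑ i ∈ Finset.range n, Real.log (R (u i))) / n) atTop
        (𝓝 (∫ z, Real.log (R z) ∂(iidLaw ν))) →
      Tendsto (fun n : ℕ => ∏ i ∈ Finset.range n, R (u i)) atTop (𝓝 0) := by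
    intro u h
    refine (Real.tendsto_exp_atBot.comp (tendsto_atBot_of_average hneg h)).congr fun n => ?_
    simp only [Function.comp]
    rw [Real.exp_sum]
    exact Finset.prod_congr rfl fun i _ => Real.exp_log (hpos _)
  exact ⟨key _ h1, key _ h2⟩

end ErgodicConsequences

/-! ### Almost sure contraction when the logarithmic rate has negative mean. -/

namespace Nbhd

variable {ν : Measure ℝ} [IsProbabilityMeasure ν] {B : Nbhd} {x : (ℤ → ℝ) → ℝ}

/-- An integrable logarithm makes the past observations grow subexponentially, and the geometric
weights then win. No moment of the observations is required. -/
lemma ae_summable_dom (hx : Measurable x)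
    (hi : Integrable (fun z => Real.log (1 + |x z|)) (iidLaw ν)) :
    ∀ᵐ z ∂(iidLaw ν), Summable fun k : ℕ =>
      B.upper ^ k * (B.intercept + B.slope * |x (EGARCH.shift (-1 - k) z)|) := by
  have hm : Measurable fun z => Real.log (1 + |x z|) :=
    Real.measurable_log.comp (hx.abs.const_add 1)
  filter_upwards [ae_all_shift (ae_tendsto_average_shift_neg hm hi)] with z hz
  have h := tendsto_div_of_average (hz (-1))
  -- The growth rate `κ` is small enough to leave the comparison series geometric with ratio
  -- `B.upper * exp κ < 1`.
  obtain ⟨κ, hκ, hbκ⟩ : ∃ κ : ℝ, 0 < κ ∧ B.upper * Real.exp κ < 1 := by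
    have hc : Continuous fun κ : ℝ => B.upper * Real.exp κ := by fun_prop
    have h0 : Tendsto (fun κ : ℝ => B.upper * Real.exp κ) (𝓝[>] 0) (𝓝 (B.upper * Real.exp 0)) :=
      (hc.tendsto 0).mono_left nhdsWithin_le_nhds
    rw [Real.exp_zero, mul_one] at h0
    obtain ⟨κ, h1, h2⟩ := ((h0.eventually (gt_mem_nhds B.upper_lt_one)).and
      self_mem_nhdsWithin).exists
    exact ⟨κ, h2, h1⟩
  have hs1 : Summable fun k : ℕ => B.upper ^ k * B.intercept :=
    (summable_geometric_of_lt_one B.upper_nonneg B.upper_lt_one).mul_right _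
  have hs2 : Summable fun k : ℕ => (B.upper * Real.exp κ) ^ k * (B.slope * Real.exp κ) :=
    (summable_geometric_of_lt_one (mul_nonneg B.upper_nonneg (Real.exp_pos _).le) hbκ).mul_right _
  refine Summable.of_norm_bounded_eventually_nat (hs1.add hs2) ?_
  filter_upwards [h.eventually (gt_mem_nhds hκ)] with k hk
  have hk1 : (0 : ℝ) < k + 1 := by positivity
  rw [div_lt_iff₀ hk1, shift_shift, show -(k : ℤ) + -1 = -1 - k by ring] at hk
  set X := |x (EGARCH.shift (-1 - k) z)|
  have hX : 0 ≤ X := abs_nonneg _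
  have h1 : X ≤ Real.exp (κ * (k + 1)) := by
    have := (Real.log_le_iff_le_exp (by linarith)).1 hk.le
    linarith
  have h2 : Real.exp (κ * (k + 1)) = Real.exp κ ^ k * Real.exp κ := by
    rw [← Real.exp_nat_mul, ← Real.exp_add]; congr 1; ring
  have hu := pow_nonneg B.upper_nonneg k
  have hD := B.slope_nonneg
  have hI := B.intercept_nonneg
  rw [Real.norm_of_nonneg (by positivity), mul_pow]
  calc B.upper ^ k * (B.intercept + B.slope * X)
      ≤ B.upper ^ k * (B.intercept + B.slope * (Real.exp κ ^ k * Real.exp κ)) := by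
        rw [← h2]; gcongr
    _ = _ := by ring

lemma measurable_dom (hx : Measurable x) : Measurable (B.dom x) :=
  measurable_geoSum ((hx.abs.const_mul _).const_add _)

lemma measurable_drive {S : Type*} [MeasurableSpace S] {y : S → ℝ} (hy : Measurable y)
    (θ : Param) : Measurable fun z => drive θ (y z) :=
  (hy.const_mul _).add (hy.abs.const_mul _)

lemma measurable_damp (hx : Measurable x) (t : ℤ) :
    Measurable fun z => B.damp (x (EGARCH.shift t z)) (B.dom x (EGARCH.shift t z)) := by
  have h1 := hx.comp (measurable_shift t)
  have h2 := (measurable_dom (B := B) hx).comp (measurable_shift t)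
  have h3 := measurable_drive h1 B.center
  have h4 : Measurable fun z => Real.exp (-(B.dom x (EGARCH.shift t z) + 1) / 2) :=
    ((h2.add_const 1).neg.div_const 2).exp
  exact (((h4.const_mul B.gain).mul ((h3.div_const 2).min measurable_const)).const_mul _).exp

lemma measurable_rateAt (hx : Measurable x) : Measurable (B.rateAt x) := by
  refine measurable_const.max (measurable_const.max (Measurable.sub_const ?_ _))
  exact ((((measurable_drive hx _).add (hx.abs.const_mul _)).const_mul _).mul_const _).mul
    (measurable_damp hx _)

lemma damp_le_one (y u : ℝ) : B.damp y u ≤ 1 := by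
  refine Real.exp_le_one_iff.2 ?_
  have h1 : 0 ≤ min (drive B.center y / 2) 1 :=
    le_min (by linarith [drive_nonneg B.center_le y]) zero_le_one
  have := mul_nonneg (mul_nonneg B.gain_nonneg (Real.exp_pos (-(u + 1) / 2)).le) h1
  linarith

lemma drive_le_mul_abs (θ : Param) (y : ℝ) : drive θ y ≤ (|gamma θ| + |delta θ|) * |y| := by
  unfold drive
  have h1 := le_abs_self (gamma θ * y)
  have h2 := le_abs_self (delta θ * |y|)
  rw [abs_mul] at h1
  rw [abs_mul, abs_abs] at h2
  linarith

/-- A linear bound for the contraction rate. -/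
def rateBound (B : Nbhd) : ℝ :=
  Real.exp (-B.floor) + (|beta B.center| + B.radius)
    + (1 / 2) * (|gamma B.center| + |delta B.center| + 2 * B.radius)
      * Real.exp (-(fixpt B.center - 2 * B.radius) / 2)

/-- Only the present observation enters, because the damping is at most `1`. So the logarithm of the
rate is dominated by `log (1 + |x|)`. -/
lemma rate_le (y y' u : ℝ) : B.rate y y' u ≤ B.rateBound * (1 + |y|) := by
  have hr := B.radius_pos
  have hy := abs_nonneg y
  have h1 := Real.exp_pos (-B.floor)
  have h2 := Real.exp_pos (-(fixpt B.center - 2 * B.radius) / 2)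
  have h3 := abs_nonneg (beta B.center)
  have h4 := abs_nonneg (gamma B.center)
  have h5 := abs_nonneg (delta B.center)
  set E := Real.exp (-(fixpt B.center - 2 * B.radius) / 2)
  set Q := (1 / 2) * (|gamma B.center| + |delta B.center| + 2 * B.radius) * E with hQ
  have hQ0 : 0 ≤ Q := by positivity
  have hK : B.rateBound = Real.exp (-B.floor) + (|beta B.center| + B.radius) + Q := rfl
  have hm : 0 ≤ (Real.exp (-B.floor) + (|beta B.center| + B.radius)) * |y| := by positivity
  have hm2 : 0 ≤ Q * |y| := by positivity
  rw [hK]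
  refine max_le (by nlinarith) (max_le ?_ ?_)
  · have := le_abs_self (beta B.center); nlinarith
  · have hd := drive_nonneg B.center_le y
    have a1 : (1 / 2) * (drive B.center y + 2 * B.radius * |y|) * E * B.damp y' u ≤ Q * |y| := by
      calc _ ≤ (1 / 2) * (drive B.center y + 2 * B.radius * |y|) * E * 1 := by
            gcongr; exact damp_le_one _ _
        _ ≤ (1 / 2) * ((|gamma B.center| + |delta B.center|) * |y| + 2 * B.radius * |y|)
          * E * 1 := by
            gcongr; exact drive_le_mul_abs _ _
        _ = Q * |y| := by rw [hQ]; ring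
    have := neg_abs_le (beta B.center)
    nlinarith

lemma rateBound_pos : 0 < B.rateBound := by
  have := rate_le (B := B) 0 0 0
  simpa using (B.rate_pos 0 0 0).trans_le this

lemma abs_log_le_of_exp_le {f K R y : ℝ} (h1 : Real.exp (-f) ≤ R) (hK : 0 < K)
    (h2 : R ≤ K * (1 + |y|)) : |Real.log R| ≤ |f| + |Real.log K| + Real.log (1 + |y|) := by
  have hR : 0 < R := (Real.exp_pos _).trans_le h1
  have hy0 : 0 < 1 + |y| := by linarith [abs_nonneg y]
  have hy : 0 ≤ Real.log (1 + |y|) := Real.log_nonneg (by linarith [abs_nonneg y])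
  have a1 : -f ≤ Real.log R := (Real.le_log_iff_exp_le hR).2 h1
  have a2 : Real.log R ≤ Real.log K + Real.log (1 + |y|) := by
    rw [← Real.log_mul hK.ne' hy0.ne']
    exact Real.log_le_log hR h2
  have := le_abs_self f
  have := abs_nonneg f
  have := le_abs_self (Real.log K)
  have := abs_nonneg (Real.log K)
  rw [abs_le]; constructor <;> linarith

lemma abs_log_rateAt_le (z : ℤ → ℝ) :
    |Real.log (B.rateAt x z)| ≤ |B.floor| + |Real.log B.rateBound| + Real.log (1 + |x z|) :=
  abs_log_le_of_exp_le (le_max_left _ _) rateBound_pos (rate_le _ _ _)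

lemma integrable_log_rateAt (hx : Measurable x)
    (hi : Integrable (fun z => Real.log (1 + |x z|)) (iidLaw ν)) :
    Integrable (fun z => Real.log (B.rateAt x z)) (iidLaw ν) :=
  ((integrable_const (|B.floor| + |Real.log B.rateBound|)).add hi).mono'
    (Real.measurable_log.comp (measurable_rateAt hx)).aestronglyMeasurable
    (ae_of_all _ fun z => abs_log_rateAt_le z)

/-- If the expected logarithm of the contraction rate is negative, the inverted recursions
contract almost surely. -/
lemma ae_good (hx : Measurable x)
    (hi : Integrable (fun z => Real.log (1 + |x z|)) (iidLaw ν))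
    (hneg : ∫ z, Real.log (B.rateAt x z) ∂(iidLaw ν) < 0) :
    ∀ᵐ z ∂(iidLaw ν), ∀ t : ℤ, B.Good x (EGARCH.shift t z) := by
  refine ae_all_shift ?_
  -- The factor `B.dom` at time `-n` need not stay bounded in `n`. It is at most `Q` infinitely
  -- often by recurrence, and one such `n` with a small product suffices for `Good.backward`.
  obtain ⟨Q, hQ⟩ : ∃ Q : ℕ, iidLaw ν {z | B.dom x z ≤ Q} ≠ 0 := by
    by_contra! hall
    have : iidLaw ν (⋃ Q : ℕ, {z | B.dom x z ≤ Q}) = 0 := measure_iUnion_null hall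
    have e : (⋃ Q : ℕ, {z | B.dom x z ≤ Q}) = Set.univ := by
      ext z
      simpa using exists_nat_ge (B.dom x z)
    rw [e] at this
    simp at this
  have hA : MeasurableSet {z | B.dom x z ≤ Q} :=
    measurableSet_le (measurable_dom hx) measurable_const
  filter_upwards [ae_summable_dom (B := B) hx hi, ae_frequently_shift_neg_mem hA hQ,
    ae_tendsto_prod_shift (measurable_rateAt (B := B) hx) (fun z => B.rate_pos _ _ _)
      (integrable_log_rateAt hx hi) hneg] with z h1 h2 h3
  refine ⟨h1, h3.1, fun ε hε => ?_⟩
  have hlim := h3.2.const_mul ((Q : ℝ) + B.fixBound + 2)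
  rw [mul_zero] at hlim
  obtain ⟨n, hn, hn'⟩ := (h2.and_eventually (hlim.eventually (gt_mem_nhds hε))).exists
  refine ⟨n, lt_of_le_of_lt ?_ hn'⟩
  have : 0 ≤ ∏ i ∈ Finset.range n, B.rateAt x (EGARCH.shift (-1 - i) z) :=
    Finset.prod_nonneg fun i _ => (B.rate_pos _ _ _).le
  have hn : B.dom x (EGARCH.shift (-n) z) ≤ Q := hn
  gcongr

end Nbhd

/-! ### Semicontinuity of the shocks in the parameter. -/

section Neighbourhoods

variable {θs : Param}

lemma continuous_alpha : Continuous alpha := continuous_coord 0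
lemma continuous_beta : Continuous beta := continuous_coord 1
lemma continuous_gamma : Continuous gamma := continuous_coord 2
lemma continuous_delta : Continuous delta := continuous_coord 3

lemma continuousAt_fixpt (h : beta θs < 1) : ContinuousAt fixpt θs :=
  continuous_alpha.continuousAt.div (continuous_const.sub continuous_beta).continuousAt
    (by linarith)

lemma drive_of_nonneg (θ : Param) {y : ℝ} (hy : 0 ≤ y) : drive θ y = (delta θ + gamma θ) * y := by
  rw [drive, abs_of_nonneg hy]; ring

lemma drive_of_nonpos (θ : Param) {y : ℝ} (hy : y ≤ 0) :
    drive θ y = (delta θ - gamma θ) * -y := by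
  rw [drive, abs_of_nonpos hy]; ring

lemma eventually_mul_le_of_continuousAt {p : Param → ℝ} (hp : ContinuousAt p θs) (h0 : 0 ≤ p θs)
    {ε : ℝ} (hε : 0 < ε) : ∀ᶠ θ in 𝓝 θs, 0 ≤ p θ → (1 - ε) * p θs ≤ p θ := by
  rcases h0.eq_or_lt with h | h
  · exact Eventually.of_forall fun θ hθ => by rw [← h]; simpa using hθ
  · have : (1 - ε) * p θs < p θs := by nlinarith
    filter_upwards [hp.eventually (lt_mem_nhds this)] with θ hθ _ using hθ.le

/-- On each half-line the shock is linear with slope `δ + γ` or `δ - γ`. The lower bound is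
multiplicative so that a slope vanishing at `θs` imposes no more than nonnegativity nearby. -/
lemma eventually_mul_drive_le (hs : |gamma θs| ≤ delta θs) {ε : ℝ} (hε : 0 < ε) :
    ∀ᶠ θ in 𝓝 θs, |gamma θ| ≤ delta θ → ∀ y, (1 - ε) * drive θs y ≤ drive θ y := by
  obtain ⟨s1, s2⟩ := abs_le.1 hs
  filter_upwards [eventually_mul_le_of_continuousAt (p := fun θ => delta θ + gamma θ)
      (continuous_delta.add continuous_gamma).continuousAt (by linarith) hε,
    eventually_mul_le_of_continuousAt (p := fun θ => delta θ - gamma θ)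
      (continuous_delta.sub continuous_gamma).continuousAt (by linarith) hε] with θ h1 h2 hθ y
  obtain ⟨t1, t2⟩ := abs_le.1 hθ
  rcases le_total 0 y with hy | hy
  · rw [drive_of_nonneg _ hy, drive_of_nonneg _ hy, ← mul_assoc]
    exact mul_le_mul_of_nonneg_right (h1 (by linarith)) hy
  · rw [drive_of_nonpos _ hy, drive_of_nonpos _ hy, ← mul_assoc]
    exact mul_le_mul_of_nonneg_right (h2 (by linarith)) (by linarith)

lemma eventually_drive_le {r : ℝ} (hr : 0 < r) :
    ∀ᶠ θ in 𝓝 θs, ∀ y, drive θ y ≤ drive θs y + 2 * r * |y| := by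
  have h1 : ∀ᶠ θ in 𝓝 θs, |gamma θ - gamma θs| < r :=
    continuous_gamma.continuousAt.eventually (Metric.ball_mem_nhds _ hr)
  have h2 : ∀ᶠ θ in 𝓝 θs, |delta θ - delta θs| < r :=
    continuous_delta.continuousAt.eventually (Metric.ball_mem_nhds _ hr)
  filter_upwards [h1, h2] with θ h1 h2 y
  have a1 : (gamma θ - gamma θs) * y ≤ r * |y| := by
    refine (le_abs_self _).trans ?_
    rw [abs_mul]
    gcongr
  have a2 : (delta θ - delta θs) * |y| ≤ r * |y| := by
    gcongr
    exact (le_abs_self _).trans h2.le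
  unfold drive
  linarith

end Neighbourhoods

/-! ### Rates as the neighbourhood shrinks. -/

namespace Nbhd

/-- The same constants with another radius. -/
def shrink (B : Nbhd) (r : ℝ) (h0 : 0 < r) (h1 : r ≤ 1) : Nbhd :=
  { B with radius := r, radius_pos := h0, radius_le_one := h1 }

/-- The constants used around the parameter `θs`. -/
def around (θs : Param) (κ M : ℝ) (J : ℕ) (h0 : 0 ≤ beta θs) (h1 : beta θs < 1)
    (hs : |gamma θs| ≤ delta θs) (hκ : 0 ≤ κ) : Nbhd where
  center := θs
  -- The largest allowed radius, to be lowered by `shrink`; the slope below is computed for it and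
  -- remains valid for all smaller ones.
  radius := 1
  upper := (1 + beta θs) / 2
  intercept := |alpha θs| + 1
  slope := (|gamma θs| + |delta θs| + 2) * Real.exp (-(fixpt θs - 2) / 2)
  gain := κ
  floor := M
  lag := J
  radius_pos := one_pos
  radius_le_one := le_rfl
  upper_nonneg := by linarith
  upper_lt_one := by linarith
  intercept_nonneg := by positivity
  slope_nonneg := by positivity
  gain_nonneg := hκ
  center_le := hs

lemma eventually_mem_shrink_around {θs : Param} {κ M : ℝ} {J : ℕ} (h0 : 0 ≤ beta θs)
    (h1 : beta θs < 1) (hs : |gamma θs| ≤ delta θs) (hκ : 0 ≤ κ)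
    (hg : ∀ᶠ θ in 𝓝 θs, 0 ≤ beta θ → κ ≤ beta θ ^ J) {r : ℝ} (hr : 0 < r) (hr1 : r ≤ 1) :
    ∀ᶠ θ in 𝓝 θs, 0 ≤ beta θ → |gamma θ| ≤ delta θ →
      ((around θs κ M J h0 h1 hs hκ).shrink r hr hr1).Mem θ := by
  have e1 : ∀ᶠ θ in 𝓝 θs, |beta θ - beta θs| < r :=
    continuous_beta.continuousAt.eventually (Metric.ball_mem_nhds _ hr)
  have e2 : ∀ᶠ θ in 𝓝 θs, beta θ < (1 + beta θs) / 2 :=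
    continuous_beta.continuousAt.eventually (gt_mem_nhds (by linarith))
  have e3 : ∀ᶠ θ in 𝓝 θs, |alpha θ| < |alpha θs| + 1 :=
    continuous_alpha.abs.continuousAt.eventually (gt_mem_nhds (by linarith))
  have e4 : ∀ᶠ θ in 𝓝 θs, fixpt θs - r < fixpt θ :=
    (continuousAt_fixpt h1).eventually (lt_mem_nhds (by linarith))
  filter_upwards [e1, e2, e3, e4, hg, eventually_mul_drive_le hs (ε := 1 / 2) (by norm_num),
    eventually_drive_le (θs := θs) hr] with θ e1 e2 e3 e4 e5 e6 e7 b0 hθ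
  refine ⟨b0, e2.le, e1.le, e3.le, hθ, e7, fun y => ?_, fun y => ?_, e4.le, e5 b0⟩
  · have := e6 hθ y
    change drive θs y / 2 ≤ drive θ y
    linarith
  · change drive θ y * Real.exp (-(fixpt θs - 2 * r) / 2)
      ≤ (|gamma θs| + |delta θs| + 2) * Real.exp (-(fixpt θs - 2) / 2) * |y|
    have a1 : drive θ y ≤ (|gamma θs| + |delta θs| + 2) * |y| := by
      have := e7 y
      have := drive_le_mul_abs θs y
      have : 2 * r * |y| ≤ 2 * |y| := by
        have := abs_nonneg y; nlinarith
      linarith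
    have a2 : Real.exp (-(fixpt θs - 2 * r) / 2) ≤ Real.exp (-(fixpt θs - 2) / 2) :=
      Real.exp_le_exp.2 (by linarith)
    calc _ ≤ ((|gamma θs| + |delta θs| + 2) * |y|) * Real.exp (-(fixpt θs - 2) / 2) := by
          gcongr
      _ = _ := by ring

variable {B : Nbhd} {x : (ℤ → ℝ) → ℝ} {ν : Measure ℝ} [IsProbabilityMeasure ν]

/-- The damping at time `0`. -/
def dampAt (B : Nbhd) (x : (ℤ → ℝ) → ℝ) (z : ℤ → ℝ) : ℝ :=
  B.damp (x (EGARCH.shift (-(1 + B.lag)) z)) (B.dom x (EGARCH.shift (-(1 + B.lag)) z))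

/-- The damped Lipschitz coefficient at the center, the limit of the contraction rates when the
radius tends to `0` and the floor to infinity. -/
def limRate (B : Nbhd) (x : (ℤ → ℝ) → ℝ) (z : ℤ → ℝ) : ℝ :=
  max (beta B.center) ((1 / 2) * drive B.center (x z) * Real.exp (-fixpt B.center / 2)
    * B.dampAt x z - beta B.center)

lemma measurable_limRate (hx : Measurable x) : Measurable (B.limRate x) :=
  measurable_const.max (Measurable.sub_const
    ((((measurable_drive hx _).const_mul _).mul_const _).mul (measurable_damp hx _)) _)

/-- A bound uniform in the radius, for dominated convergence as the radius tends to `0`. -/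
lemma rateAt_shrink_le (z : ℤ → ℝ) {r : ℝ} (h0 : 0 < r) (h1 : r ≤ 1) :
    (B.shrink r h0 h1).rateAt x z ≤ (B.shrink 1 one_pos le_rfl).rateBound * (1 + |x z|) := by
  refine (rate_le _ _ _).trans ?_
  gcongr
  unfold rateBound
  have : 0 ≤ |gamma B.center| + |delta B.center| := by positivity
  change Real.exp (-B.floor) + (|beta B.center| + r)
    + (1 / 2) * (|gamma B.center| + |delta B.center| + 2 * r)
      * Real.exp (-(fixpt B.center - 2 * r) / 2) ≤ Real.exp (-B.floor) + (|beta B.center| + 1)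
    + (1 / 2) * (|gamma B.center| + |delta B.center| + 2 * 1)
      * Real.exp (-(fixpt B.center - 2 * 1) / 2)
  gcongr

lemma tendsto_rateAt_shrink (z : ℤ → ℝ) {r : ℕ → ℝ} (h0 : ∀ n, 0 < r n) (h1 : ∀ n, r n ≤ 1)
    (hr : Tendsto r atTop (𝓝 0)) :
    Tendsto (fun n => (B.shrink (r n) (h0 n) (h1 n)).rateAt x z) atTop
      (𝓝 (max (Real.exp (-B.floor)) (B.limRate x z))) := by
  have hc : Continuous fun ρ : ℝ => max (Real.exp (-B.floor)) (max (beta B.center + ρ)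
      ((1 / 2) * (drive B.center (x z) + 2 * ρ * |x z|)
        * Real.exp (-(fixpt B.center - 2 * ρ) / 2) * B.dampAt x z - (beta B.center - ρ))) := by
    fun_prop
  have := (hc.tendsto 0).comp hr
  simp only [add_zero, mul_zero, zero_mul, sub_zero] at this
  exact this

/-- A small radius suffices for contraction. -/
lemma exists_shrink_integral_neg (hx : Measurable x)
    (hi : Integrable (fun z => Real.log (1 + |x z|)) (iidLaw ν))
    (hneg : ∫ z, Real.log (max (Real.exp (-B.floor)) (B.limRate x z)) ∂(iidLaw ν) < 0) :
    ∃ (r : ℝ) (h0 : 0 < r) (h1 : r ≤ 1),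
      ∫ z, Real.log ((B.shrink r h0 h1).rateAt x z) ∂(iidLaw ν) < 0 := by
  let r : ℕ → ℝ := fun n => 1 / ((n : ℝ) + 1)
  have h0 : ∀ n, 0 < r n := fun n => by positivity
  have h1 : ∀ n, r n ≤ 1 := fun n => by
    rw [div_le_one (by positivity)]; linarith [n.cast_nonneg (α := ℝ)]
  have hr : Tendsto r atTop (𝓝 0) := tendsto_one_div_add_atTop_nhds_zero_nat
  have key : Tendsto (fun n => ∫ z, Real.log ((B.shrink (r n) (h0 n) (h1 n)).rateAt x z)
      ∂(iidLaw ν)) atTop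
      (𝓝 (∫ z, Real.log (max (Real.exp (-B.floor)) (B.limRate x z)) ∂(iidLaw ν))) := by
    refine tendsto_integral_of_dominated_convergence
      (fun z => |B.floor| + |Real.log (B.shrink 1 one_pos le_rfl).rateBound|
        + Real.log (1 + |x z|)) (fun n => ?_) ?_ (fun n => ae_of_all _ fun z => ?_)
      (ae_of_all _ fun z => ?_)
    · exact (Real.measurable_log.comp (measurable_rateAt hx)).aestronglyMeasurable
    · exact (integrable_const _).add hi
    · exact abs_log_le_of_exp_le (le_max_left _ _) rateBound_pos (rateAt_shrink_le z _ _)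
    · exact ((Real.continuousAt_log (lt_max_of_lt_left (Real.exp_pos _)).ne').tendsto).comp
        (tendsto_rateAt_shrink z h0 h1 hr)
  obtain ⟨n, hn⟩ := (key.eventually (gt_mem_nhds hneg)).exists
  exact ⟨r n, h0 n, h1 n, hn⟩

end Nbhd

/-! ### Logarithms of nonnegative functions, truncated from below. -/

section TruncatedLog

variable {S : Type*} [MeasurableSpace S] {P : Measure S} {L y : S → ℝ} {K : ℝ}

/-- The negative part of `log`, with the convention `log 0 = -∞`. -/
def negLog (a : ℝ) : ENNReal := if a = 0 then ⊤ else ENNReal.ofReal (-Real.log a)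

lemma measurable_negLog : Measurable negLog :=
  Measurable.ite (measurableSet_singleton 0) measurable_const
    Real.measurable_log.neg.ennreal_ofReal

lemma ofReal_log_max (M : ℕ) {a : ℝ} (ha : 0 ≤ a) :
    ENNReal.ofReal (Real.log (max (Real.exp (-M)) a)) = ENNReal.ofReal (Real.log a) := by
  rcases le_total (Real.exp (-M)) a with h | h
  · rw [max_eq_right h]
  · rw [max_eq_left h, Real.log_exp, ENNReal.ofReal_of_nonpos (by simp),
      ENNReal.ofReal_of_nonpos]
    refine Real.log_nonpos ha (h.trans ?_)
    exact Real.exp_le_one_iff.2 (by simp)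

lemma tendsto_ofReal_neg_log_max {a : ℝ} (ha : 0 ≤ a) :
    Tendsto (fun M : ℕ => ENNReal.ofReal (-Real.log (max (Real.exp (-M)) a))) atTop
      (𝓝 (negLog a)) := by
  rcases ha.eq_or_lt with h | h
  · have e : ∀ M : ℕ, max (Real.exp (-(M : ℝ))) a = Real.exp (-M) := fun M => by
      rw [← h]; exact max_eq_left (Real.exp_pos _).le
    simp_rw [e, Real.log_exp, neg_neg, negLog, if_pos h.symm]
    exact ENNReal.tendsto_ofReal_atTop.comp tendsto_natCast_atTop_atTop
  · rw [negLog, if_neg h.ne']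
    refine tendsto_const_nhds.congr' ?_
    filter_upwards [eventually_ge_atTop ⌈-Real.log a⌉₊] with M hM
    rw [max_eq_right]
    rw [← Real.le_log_iff_exp_le h]
    have := (Nat.le_ceil _).trans (Nat.cast_le (α := ℝ).2 hM)
    linarith

lemma integrable_log_max [IsProbabilityMeasure P] (hL : Measurable L)
    (hi : Integrable (fun z => Real.log (1 + |y z|)) P)
    (hK : 1 ≤ K) (hb : ∀ z, L z ≤ K * (1 + |y z|)) {M : ℝ} (hM : 0 ≤ M) :
    Integrable (fun z => Real.log (max (Real.exp (-M)) (L z))) P := by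
  refine ((integrable_const (|M| + |Real.log K|)).add hi).mono'
    (Real.measurable_log.comp (measurable_const.max hL)).aestronglyMeasurable
    (ae_of_all _ fun z => ?_)
  refine Nbhd.abs_log_le_of_exp_le (le_max_left _ _) (by linarith) (max_le ?_ (hb z))
  have : Real.exp (-M) ≤ 1 := Real.exp_le_one_iff.2 (by linarith)
  have := abs_nonneg (y z)
  nlinarith

lemma lintegral_ofReal_log_ne_top [IsProbabilityMeasure P]
    (hi : Integrable (fun z => Real.log (1 + |y z|)) P)
    (hL : Measurable L) (h0 : ∀ z, 0 ≤ L z)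
    (hK : 1 ≤ K) (hb : ∀ z, L z ≤ K * (1 + |y z|)) :
    ∫⁻ z, ENNReal.ofReal (Real.log (L z)) ∂P ≠ ⊤ := by
  simp_rw [← fun z => ofReal_log_max 0 (h0 z)]
  exact (integrable_log_max hL hi hK hb (M := ((0 : ℕ) : ℝ)) (by simp)).lintegral_lt_top.ne

/-- Truncating at `-M` leaves the positive part untouched, while the negative parts increase to
`negLog`. Monotone convergence keeps the strict inequality for some finite `M`, even when the mean
is `-∞`. -/
lemma exists_integral_log_max_neg [IsProbabilityMeasure P]
    (hi : Integrable (fun z => Real.log (1 + |y z|)) P)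
    (hL : Measurable L) (h0 : ∀ z, 0 ≤ L z) (hK : 1 ≤ K) (hb : ∀ z, L z ≤ K * (1 + |y z|))
    (h : ∫⁻ z, ENNReal.ofReal (Real.log (L z)) ∂P < ∫⁻ z, negLog (L z) ∂P) :
    ∃ M : ℕ, ∫ z, Real.log (max (Real.exp (-M)) (L z)) ∂P < 0 := by
  have hm : ∀ M : ℕ, Measurable fun z => Real.log (max (Real.exp (-(M : ℝ))) (L z)) := fun M =>
    Real.measurable_log.comp (measurable_const.max hL)
  have hlim := lintegral_tendsto_of_tendsto_of_monotone (μ := P)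
    (f := fun (M : ℕ) z => ENNReal.ofReal (-Real.log (max (Real.exp (-M)) (L z))))
    (F := fun z => negLog (L z)) (fun M => (hm M).neg.ennreal_ofReal.aemeasurable)
    (ae_of_all _ fun z M N hMN => by
      refine ENNReal.ofReal_le_ofReal (neg_le_neg ?_)
      refine Real.log_le_log (lt_max_of_lt_left (Real.exp_pos _)) (max_le_max ?_ le_rfl)
      have : (M : ℝ) ≤ N := by exact_mod_cast hMN
      exact Real.exp_le_exp.2 (by linarith))
    (ae_of_all _ fun z => tendsto_ofReal_neg_log_max (h0 z))
  obtain ⟨M, hM⟩ := (hlim.eventually (lt_mem_nhds h)).exists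
  refine ⟨M, ?_⟩
  have hint := integrable_log_max hL hi hK hb (M := (M : ℝ)) (by simp)
  rw [integral_eq_lintegral_pos_part_sub_lintegral_neg_part hint]
  simp_rw [fun z => ofReal_log_max M (h0 z)]
  rw [sub_neg]
  exact (ENNReal.toReal_lt_toReal (lintegral_ofReal_log_ne_top hi hL h0 hK hb)
    hint.neg.lintegral_lt_top.ne).2 hM

/-- Where the mean is not negative, the finite positive part bounds the negative part. The logarithm
is then finite almost everywhere and integrable, so the boundary and exterior cases can use ordinary
integrals. -/
lemma integrable_log_of_lintegral_negLog_le [IsProbabilityMeasure P]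
    (hi : Integrable (fun z => Real.log (1 + |y z|)) P)
    (hL : Measurable L) (h0 : ∀ z, 0 ≤ L z) (hK : 1 ≤ K) (hb : ∀ z, L z ≤ K * (1 + |y z|))
    (h : ∫⁻ z, negLog (L z) ∂P ≤ ∫⁻ z, ENNReal.ofReal (Real.log (L z)) ∂P) :
    (∀ᵐ z ∂P, 0 < L z) ∧ Integrable (fun z => Real.log (L z)) P ∧ 0 ≤ ∫ z, Real.log (L z) ∂P := by
  have hpos := lintegral_ofReal_log_ne_top hi hL h0 hK hb
  have hmn : Measurable fun z => negLog (L z) := measurable_negLog.comp hL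
  have hneg : ∫⁻ z, negLog (L z) ∂P ≠ ⊤ := ne_top_of_le_ne_top hpos h
  have hL0 : ∀ᵐ z ∂P, 0 < L z := by
    filter_upwards [ae_lt_top hmn hneg] with z hz
    refine (h0 z).lt_of_ne fun h' => ?_
    simp [negLog, ← h'] at hz
  have e : ∫⁻ z, negLog (L z) ∂P = ∫⁻ z, ENNReal.ofReal (-Real.log (L z)) ∂P := by
    refine lintegral_congr_ae ?_
    filter_upwards [hL0] with z hz
    rw [negLog, if_neg hz.ne']
  rw [e] at h hneg
  have hint : Integrable (fun z => Real.log (L z)) P := by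
    refine ⟨(Real.measurable_log.comp hL).aestronglyMeasurable, ?_⟩
    have hml : Measurable fun z => ENNReal.ofReal (Real.log (L z)) :=
      (Real.measurable_log.comp hL).ennreal_ofReal
    have hlt : ∫⁻ z, (ENNReal.ofReal (Real.log (L z)) + ENNReal.ofReal (-Real.log (L z))) ∂P
        < ⊤ := by
      rw [lintegral_add_left hml]
      exact ENNReal.add_lt_top.2 ⟨hpos.lt_top, hneg.lt_top⟩
    refine lt_of_le_of_lt (lintegral_mono fun z => ?_) hlt
    rw [Real.enorm_eq_ofReal_abs]
    rcases le_total 0 (Real.log (L z)) with h | h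
    · rw [abs_of_nonneg h]; exact le_self_add
    · rw [abs_of_nonpos h]; exact le_add_self
  refine ⟨hL0, hint, ?_⟩
  rw [integral_eq_lintegral_pos_part_sub_lintegral_neg_part hint, sub_nonneg]
  exact (ENNReal.toReal_le_toReal hneg hpos).2 h

lemma exists_integral_log_max_neg_of_integral_neg (hL : Measurable L) (h0 : ∀ᵐ z ∂P, 0 < L z)
    (hi : Integrable (fun z => Real.log (L z)) P) (h : ∫ z, Real.log (L z) ∂P < 0) :
    ∃ M : ℕ, ∫ z, Real.log (max (Real.exp (-M)) (L z)) ∂P < 0 := by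
  have key : Tendsto (fun M : ℕ => ∫ z, Real.log (max (Real.exp (-M)) (L z)) ∂P) atTop
      (𝓝 (∫ z, Real.log (L z) ∂P)) := by
    refine tendsto_integral_of_dominated_convergence (fun z => |Real.log (L z)|) (fun M =>
      (Real.measurable_log.comp (measurable_const.max hL)).aestronglyMeasurable) hi.abs
      (fun M => ?_) ?_
    · filter_upwards [h0] with z hz
      rw [Real.norm_eq_abs]
      rcases le_total (Real.exp (-M)) (L z) with h | h
      · rw [max_eq_right h]
      · have h1 : Real.log (L z) ≤ -M := (Real.log_le_iff_le_exp hz).2 h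
        have hM : (0 : ℝ) ≤ M := M.cast_nonneg
        rw [max_eq_left h, Real.log_exp, abs_neg, abs_of_nonneg hM, abs_of_nonpos (by linarith)]
        linarith
    · filter_upwards [h0] with z hz
      refine tendsto_const_nhds.congr' ?_
      filter_upwards [eventually_ge_atTop ⌈-Real.log (L z)⌉₊] with M hM
      rw [max_eq_right]
      rw [← Real.le_log_iff_exp_le hz]
      have := (Nat.le_ceil _).trans (Nat.cast_le (α := ℝ).2 hM)
      linarith
  exact (key.eventually (gt_mem_nhds h)).exists

end TruncatedLog

/-! ### The Lipschitz coefficient and its extended logarithm. -/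

section LipCoeff

variable {θ : Param}

lemma lipCoeff_eq (θ : Param) (y : ℝ) :
    lipCoeff θ y
      = max (beta θ) ((1 / 2) * drive θ y * Real.exp (-fixpt θ / 2) - beta θ) := by
  unfold lipCoeff drive fixpt
  congr 4; ring

lemma measurable_lipCoeff (θ : Param) : Measurable (lipCoeff θ) := by
  unfold lipCoeff; fun_prop

/-- A linear bound for the Lipschitz coefficient. -/
def lipBound (θ : Param) : ℝ :=
  1 + |beta θ| + (1 / 2) * (|gamma θ| + |delta θ|) * Real.exp (-fixpt θ / 2)

lemma one_le_lipBound (θ : Param) : 1 ≤ lipBound θ := by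
  unfold lipBound
  have := abs_nonneg (beta θ)
  have : 0 ≤ (1 / 2) * (|gamma θ| + |delta θ|) * Real.exp (-fixpt θ / 2) := by positivity
  linarith

lemma lipCoeff_le (θ : Param) (y : ℝ) : lipCoeff θ y ≤ lipBound θ * (1 + |y|) := by
  rw [lipCoeff_eq, lipBound]
  have hb := abs_nonneg (beta θ)
  have hy := abs_nonneg y
  have hE := Real.exp_pos (-fixpt θ / 2)
  have h1 : (1 / 2) * drive θ y * Real.exp (-fixpt θ / 2)
      ≤ (1 / 2) * (|gamma θ| + |delta θ|) * Real.exp (-fixpt θ / 2) * |y| := by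
    have := Nbhd.drive_le_mul_abs θ y
    calc _ ≤ (1 / 2) * ((|gamma θ| + |delta θ|) * |y|) * Real.exp (-fixpt θ / 2) := by gcongr
      _ = _ := by ring
  have h2 : 0 ≤ (1 / 2) * (|gamma θ| + |delta θ|) * Real.exp (-fixpt θ / 2) := by positivity
  have h3 := mul_nonneg hb hy
  have h4 := le_abs_self (beta θ)
  have h5 := neg_abs_le (beta θ)
  refine max_le (by nlinarith) (by nlinarith)

lemma toENNReal_logLip (h : 0 ≤ beta θ) (y : ℝ) :
    (logLip θ y).toENNReal = ENNReal.ofReal (Real.log (lipCoeff θ y)) := by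
  have h0 : 0 ≤ lipCoeff θ y := le_max_of_le_left h
  rw [logLip, ENNReal.log_ofReal]
  split_ifs with h'
  · simp [le_antisymm h' h0]
  · simp

lemma toENNReal_neg_logLip (h : 0 ≤ beta θ) (y : ℝ) :
    (-logLip θ y).toENNReal = negLog (lipCoeff θ y) := by
  have h0 : 0 ≤ lipCoeff θ y := le_max_of_le_left h
  rw [logLip, ENNReal.log_ofReal, negLog]
  split_ifs with h1 h2 h2
  · simp
  · exact absurd (le_antisymm h1 h0) h2
  · exact absurd h2.le h1
  · rw [← EReal.coe_neg, EReal.real_coe_toENNReal]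

lemma logLip_le_of_le (y : ℝ) {R : ℝ} (hR : 0 < R) (h : lipCoeff θ y ≤ R) :
    logLip θ y ≤ (Real.log R : EReal) := by
  rw [← ENNReal.log_ofReal_of_pos hR, logLip]
  exact ENNReal.log_le_log (ENNReal.ofReal_le_ofReal h)

lemma le_logLip_of_le (y : ℝ) {R : ℝ} (hR : 0 < R) (h : R ≤ lipCoeff θ y) :
    (Real.log R : EReal) ≤ logLip θ y := by
  rw [← ENNReal.log_ofReal_of_pos hR, logLip]
  exact ENNReal.log_le_log (ENNReal.ofReal_le_ofReal h)

lemma coe_sum_eReal {ι : Type*} (s : Finset ι) (f : ι → ℝ) :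
    ((∑ i ∈ s, f i : ℝ) : EReal) = ∑ i ∈ s, (f i : EReal) := by
  classical
  induction s using Finset.induction_on with
  | empty => simp
  | insert a s ha ih => rw [Finset.sum_insert ha, Finset.sum_insert ha, EReal.coe_add, ih]

end LipCoeff

/-! ### Contraction or exclusion, according to the sign of the mean logarithm. -/

section

variable {ν : Measure ℝ} [IsProbabilityMeasure ν] {x : (ℤ → ℝ) → ℝ} {θs : Param}

lemma integral_lt_integral_of_ae_le {S : Type*} [MeasurableSpace S] {P : Measure S} {f g : S → ℝ}
    (hf : Integrable f P) (hg : Integrable g P) (h : ∀ᵐ z ∂P, f z ≤ g z)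
    (hlt : P {z | f z < g z} ≠ 0) : ∫ z, f z ∂P < ∫ z, g z ∂P := by
  rw [← sub_pos, ← integral_sub hg hf]
  refine (integral_pos_iff_support_of_nonneg_ae (f := fun z => g z - f z) ?_ (hg.sub hf)).2 ?_
  rotate_left
  · refine pos_iff_ne_zero.2 (mt (measure_mono_null ?_) hlt)
    exact fun z hz => (sub_pos.2 (by exact hz)).ne'
  · filter_upwards [h] with z hz using sub_nonneg.2 hz

lemma sum_Icc_shift (f : (ℤ → ℝ) → ℝ) (N : ℕ) (z : ℤ → ℝ) :
    ∑ t ∈ Finset.Icc 1 N, f (shift t z) = ∑ i ∈ Finset.range N, f (shift i (shift 1 z)) := by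
  induction N with
  | zero => simp
  | succ N ih =>
    rw [Finset.sum_Icc_succ_top (by omega), Finset.sum_range_succ, ih, shift_shift]
    push_cast
    rfl

namespace Nbhd

variable {B : Nbhd}

lemma dom_nonneg (z : ℤ → ℝ) : 0 ≤ B.dom x z :=
  tsum_nonneg fun k => mul_nonneg (pow_nonneg B.upper_nonneg k)
    (add_nonneg B.intercept_nonneg (mul_nonneg B.slope_nonneg (abs_nonneg _)))

/-- The cap by `1` inside `damp` is there for this bound: the damping changes the logarithm by a
bounded amount only. -/
lemma exp_le_damp {y u : ℝ} (hu : 0 ≤ u) : Real.exp (-B.gain / 2) ≤ B.damp y u := by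
  refine Real.exp_le_exp.2 ?_
  have h1 : Real.exp (-(u + 1) / 2) ≤ 1 := Real.exp_le_one_iff.2 (by linarith)
  have h2 : min (drive B.center y / 2) 1 ≤ 1 := min_le_right _ _
  have h3 : 0 ≤ min (drive B.center y / 2) 1 :=
    le_min (by linarith [drive_nonneg B.center_le y]) zero_le_one
  have h4 := B.gain_nonneg
  have h5 := Real.exp_pos (-(u + 1) / 2)
  have : B.gain * Real.exp (-(u + 1) / 2) * min (drive B.center y / 2) 1 ≤ B.gain * 1 * 1 := by
    gcongr
  linarith

lemma damp_lt_one {y : ℝ} (u : ℝ) (hg : 0 < B.gain) (hy : 0 < drive B.center y) :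
    B.damp y u < 1 := by
  rw [← Real.exp_zero]
  refine Real.exp_lt_exp.2 ?_
  have h1 : 0 < min (drive B.center y / 2) 1 := lt_min (by linarith) one_pos
  have := mul_pos (mul_pos hg (Real.exp_pos (-(u + 1) / 2))) h1
  linarith

lemma limRate_le (z : ℤ → ℝ) : B.limRate x z ≤ lipCoeff B.center (x z) := by
  rw [lipCoeff_eq, limRate]
  refine max_le_max le_rfl (sub_le_sub_right ?_ _)
  have h1 : 0 ≤ (1 / 2) * drive B.center (x z) * Real.exp (-fixpt B.center / 2) := by
    have := drive_nonneg B.center_le (x z)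
    positivity
  have := mul_le_mul_of_nonneg_left
    (damp_le_one (B := B) (x (EGARCH.shift (-(1 + B.lag)) z))
      (B.dom x (EGARCH.shift (-(1 + B.lag)) z))) h1
  rw [mul_one] at this
  exact this

lemma limRate_lt {z : ℤ → ℝ} (hg : 0 < B.gain) (hL : beta B.center < lipCoeff B.center (x z))
    (h0 : 0 ≤ beta B.center)
    (hd : 0 < drive B.center (x (EGARCH.shift (-(1 + B.lag)) z))) :
    B.limRate x z < lipCoeff B.center (x z) := by
  refine max_lt hL ?_
  rw [lipCoeff_eq] at hL ⊢
  rcases lt_max_iff.1 hL with h | h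
  · exact absurd h (lt_irrefl _)
  refine lt_max_of_lt_right (sub_lt_sub_right ?_ _)
  have h1 : 0 < (1 / 2) * drive B.center (x z) * Real.exp (-fixpt B.center / 2) := by linarith
  exact mul_lt_of_lt_one_right h1 (damp_lt_one _ hg hd)

/-- With `limRate_le` this transfers integrability of the logarithm from the Lipschitz coefficient
to the damped rate. -/
lemma mul_lipCoeff_le_limRate (h0 : 0 ≤ beta B.center) (z : ℤ → ℝ) :
    Real.exp (-B.gain / 2) / 2 * lipCoeff B.center (x z) ≤ B.limRate x z := by
  set g := B.dampAt x z
  set u := (1 / 2) * drive B.center (x z) * Real.exp (-fixpt B.center / 2) with hu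
  have hu0 : 0 ≤ u := by
    have := drive_nonneg B.center_le (x z)
    positivity
  have hg : Real.exp (-B.gain / 2) ≤ g := exp_le_damp (dom_nonneg _)
  have hg1 : g ≤ 1 := damp_le_one _ _
  have hE := Real.exp_pos (-B.gain / 2)
  have r1 : beta B.center ≤ B.limRate x z := le_max_left _ _
  have r2 : u * g - beta B.center ≤ B.limRate x z := le_max_right _ _
  rw [lipCoeff_eq, ← hu, mul_max_of_nonneg _ _ (by positivity)]
  refine max_le ?_ ?_
  · nlinarith
  · nlinarith [mul_le_mul_of_nonneg_left hg hu0]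

end Nbhd

/-- `θs` has a neighbourhood in which the inverted recursions contract. -/
def HasContraction (ν : Measure ℝ) [IsProbabilityMeasure ν] (x : (ℤ → ℝ) → ℝ) (θs : Param) :
    Prop :=
  ∃ B : Nbhd, (∫ z, Real.log (B.rateAt x z) ∂(iidLaw ν) < 0) ∧
    ∀ᶠ θ in 𝓝 θs, 0 ≤ beta θ → |gamma θ| ≤ delta θ → B.Mem θ

lemma hasContraction_of_limRate (hx : Measurable x)
    (hi : Integrable (fun z => Real.log (1 + |x z|)) (iidLaw ν)) (h0 : 0 ≤ beta θs)
    (h1 : beta θs < 1) (hs : |gamma θs| ≤ delta θs) {κ M : ℝ} {J : ℕ} (hκ : 0 ≤ κ)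
    (hg : ∀ᶠ θ in 𝓝 θs, 0 ≤ beta θ → κ ≤ beta θ ^ J)
    (hneg : ∫ z, Real.log (max (Real.exp (-M))
      ((Nbhd.around θs κ M J h0 h1 hs hκ).limRate x z)) ∂(iidLaw ν) < 0) :
    HasContraction ν x θs := by
  obtain ⟨r, hr0, hr1, h⟩ :=
    Nbhd.exists_shrink_integral_neg (B := Nbhd.around θs κ M J h0 h1 hs hκ) hx hi hneg
  exact ⟨_, h, Nbhd.eventually_mem_shrink_around h0 h1 hs hκ hg hr0 hr1⟩

/-- Contraction under the condition `INV`. -/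
lemma hasContraction_of_lintegral_lt (hx : Measurable x)
    (hi : Integrable (fun z => Real.log (1 + |x z|)) (iidLaw ν)) (h0 : 0 ≤ beta θs)
    (h1 : beta θs < 1) (hs : |gamma θs| ≤ delta θs)
    (h : ∫⁻ z, ENNReal.ofReal (Real.log (lipCoeff θs (x z))) ∂(iidLaw ν)
      < ∫⁻ z, negLog (lipCoeff θs (x z)) ∂(iidLaw ν)) :
    HasContraction ν x θs := by
  obtain ⟨M, hM⟩ := exists_integral_log_max_neg hi ((measurable_lipCoeff θs).comp hx)
    (fun z => le_max_of_le_left h0) (one_le_lipBound θs) (fun z => lipCoeff_le θs (x z)) h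
  -- Zero gain means no damping: a negative mean needs no help from past shocks.
  refine hasContraction_of_limRate hx hi h0 h1 hs (κ := 0) (M := M) (J := 0) le_rfl
    (Eventually.of_forall fun θ _ => by simp) ?_
  refine lt_of_le_of_lt (le_of_eq (integral_congr_ae (ae_of_all _ fun z => ?_))) hM
  have e : (Nbhd.around θs 0 M 0 h0 h1 hs le_rfl).dampAt x z = 1 := by
    simp [Nbhd.dampAt, Nbhd.damp, Nbhd.around]
  simp only [Nbhd.limRate, e, mul_one]
  rw [Function.comp, lipCoeff_eq]
  rfl

/-- On the boundary of `INV`, the shocks still lead to a strict contraction after some lag. -/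
lemma exists_lag (hx : Measurable x) (h0 : 0 ≤ beta θs) (h1 : beta θs < 1)
    (hpos : ∀ᵐ z ∂(iidLaw ν), 0 < lipCoeff θs (x z))
    (hmean : 0 ≤ ∫ z, Real.log (lipCoeff θs (x z)) ∂(iidLaw ν)) :
    ∃ (κ : ℝ) (J : ℕ), 0 < κ ∧ (∀ᶠ θ in 𝓝 θs, 0 ≤ beta θ → κ ≤ beta θ ^ J) ∧
      iidLaw ν {z | beta θs < lipCoeff θs (x z) ∧ 0 < drive θs (x (shift (-(1 + J)) z))} ≠ 0 := by
  have hd : ∀ y, beta θs < lipCoeff θs y → 0 < drive θs y := by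
    intro y hy
    rw [lipCoeff_eq] at hy
    rcases lt_max_iff.1 hy with h | h
    · exact absurd h (lt_irrefl _)
    by_contra hneg
    have : (1 / 2) * drive θs y * Real.exp (-fixpt θs / 2) ≤ 0 :=
      mul_nonpos_of_nonpos_of_nonneg (by linarith) (Real.exp_pos _).le
    linarith
  rcases h0.eq_or_lt with hb | hb
  · refine ⟨1, 0, one_pos, Eventually.of_forall fun θ _ => by simp, ?_⟩
    have : ∀ᵐ z ∂(iidLaw ν), beta θs < lipCoeff θs (x z) ∧
        0 < drive θs (x (shift (-(1 + (0 : ℕ))) z)) := by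
      filter_upwards [ae_all_shift hpos] with z hz
      rw [← hb]
      refine ⟨by simpa using hz 0, hd _ ?_⟩
      rw [← hb]
      exact hz _
    have h2 := prob_compl_eq_zero_iff₀ (μ := iidLaw ν) (s := {z | beta θs < lipCoeff θs (x z) ∧
        0 < drive θs (x (shift (-(1 + (0 : ℕ))) z))}) ?_ |>.1 this
    · rw [h2]; exact one_ne_zero
    · exact NullMeasurableSet.of_compl (NullMeasurableSet.of_null this)
  · have hA : MeasurableSet {z | 0 < drive θs (x z)} :=
      measurableSet_lt measurable_const (Nbhd.measurable_drive hx θs)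
    -- Otherwise the coefficient would be `β` almost surely, with mean logarithm `log β < 0`.
    have hD : iidLaw ν {z | beta θs < lipCoeff θs (x z)} ≠ 0 := by
      intro hnull
      have hle : ∀ᵐ z ∂(iidLaw ν), Real.log (lipCoeff θs (x z)) = Real.log (beta θs) := by
        have : ∀ᵐ z ∂(iidLaw ν), ¬ beta θs < lipCoeff θs (x z) :=
          measure_eq_zero_iff_ae_notMem.1 hnull
        filter_upwards [this] with z hz
        rw [le_antisymm (not_lt.1 hz) (le_max_left _ _)]
      rw [integral_congr_ae hle] at hmean
      simp only [integral_const, probReal_univ, one_smul] at hmean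
      exact absurd hmean (not_le.2 (Real.log_neg hb h1))
    have hAne : iidLaw ν {z | 0 < drive θs (x z)} ≠ 0 := by
      refine fun hnull => hD (measure_mono_null (fun z hz => hd _ hz) hnull)
    have hfreq := ae_frequently_shift_neg_mem hA hAne
    obtain ⟨J, hJ⟩ : ∃ J : ℕ, iidLaw ν {z | beta θs < lipCoeff θs (x z) ∧
        0 < drive θs (x (shift (-(1 + J)) z))} ≠ 0 := by
      by_contra! hall
      have hnull := measure_iUnion_null hall
      refine hD (measure_mono_null_ae ?_ hnull)
      filter_upwards [hfreq] with z hz hz'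
      obtain ⟨n, hn1, hn2⟩ := (frequently_atTop.1 hz) 1
      obtain ⟨k, rfl⟩ := Nat.exists_eq_add_of_le hn1
      refine Set.mem_iUnion.2 ⟨k, hz', ?_⟩
      simpa using hn2
    -- Halving `β` makes the gain valid throughout a neighbourhood. The lag `J` came from recurrence
    -- of the event that the shock is positive.
    refine ⟨(beta θs / 2) ^ J, J, by positivity, ?_, hJ⟩
    filter_upwards [continuous_beta.continuousAt.eventually (lt_mem_nhds (half_lt_self hb))]
      with θ hθ _
    gcongr

/-- The damped rate never exceeds the Lipschitz coefficient and is strictly smaller on the event of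
`exists_lag`. Its mean logarithm is therefore strictly below zero. -/
lemma hasContraction_of_integral_eq_zero (hx : Measurable x)
    (hi : Integrable (fun z => Real.log (1 + |x z|)) (iidLaw ν)) (h0 : 0 ≤ beta θs)
    (h1 : beta θs < 1) (hs : |gamma θs| ≤ delta θs)
    (hpos : ∀ᵐ z ∂(iidLaw ν), 0 < lipCoeff θs (x z))
    (hint : Integrable (fun z => Real.log (lipCoeff θs (x z))) (iidLaw ν))
    (hmean : ∫ z, Real.log (lipCoeff θs (x z)) ∂(iidLaw ν) = 0) :
    HasContraction ν x θs := by
  obtain ⟨κ, J, hκ, hg, hlag⟩ := exists_lag hx h0 h1 hpos hmean.ge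
  set B := Nbhd.around θs κ 0 J h0 h1 hs hκ.le with hB
  have hρm : Measurable (B.limRate x) := Nbhd.measurable_limRate hx
  have hlow : ∀ z, Real.exp (-κ / 2) / 2 * lipCoeff θs (x z) ≤ B.limRate x z :=
    Nbhd.mul_lipCoeff_le_limRate (B := B) h0
  have hup : ∀ z, B.limRate x z ≤ lipCoeff θs (x z) := Nbhd.limRate_le (B := B)
  have hρ0 : ∀ᵐ z ∂(iidLaw ν), 0 < B.limRate x z := by
    filter_upwards [hpos] with z hz
    exact lt_of_lt_of_le (by positivity) (hlow z)
  have hρi : Integrable (fun z => Real.log (B.limRate x z)) (iidLaw ν) := by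
    refine ((integrable_const |Real.log (Real.exp (-κ / 2) / 2)|).add hint.abs).mono'
      (Real.measurable_log.comp hρm).aestronglyMeasurable ?_
    filter_upwards [hpos, hρ0] with z hz hz'
    have a1 := Real.log_le_log hz' (hup z)
    have a2 := Real.log_le_log (by positivity) (hlow z)
    rw [Real.log_mul (by positivity) hz.ne'] at a2
    have b1 := neg_abs_le (Real.log (Real.exp (-κ / 2) / 2))
    have b2 := neg_abs_le (Real.log (lipCoeff θs (x z)))
    have b3 := le_abs_self (Real.log (lipCoeff θs (x z)))
    have b4 := abs_nonneg (Real.log (Real.exp (-κ / 2) / 2))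
    change |Real.log (B.limRate x z)|
      ≤ |Real.log (Real.exp (-κ / 2) / 2)| + |Real.log (lipCoeff θs (x z))|
    rw [abs_le]; constructor <;> linarith
  have hneg : ∫ z, Real.log (B.limRate x z) ∂(iidLaw ν) < 0 := by
    rw [← hmean]
    refine integral_lt_integral_of_ae_le hρi hint ?_ ?_
    · filter_upwards [hρ0] with z hz using Real.log_le_log hz (hup z)
    · refine fun hnull => hlag (measure_mono_null_ae ?_ hnull)
      filter_upwards [hρ0] with z hz hz'
      exact Real.log_lt_log hz (Nbhd.limRate_lt (B := B) hκ hz'.1 h0 hz'.2)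
  obtain ⟨M, hM⟩ := exists_integral_log_max_neg_of_integral_neg hρm hρ0 hρi hneg
  exact hasContraction_of_limRate hx hi h0 h1 hs (M := M) hκ.le hg hM

/-- A lower bound for the Lipschitz coefficients near `θs`. -/
lemma eventually_le_lipCoeff (h0 : 0 ≤ beta θs) (h1 : beta θs < 1) (hs : |gamma θs| ≤ delta θs)
    {ε : ℝ} (hε : 0 < ε) (hε1 : ε ≤ 1 / 2) :
    ∀ᶠ θ in 𝓝 θs, 0 ≤ beta θ → |gamma θ| ≤ delta θ → ∀ y,
      max (lipCoeff θs y / 8) ((1 - ε) * lipCoeff θs y - 2 * ε) ≤ lipCoeff θ y := by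
  -- The shock and the exponential each lose a factor `1 - ε / 2`, and `(1 - ε / 2) ^ 2 ≥ 1 - ε`.
  have hη : (0 : ℝ) < ε / 2 := by linarith
  have e1 : ∀ᶠ θ in 𝓝 θs, 0 ≤ beta θ → (1 - ε) * beta θs ≤ beta θ :=
    eventually_mul_le_of_continuousAt continuous_beta.continuousAt h0 hε
  have e2 : ∀ᶠ θ in 𝓝 θs, beta θ < beta θs + ε :=
    continuous_beta.continuousAt.eventually (gt_mem_nhds (by linarith))
  have e3 : ∀ᶠ θ in 𝓝 θs, (1 - ε / 2) * Real.exp (-fixpt θs / 2) < Real.exp (-fixpt θ / 2) := by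
    have hc : ContinuousAt (fun θ => Real.exp (-fixpt θ / 2)) θs :=
      ((continuousAt_fixpt h1).neg.div_const 2).rexp
    refine hc.eventually (lt_mem_nhds ?_)
    have := Real.exp_pos (-fixpt θs / 2)
    nlinarith
  filter_upwards [e1, e2, e3, eventually_mul_drive_le hs hη] with θ e1 e2 e3 e4 b0 hθ y
  have e1 := e1 b0
  have e4 := e4 hθ y
  have hd := drive_nonneg hs y
  have hd' := drive_nonneg hθ y
  have hE := Real.exp_pos (-fixpt θs / 2)
  set us := (1 / 2) * drive θs y * Real.exp (-fixpt θs / 2) with hus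
  set u := (1 / 2) * drive θ y * Real.exp (-fixpt θ / 2) with hu
  have hus0 : 0 ≤ us := by positivity
  have key : (1 - ε) * us ≤ u := by
    have a1 : 0 ≤ 1 - ε / 2 := by linarith
    have : ((1 - ε / 2) * drive θs y) * ((1 - ε / 2) * Real.exp (-fixpt θs / 2))
        ≤ drive θ y * Real.exp (-fixpt θ / 2) := by
      have := e3.le
      gcongr
    have a2 : (1 - ε) * us ≤ (1 - ε / 2) ^ 2 * us := by
      have : 1 - ε ≤ (1 - ε / 2) ^ 2 := by nlinarith [sq_nonneg (ε / 2)]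
      gcongr
    rw [hus] at a2 ⊢
    rw [hu]
    linarith
  have l1 : beta θ ≤ lipCoeff θ y := le_max_left _ _
  have l2 : u - beta θ ≤ lipCoeff θ y := by rw [lipCoeff_eq]; exact le_max_right _ _
  rw [lipCoeff_eq θs, ← hus]
  have hε2 : (1 : ℝ) / 2 ≤ 1 - ε := by linarith
  have hb2 : beta θs / 2 ≤ beta θ := by nlinarith
  have hu2 : us / 2 ≤ u := by nlinarith
  refine max_le ?_ ?_
  · rcases max_choice (beta θs) (us - beta θs) with h | h <;> rw [h] <;> linarith
  · rcases max_choice (beta θs) (us - beta θs) with h | h <;> rw [h]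
    · linarith
    · nlinarith

/-- Parameters with positive expected logarithmic Lipschitz coefficient are eventually excluded
from the empirical constraint set. -/
lemma eventually_excluded_of_integral_pos (hx : Measurable x) (h0 : 0 ≤ beta θs)
    (h1 : beta θs < 1) (hs : |gamma θs| ≤ delta θs)
    (hpos : ∀ᵐ z ∂(iidLaw ν), 0 < lipCoeff θs (x z))
    (hint : Integrable (fun z => Real.log (lipCoeff θs (x z))) (iidLaw ν))
    (hmean : 0 < ∫ z, Real.log (lipCoeff θs (x z)) ∂(iidLaw ν)) :
    ∃ U ∈ 𝓝 θs, ∀ᵐ z ∂(iidLaw ν), ∀ᶠ n : ℕ in atTop, ∀ θ ∈ U, 0 ≤ beta θ →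
      |gamma θ| ≤ delta θ → 0 < ∑ t ∈ Finset.Icc 1 n, logLip θ (orbit x z t) := by
  set L : (ℤ → ℝ) → ℝ := fun z => lipCoeff θs (x z) with hLdef
  have hL : Measurable L := (measurable_lipCoeff θs).comp hx
  let r : ℕ → ℝ := fun n => 1 / ((n : ℝ) + 2)
  -- The second entry tends to `L`; the first keeps `log l` above `log L - log 8`, which supplies
  -- the dominating function.
  let l : ℕ → (ℤ → ℝ) → ℝ := fun n z => max (L z / 8) ((1 - r n) * L z - 2 * r n)
  have hr0 : ∀ n, 0 < r n := fun n => by positivity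
  have hr1 : ∀ n, r n ≤ 1 / 2 := fun n =>
    one_div_le_one_div_of_le two_pos (by linarith [n.cast_nonneg (α := ℝ)])
  have hr : Tendsto r atTop (𝓝 0) := by
    have := (tendsto_add_atTop_iff_nat 1).2 (tendsto_one_div_add_atTop_nhds_zero_nat (𝕜 := ℝ))
    refine this.congr fun n => ?_
    simp only [r]; push_cast; congr 1; ring
  have hlm : ∀ n, Measurable (l n) := fun n =>
    (hL.div_const 8).max ((hL.const_mul _).sub_const _)
  have hbound : ∀ n, ∀ᵐ z ∂(iidLaw ν), |Real.log (l n z)| ≤ |Real.log (L z)| + Real.log 8 := by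
    intro n
    filter_upwards [hpos] with z hz
    have hz : 0 < L z := hz
    have a1 : L z / 8 ≤ l n z := le_max_left _ _
    have a2 : l n z ≤ L z := max_le (by linarith) (by nlinarith [hr0 n])
    have a3 : 0 < L z / 8 := by positivity
    have b1 := Real.log_le_log a3 a1
    have b2 := Real.log_le_log (a3.trans_le a1) a2
    rw [Real.log_div hz.ne' (by norm_num)] at b1
    have b3 : 0 < Real.log 8 := Real.log_pos (by norm_num)
    have b4 := neg_abs_le (Real.log (L z))
    have b5 := le_abs_self (Real.log (L z))
    rw [abs_le]; constructor <;> linarith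
  have key : Tendsto (fun n => ∫ z, Real.log (l n z) ∂(iidLaw ν)) atTop
      (𝓝 (∫ z, Real.log (L z) ∂(iidLaw ν))) := by
    refine tendsto_integral_of_dominated_convergence (fun z => |Real.log (L z)| + Real.log 8)
      (fun n => (Real.measurable_log.comp (hlm n)).aestronglyMeasurable)
      (hint.abs.add (integrable_const _)) hbound ?_
    filter_upwards [hpos] with z hz
    have hz : 0 < L z := hz
    have hc : Continuous fun ρ : ℝ => max (L z / 8) ((1 - ρ) * L z - 2 * ρ) := by fun_prop
    have h2 := (hc.tendsto 0).comp hr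
    simp only [sub_zero, one_mul, mul_zero] at h2
    rw [max_eq_right (by linarith)] at h2
    exact (Real.continuousAt_log hz.ne').tendsto.comp h2
  obtain ⟨n, hn⟩ := (key.eventually (lt_mem_nhds hmean)).exists
  have hln : Integrable (fun z => Real.log (l n z)) (iidLaw ν) :=
    (hint.abs.add (integrable_const (Real.log 8))).mono'
      (Real.measurable_log.comp (hlm n)).aestronglyMeasurable (hbound n)
  refine ⟨_, eventually_le_lipCoeff h0 h1 hs (hr0 n) (hr1 n), ?_⟩
  filter_upwards [ae_all_shift hpos, ae_all_shift (ae_tendsto_average_shift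
    (Real.measurable_log.comp (hlm n)) hln)] with z hz hav
  have hinf := tendsto_atTop_of_average hn (hav 1)
  filter_upwards [tendsto_atTop.1 hinf 1] with N hN θ hθ b0 hγ
  have hsum : ∑ t ∈ Finset.Icc 1 N, Real.log (l n (shift t z))
      = ∑ i ∈ Finset.range N, Real.log (l n (shift i (shift 1 z))) :=
    sum_Icc_shift (fun z => Real.log (l n z)) N z
  have hlow : ((∑ t ∈ Finset.Icc 1 N, Real.log (l n (shift t z)) : ℝ) : EReal)
      ≤ ∑ t ∈ Finset.Icc 1 N, logLip θ (orbit x z t) := by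
    rw [coe_sum_eReal]
    refine Finset.sum_le_sum fun t _ => ?_
    have hzt : 0 < L (shift t z) := hz t
    exact le_logLip_of_le _ (lt_max_of_lt_left (by positivity)) (hθ b0 hγ _)
  refine lt_of_lt_of_le ?_ hlow
  rw [hsum]
  have : (0 : ℝ) < ∑ i ∈ Finset.range N, Real.log (l n (shift i (shift 1 z))) :=
    lt_of_lt_of_le one_pos hN
  exact_mod_cast this

/-- Every parameter either has a neighbourhood of contraction, or a neighbourhood which is
eventually excluded from the empirical constraint set. -/
lemma hasContraction_or_excluded (hx : Measurable x)
    (hi : Integrable (fun z => Real.log (1 + |x z|)) (iidLaw ν)) (h0 : 0 ≤ beta θs)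
    (h1 : beta θs < 1) (hs : |gamma θs| ≤ delta θs) :
    HasContraction ν x θs ∨
    ∃ U ∈ 𝓝 θs, ∀ᵐ z ∂(iidLaw ν), ∀ᶠ n : ℕ in atTop, ∀ θ ∈ U, 0 ≤ beta θ →
      |gamma θ| ≤ delta θ → 0 < ∑ t ∈ Finset.Icc 1 n, logLip θ (orbit x z t) := by
  rcases lt_or_ge (∫⁻ z, ENNReal.ofReal (Real.log (lipCoeff θs (x z))) ∂(iidLaw ν))
    (∫⁻ z, negLog (lipCoeff θs (x z)) ∂(iidLaw ν)) with h | h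
  · exact Or.inl (hasContraction_of_lintegral_lt hx hi h0 h1 hs h)
  · obtain ⟨hpos, hint, hmean⟩ := integrable_log_of_lintegral_negLog_le hi
      ((measurable_lipCoeff θs).comp hx) (fun z => le_max_of_le_left h0) (one_le_lipBound θs)
      (fun z => lipCoeff_le θs (x z)) h
    rcases hmean.eq_or_lt with h2 | h2
    · exact Or.inl (hasContraction_of_integral_eq_zero hx hi h0 h1 hs hpos hint h2.symm)
    · exact Or.inr (eventually_excluded_of_integral_pos hx h0 h1 hs hpos hint h2)

end

/-! ### Compact sets of contraction that capture the empirical constraint set. -/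

section

/-- Along the sample point `z`, the inverted recursions contract to their stationary solutions,
uniformly over `C`. -/
structure ContractsAt (x : (ℤ → ℝ) → ℝ) (C : Set Param) (z : ℤ → ℝ) : Prop where
  continuousOn : ∀ t : ℤ, ContinuousOn (fun θ => statG x θ (shift t z)) C
  fixpt_le : ∀ t : ℤ, ∀ θ ∈ C, fixpt θ ≤ statG x θ (shift t z)
  step : ∀ t : ℤ, ∀ θ ∈ C,
    statG x θ (shift (t + 1) z) = phi θ (x (shift t z)) (statG x θ (shift t z))
  forward : ∀ c : ℝ, ∀ ε > 0, ∀ᶠ n : ℕ in atTop, ∀ θ ∈ C, ∀ s, |s| ≤ c →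
    |gHat (orbit x z) θ s n - statG x θ (shift n z)| ≤ ε

/-- A compact set of parameters over which the inverted recursions contract almost surely. -/
structure IsContractive (ν : Measure ℝ) [IsProbabilityMeasure ν] (x : (ℤ → ℝ) → ℝ)
    (C : Set Param) : Prop where
  isCompact : IsCompact C
  beta_nonneg : ∀ θ ∈ C, 0 ≤ beta θ
  beta_lt_one : ∀ θ ∈ C, beta θ < 1
  abs_gamma_le : ∀ θ ∈ C, |gamma θ| ≤ delta θ
  ae_contractsAt : ∀ᵐ z ∂(iidLaw ν), ContractsAt x C z

variable {ν : Measure ℝ} [IsProbabilityMeasure ν] {x : (ℤ → ℝ) → ℝ} {C D : Set Param}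
  {z : ℤ → ℝ}

lemma ContractsAt.empty : ContractsAt x ∅ z :=
  ⟨fun _ => continuousOn_empty _, fun _ _ h => h.elim, fun _ _ h => h.elim,
    fun _ _ _ => Eventually.of_forall fun _ _ h => h.elim⟩

lemma ContractsAt.union (hC : IsClosed C) (hD : IsClosed D) (h : ContractsAt x C z)
    (h' : ContractsAt x D z) : ContractsAt x (C ∪ D) z where
  continuousOn t := (h.continuousOn t).union_of_isClosed (h'.continuousOn t) hC hD
  fixpt_le t θ hθ := hθ.elim (h.fixpt_le t θ) (h'.fixpt_le t θ)
  step t θ hθ := hθ.elim (h.step t θ) (h'.step t θ)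
  forward c ε hε := by
    filter_upwards [h.forward c ε hε, h'.forward c ε hε] with n h1 h2 θ hθ
    exact hθ.elim (h1 θ) (h2 θ)

lemma IsContractive.empty : IsContractive ν x ∅ :=
  ⟨isCompact_empty, fun _ h => h.elim, fun _ h => h.elim, fun _ h => h.elim,
    ae_of_all _ fun _ => ContractsAt.empty⟩

lemma IsContractive.union (h : IsContractive ν x C) (h' : IsContractive ν x D) :
    IsContractive ν x (C ∪ D) where
  isCompact := h.isCompact.union h'.isCompact
  beta_nonneg θ hθ := hθ.elim (h.beta_nonneg θ) (h'.beta_nonneg θ)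
  beta_lt_one θ hθ := hθ.elim (h.beta_lt_one θ) (h'.beta_lt_one θ)
  abs_gamma_le θ hθ := hθ.elim (h.abs_gamma_le θ) (h'.abs_gamma_le θ)
  ae_contractsAt := by
    filter_upwards [h.ae_contractsAt, h'.ae_contractsAt] with z h1 h2
    exact h1.union h.isCompact.isClosed h'.isCompact.isClosed h2

lemma Nbhd.contractsAt {B : Nbhd} (hC : ∀ θ ∈ C, B.Mem θ)
    (h : ∀ t : ℤ, B.Good x (shift t z)) : ContractsAt x C z where
  continuousOn t := (Nbhd.continuousOn_statG (Nbhd.good_shift h t)).mono hC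
  fixpt_le t θ hθ := ((hC θ hθ).statG_mem (Nbhd.good_shift h t)).1
  step t θ hθ := by
    have := (hC θ hθ).statG_shift_one (Nbhd.good_shift h t)
    rwa [EGARCH.shift_shift, add_comm 1 t] at this
  forward c ε hε := by
    filter_upwards [Nbhd.eventually_abs_gHat_sub_statG_le h c hε] with n hn θ hθ
    exact hn θ (hC θ hθ)

lemma HasContraction.exists_isContractive {θs : Param} {Θ : Set Param} (hx : Measurable x)
    (hi : Integrable (fun z => Real.log (1 + |x z|)) (iidLaw ν)) (hΘ : IsCompact Θ)
    (hβ : ∀ θ ∈ Θ, 0 ≤ beta θ ∧ beta θ < 1) (h : HasContraction ν x θs) :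
    ∃ r > 0, IsContractive ν x (Metric.closedBall θs r ∩ Θ ∩ {θ | |gamma θ| ≤ delta θ}) := by
  obtain ⟨B, hB, hmem⟩ := h
  obtain ⟨r, hr, hsub⟩ := Metric.nhds_basis_closedBall.mem_iff.1 hmem
  have hM : ∀ θ ∈ Metric.closedBall θs r ∩ Θ ∩ {θ | |gamma θ| ≤ delta θ}, B.Mem θ :=
    fun θ hθ => hsub hθ.1.1 (hβ θ hθ.1.2).1 hθ.2
  refine ⟨r, hr, ?_, fun θ hθ => (hβ θ hθ.1.2).1, fun θ hθ => (hβ θ hθ.1.2).2,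
    fun θ hθ => hθ.2, ?_⟩
  · exact (hΘ.inter_left Metric.isClosed_closedBall).inter_right
      (isClosed_le continuous_gamma.abs continuous_delta)
  · filter_upwards [Nbhd.ae_good hx hi hB] with z hz using Nbhd.contractsAt hM hz

/-- The empirical constraint set is eventually contained in a set of contraction. -/
theorem exists_isContractive_stableSet_subset {Θ : Set Param} {ε : ℝ} (hx : Measurable x)
    (hi : Integrable (fun z => Real.log (1 + |x z|)) (iidLaw ν)) (hΘ : IsCompact Θ)
    (hβ : ∀ θ ∈ Θ, 0 ≤ beta θ ∧ beta θ < 1) (hε : 0 < ε) :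
    ∃ C, IsContractive ν x C ∧
      ∀ᵐ z ∂(iidLaw ν), ∀ᶠ n : ℕ in atTop, stableSet Θ ε (orbit x z) n ⊆ C := by
  -- The redundant `Θ ∩` makes the claim local in a subset of `Θ`, as induction over a compact set
  -- requires.
  suffices h : ∃ C, IsContractive ν x C ∧
      ∀ᵐ z ∂(iidLaw ν), ∀ᶠ n : ℕ in atTop, Θ ∩ stableSet Θ ε (orbit x z) n ⊆ C by
    obtain ⟨C, hC, h⟩ := h
    refine ⟨C, hC, ?_⟩
    filter_upwards [h] with z hz
    filter_upwards [hz] with n hn θ hθ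
    exact hn ⟨hθ.1, hθ⟩
  refine hΘ.induction_on (p := fun s => ∃ C, IsContractive ν x C ∧
      ∀ᵐ z ∂(iidLaw ν), ∀ᶠ n : ℕ in atTop, s ∩ stableSet Θ ε (orbit x z) n ⊆ C) ?_ ?_ ?_ ?_
  · exact ⟨∅, IsContractive.empty, ae_of_all _ fun z => Eventually.of_forall fun n => by simp⟩
  · rintro s t hst ⟨C, hC, h⟩
    refine ⟨C, hC, ?_⟩
    filter_upwards [h] with z hz
    filter_upwards [hz] with n hn
    exact (Set.inter_subset_inter_left _ hst).trans hn
  · rintro s t ⟨C, hC, h⟩ ⟨D, hD, h'⟩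
    refine ⟨C ∪ D, hC.union hD, ?_⟩
    filter_upwards [h, h'] with z h1 h2
    filter_upwards [h1, h2] with n h1 h2
    rw [Set.union_inter_distrib_right]
    exact Set.union_subset_union h1 h2
  · intro θs hθs
    by_cases hs : |gamma θs| ≤ delta θs
    · rcases hasContraction_or_excluded (ν := ν) hx hi (hβ θs hθs).1 (hβ θs hθs).2 hs
        with h | ⟨U, hU, h⟩
      · obtain ⟨r, hr, hC⟩ := h.exists_isContractive hx hi hΘ hβ
        refine ⟨Metric.closedBall θs r, mem_nhdsWithin_of_mem_nhds
          (Metric.closedBall_mem_nhds θs hr), _, hC, ae_of_all _ fun z =>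
          Eventually.of_forall fun n θ hθ => ⟨⟨hθ.1, hθ.2.1⟩, hθ.2.2.1⟩⟩
      · refine ⟨U, mem_nhdsWithin_of_mem_nhds hU, ∅, IsContractive.empty, ?_⟩
        filter_upwards [h] with z hz
        filter_upwards [hz] with n hn θ hθ
        have h1 := hn θ hθ.1 (hβ θ hθ.2.1).1 hθ.2.2.1
        have h2 : ∑ t ∈ Finset.Icc 1 n, logLip θ (orbit x z t) ≤ ((-ε : ℝ) : EReal) := hθ.2.2.2
        have h3 := h1.trans_le h2
        exact absurd (by exact_mod_cast h3 : (0 : ℝ) < -ε) (by linarith)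
    · refine ⟨{θ | delta θ < |gamma θ|}, mem_nhdsWithin_of_mem_nhds
        ((isOpen_lt continuous_delta continuous_gamma.abs).mem_nhds (not_le.1 hs)), ∅,
        IsContractive.empty, ae_of_all _ fun z => Eventually.of_forall fun n θ hθ => ?_⟩
      exact absurd hθ.2.2.1 (not_le.2 hθ.1)

end

/-! ### A deterministic modulus of continuity off a small event. -/

section Modulus

variable {S : Type*} [MeasurableSpace S] {P : Measure S}

/-- A random function that is almost surely continuous on a compact set has a deterministic bound
and a deterministic modulus of continuity off a set of small probability. -/
lemma exists_modulus [IsFiniteMeasure P] {C : Set Param} {F : Param → S → ℝ} (hC : IsCompact C)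
    (hm : ∀ θ, Measurable (F θ)) (hc : ∀ᵐ z ∂P, ContinuousOn (fun θ => F θ z) C) {κ : ℝ}
    (hκ : 0 < κ) {ρ : ENNReal} (hρ : ρ ≠ 0) :
    ∃ E, MeasurableSet E ∧ P E ≤ ρ ∧ ∃ M, ∃ d > 0, ∀ z ∉ E, (∀ θ ∈ C, |F θ z| ≤ M) ∧
      ∀ θ ∈ C, ∀ θ' ∈ C, dist θ θ' < d → |F θ z - F θ' z| ≤ κ := by
  obtain ⟨D, hDC, hD, hCD⟩ :=
    (TopologicalSpace.IsSeparable.of_separableSpace C).exists_countable_dense_subset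
  -- The bad events range over a countable dense set, which makes them measurable. They are avoided
  -- for large `j` at every continuous sample function, so their probabilities tend to `0`.
  let A : ℕ → Set S := fun j => ⋃ θ ∈ D, ⋃ θ' ∈ D,
    {z | (j : ℝ) < |F θ z| ∨ dist θ θ' < 1 / ((j : ℝ) + 1) ∧ κ < |F θ z - F θ' z|}
  have hAm : ∀ j, MeasurableSet (A j) := fun j =>
    MeasurableSet.biUnion hD fun θ _ => MeasurableSet.biUnion hD fun θ' _ =>
      (measurableSet_lt measurable_const (hm θ).abs).union
        ((MeasurableSet.const _).inter
          (measurableSet_lt measurable_const ((hm θ).sub (hm θ')).abs))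
  have hmem : ∀ {j z}, z ∈ A j ↔ ∃ θ ∈ D, ∃ θ' ∈ D,
      (j : ℝ) < |F θ z| ∨ dist θ θ' < 1 / ((j : ℝ) + 1) ∧ κ < |F θ z - F θ' z| := by
    intro j z; simp [A]
  have hlim : Tendsto (fun j => P (A j)) atTop (𝓝 (P ∅)) := by
    refine tendsto_measure_of_ae_tendsto_indicator_of_isFiniteMeasure _ MeasurableSet.empty hAm ?_
    filter_upwards [hc] with z hz
    obtain ⟨M, hM⟩ := hC.exists_bound_of_continuousOn hz
    obtain ⟨d, hd, hu⟩ := Metric.uniformContinuousOn_iff.1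
      (hC.uniformContinuousOn_of_continuous hz) κ hκ
    have h2 := (tendsto_one_div_add_atTop_nhds_zero_nat (𝕜 := ℝ)).eventually (gt_mem_nhds hd)
    filter_upwards [h2, eventually_ge_atTop ⌈M⌉₊] with j hj hjM
    simp only [Set.mem_empty_iff_false, iff_false]
    intro hzA
    obtain ⟨θ, hθ, θ', hθ', h | ⟨h, h'⟩⟩ := hmem.1 hzA
    · have : M ≤ j := (Nat.le_ceil M).trans (by exact_mod_cast hjM)
      exact absurd (hM θ (hDC hθ)) (not_le.2 (this.trans_lt h))
    · exact absurd (hu θ (hDC hθ) θ' (hDC hθ') (h.trans hj)) (not_lt.2 h'.le)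
  rw [measure_empty] at hlim
  obtain ⟨j, hj⟩ := (hlim.eventually (gt_mem_nhds (pos_iff_ne_zero.2 hρ))).exists
  refine ⟨A j ∪ toMeasurable P {z | ¬ ContinuousOn (fun θ => F θ z) C},
    (hAm j).union (measurableSet_toMeasurable _ _), ?_, j, 1 / ((j : ℝ) + 1), by positivity, ?_⟩
  · refine (measure_union_le _ _).trans ?_
    rw [measure_toMeasurable, show P {z | ¬ ContinuousOn (fun θ => F θ z) C} = 0 from hc, add_zero]
    exact hj.le
  · intro z hz
    have hzA : z ∉ A j := fun h => hz (Or.inl h)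
    have hzc : ContinuousOn (fun θ => F θ z) C := by
      by_contra h
      exact hz (Or.inr (subset_toMeasurable _ _ h))
    constructor
    · intro θ hθ
      by_contra! hlt
      have h1 : ∀ᶠ θ' in 𝓝[C] θ, (j : ℝ) < |F θ' z| :=
        (hzc θ hθ).abs.eventually (lt_mem_nhds hlt)
      rw [eventually_nhdsWithin_iff] at h1
      obtain ⟨θ', h2, h3⟩ := ((mem_closure_iff_frequently.1 (hCD hθ)).and_eventually h1).exists
      exact hzA (hmem.2 ⟨θ', h2, θ', h2, Or.inl (h3 (hDC h2))⟩)
    · intro θ hθ θ' hθ' hdist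
      by_contra! hlt
      have hcl : (θ, θ') ∈ closure (D ×ˢ D) := by
        rw [closure_prod_eq]; exact ⟨hCD hθ, hCD hθ'⟩
      have hcont : ContinuousWithinAt (fun p : Param × Param => |F p.1 z - F p.2 z|) (C ×ˢ C)
          (θ, θ') := by
        have c1 : ContinuousOn (fun p : Param × Param => F p.1 z) (C ×ˢ C) :=
          hzc.comp continuousOn_fst fun p hp => hp.1
        have c2 : ContinuousOn (fun p : Param × Param => F p.2 z) (C ×ˢ C) :=
          hzc.comp continuousOn_snd fun p hp => hp.2
        exact (c1.sub c2).abs _ ⟨hθ, hθ'⟩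
      have h1 := hcont.eventually (lt_mem_nhds hlt)
      rw [eventually_nhdsWithin_iff] at h1
      have h2 : ∀ᶠ p : Param × Param in 𝓝 (θ, θ'), dist p.1 p.2 < 1 / ((j : ℝ) + 1) :=
        continuous_dist.continuousAt.eventually (gt_mem_nhds hdist)
      obtain ⟨p, hp, h3, h4⟩ := ((mem_closure_iff_frequently.1 hcl).and_eventually
        (h1.and h2)).exists
      exact hzA (hmem.2 ⟨p.1, hp.1, p.2, hp.2, Or.inr ⟨h4, h3 ⟨hDC hp.1, hDC hp.2⟩⟩⟩)

lemma abs_integral_sub_integral_le [IsProbabilityMeasure P] {F F' : S → ℝ} {N : Set S} {b η r : ℝ}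
    (hF : Measurable F) (hF' : Measurable F') (hN : MeasurableSet N) (hη : 0 ≤ η)
    (hb : ∀ ω, |F ω| ≤ b) (hb' : ∀ ω, |F' ω| ≤ b) (hout : ∀ ω ∉ N, |F ω - F' ω| ≤ η)
    (hr : 0 ≤ r) (hPN : P N ≤ ENNReal.ofReal r) :
    |∫ ω, F ω ∂P - ∫ ω, F' ω ∂P| ≤ η + 2 * b * r := by
  have hi : Integrable F P := Integrable.of_bound hF.aestronglyMeasurable b (ae_of_all _ hb)
  have hi' : Integrable F' P := Integrable.of_bound hF'.aestronglyMeasurable b (ae_of_all _ hb')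
  obtain ⟨ω₀⟩ := nonempty_of_isProbabilityMeasure P
  have hb0 : 0 ≤ b := (abs_nonneg _).trans (hb ω₀)
  have hI : Integrable (N.indicator fun _ => 2 * b) P := (integrable_const _).indicator hN
  rw [← integral_sub hi hi']
  calc |∫ ω, F ω - F' ω ∂P| ≤ ∫ ω, |F ω - F' ω| ∂P := abs_integral_le_integral_abs
    _ ≤ ∫ ω, η + N.indicator (fun _ => 2 * b) ω ∂P := by
      refine integral_mono (hi.sub hi').abs ((integrable_const η).add hI) fun ω => ?_
      by_cases h : ω ∈ N
      · have := abs_sub (F ω) (F' ω)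
        simp only [Set.indicator_of_mem h]
        linarith [hb ω, hb' ω]
      · simpa [Set.indicator_of_notMem h] using hout ω h
    _ = η + 2 * b * P.real N := by
      rw [integral_add (integrable_const η) hI, integral_indicator_const _ hN]
      simp [mul_comm]
    _ ≤ η + 2 * b * r := by
      have : P.real N ≤ r := ENNReal.toReal_le_of_le_ofReal hr hPN
      gcongr

lemma tendsto_measure_zero_of_eventually_notMem [IsFiniteMeasure P] {A : ℕ → Set S}
    (hA : ∀ n, MeasurableSet (A n)) (h : ∀ᵐ ω ∂P, ∀ᶠ n in atTop, ω ∉ A n) :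
    Tendsto (fun n => P (A n)) atTop (𝓝 0) := by
  rw [← measure_empty (μ := P)]
  refine tendsto_measure_of_ae_tendsto_indicator_of_isFiniteMeasure _ MeasurableSet.empty hA ?_
  filter_upwards [h] with ω hω
  filter_upwards [hω] with n hn
  simpa using hn

end Modulus

/-! ### Limit law and merging of the forecasts. -/

section Forecast

variable {Ω : Type*} [MeasurableSpace Ω] {μ : Measure Ω} [IsProbabilityMeasure μ]
  {ν : Measure ℝ} [IsProbabilityMeasure ν] {W : Ω → ℤ → ℝ} {x : (ℤ → ℝ) → ℝ} {C : Set Param}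

/-- The limit law of the volatility forecast. -/
def limitLaw (ν : Measure ℝ) [IsProbabilityMeasure ν] (x : (ℤ → ℝ) → ℝ) (hx : Measurable x)
    (θ : Param) : ProbabilityMeasure ℝ :=
  ⟨((iidLaw ν).map (statG x θ)).map Real.exp,
    haveI : IsProbabilityMeasure ((iidLaw ν).map (statG x θ)) :=
      Measure.isProbabilityMeasure_map
        (measurable_statG hx measurable_const measurable_id).aemeasurable
    Measure.isProbabilityMeasure_map Real.measurable_exp.aemeasurable⟩

lemma measurable_volHat_orbit (hx : Measurable x) (hW : Measurable W) {θ : Ω → Param} {s : Ω → ℝ}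
    (hθ : Measurable θ) (hs : Measurable s) (n : ℕ) :
    Measurable fun ω => gHat (orbit x (W ω)) (θ ω) (s ω) n :=
  measurable_gHat (X := fun ω => orbit x (W ω))
    (fun i => hx.comp ((measurable_shift i).comp hW)) hθ hs n

/-- The law of the forecast converges, and the limit does not depend on the initial value. -/
theorem tendstoInDistribution_volHat (hx : Measurable x)
    (hW : MeasurePreserving W μ (iidLaw ν)) (hC : IsContractive ν x C) {θ : Param} (hθ : θ ∈ C)
    (s : ℝ) :
    TendstoInDistribution (fun (t : ℕ) (ω : Ω) => volHat (orbit x (W ω)) θ s t) atTop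
      (id : ℝ → ℝ) (fun _ => μ) (limitLaw ν x hx θ : Measure ℝ) := by
  have hG : Measurable (statG x θ) := measurable_statG hx measurable_const measurable_id
  have hsh : ∀ t : ℤ, MeasurePreserving (fun ω => shift t (W ω)) μ (iidLaw ν) := fun t =>
    (measurePreserving_shift ν t).comp hW
  have hlaw : ∀ t : ℕ, μ.map (fun ω => statG x θ (shift t (W ω))) = (iidLaw ν).map (statG x θ) := by
    intro t
    rw [← (hsh t).map_eq, Measure.map_map hG (hsh t).measurable]
    rfl
  have hGt : ∀ t : ℕ, Measurable fun ω => statG x θ (shift t (W ω)) := fun t =>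
    hG.comp (hsh t).measurable
  have h1 : TendstoInDistribution (fun (t : ℕ) ω => statG x θ (shift t (W ω))) atTop
      (statG x θ) (fun _ => μ) (iidLaw ν) :=
    tendstoInDistribution_of_identDistrib 0
      (fun t => ⟨(hGt 0).aemeasurable, (hGt t).aemeasurable, (hlaw 0).trans (hlaw t).symm⟩)
      ⟨(hGt 0).aemeasurable, hG.aemeasurable, hlaw 0⟩
  have hgm : ∀ t, Measurable fun ω => gHat (orbit x (W ω)) θ s t := fun t =>
    measurable_volHat_orbit hx hW.measurable measurable_const measurable_const t
  have h2 : TendstoInMeasure μ ((fun (t : ℕ) ω => gHat (orbit x (W ω)) θ s t)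
      - fun (t : ℕ) ω => statG x θ (shift t (W ω))) atTop 0 := by
    refine tendstoInMeasure_of_tendsto_ae
      (fun t => ((hgm t).sub (hGt t)).aestronglyMeasurable) ?_
    filter_upwards [hW.quasiMeasurePreserving.ae hC.ae_contractsAt] with ω hω
    rw [Metric.tendsto_atTop']
    intro ε hε
    obtain ⟨N, hN⟩ := eventually_atTop.1 (hω.forward |s| (ε / 2) (half_pos hε))
    refine ⟨N, fun n hn => ?_⟩
    have := hN n hn.le θ hθ s le_rfl
    simp only [Pi.sub_apply, Pi.zero_apply, Real.dist_eq, sub_zero]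
    linarith
  have h3 := tendstoInDistribution_of_tendstoInMeasure_sub _ _ h1 h2
    fun t => (hgm t).aemeasurable
  have h4 := h3.continuous_comp Real.continuous_exp
  refine ⟨h4.forall_aemeasurable, aemeasurable_id, ?_⟩
  convert! h4.tendsto using 2
  refine congrArg 𝓝 (Subtype.ext ?_)
  change Measure.map id (((iidLaw ν).map (statG x θ)).map Real.exp) = _
  rw [Measure.map_id, Measure.map_map Real.measurable_exp hG]

/-- Contraction is uniform over `C`, so one exceptional event per `t` serves all `n` at once. This
permits `t` and `n` to tend to infinity jointly. -/
lemma tendsto_measure_forecast_error (hx : Measurable x) (hW : MeasurePreserving W μ (iidLaw ν))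
    (hC : IsContractive ν x C) {θ : ℕ → Ω → Param} (hθ : ∀ n, Measurable (θ n)) {k : Param → ℝ}
    (hk : Continuous k) {κ : ℝ} (hκ : 0 < κ) :
    ∃ B : ℕ → Set Ω, (∀ t, MeasurableSet (B t)) ∧ Tendsto (fun t => μ (B t)) atTop (𝓝 0) ∧
      ∀ (t : ℕ), ∀ ω ∉ B t, ∀ n, θ n ω ∈ C →
        |gHat (orbit x (W ω)) (θ n ω) (k (θ n ω)) t - statG x (θ n ω) (shift t (W ω))| ≤ κ := by
  let B : ℕ → Set Ω := fun t => ⋃ n, {ω | θ n ω ∈ C ∧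
    κ < |gHat (orbit x (W ω)) (θ n ω) (k (θ n ω)) t - statG x (θ n ω) (shift t (W ω))|}
  have hB : ∀ t, MeasurableSet (B t) := fun t => MeasurableSet.iUnion fun n =>
    (hθ n hC.isCompact.isClosed.measurableSet).inter (measurableSet_lt measurable_const
      ((measurable_volHat_orbit hx hW.measurable (hθ n) (hk.measurable.comp (hθ n)) t).sub
        (measurable_statG hx (hθ n) ((measurable_shift t).comp hW.measurable))).abs)
  refine ⟨B, hB, tendsto_measure_zero_of_eventually_notMem hB ?_, fun t ω hω n hn => ?_⟩
  · obtain ⟨c, hc⟩ := hC.isCompact.exists_bound_of_continuousOn hk.continuousOn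
    filter_upwards [hW.quasiMeasurePreserving.ae hC.ae_contractsAt] with ω hω
    filter_upwards [hω.forward c κ hκ] with t ht
    simp only [B, Set.mem_iUnion, not_exists]
    exact fun n hn => absurd (ht _ hn.1 _ (hc _ hn.1)) (not_le.2 hn.2)
  · by_contra! h
    exact hω (Set.mem_iUnion.2 ⟨n, hn, h⟩)

/-- The laws of the forecasts merge for all pairs of initial values. -/
theorem tendsto_integral_volHat_sub (hx : Measurable x) (hW : MeasurePreserving W μ (iidLaw ν))
    (hC : IsContractive ν x C) {θ θ' : ℕ → Ω → Param} (hθ : ∀ n, Measurable (θ n))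
    (hθ' : ∀ n, Measurable (θ' n)) (hmem : ∀ᵐ ω ∂μ, ∀ᶠ n in atTop, θ n ω ∈ C)
    (hmem' : ∀ᵐ ω ∂μ, ∀ᶠ n in atTop, θ' n ω ∈ C)
    (hsub : TendstoInMeasure μ (fun n ω => θ n ω - θ' n ω) atTop (fun _ => 0)) {k k' : Param → ℝ}
    (hk : Continuous k) (hk' : Continuous k') (f : BoundedContinuousFunction ℝ ℝ) :
    Tendsto (fun p : ℕ × ℕ =>
      (∫ ω, f (volHat (orbit x (W ω)) (θ p.2 ω) (k (θ p.2 ω)) p.1) ∂μ)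
        - ∫ ω, f (volHat (orbit x (W ω)) (θ' p.2 ω) (k' (θ' p.2 ω)) p.1) ∂μ)
      (atTop ×ˢ atTop) (𝓝 0) := by
  rw [Metric.tendsto_nhds]
  intro η hη
  have hGm : ∀ θ, Measurable (statG x θ) := fun θ =>
    measurable_statG hx measurable_const measurable_id
  have hGc : ∀ᵐ z ∂(iidLaw ν), ContinuousOn (fun θ => statG x θ z) C := by
    filter_upwards [hC.ae_contractsAt] with z hz
    simpa using hz.continuousOn 0
  -- The exceptional set will have probability at most `3 * r` and cost at most `2 * ‖f‖ * (3 * r) ≤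
  -- η / 2`; off it the integrands differ by at most `η / 4`.
  set r : ℝ := η / (12 * (‖f‖ + 1)) with hr
  have hf0 := norm_nonneg f
  have hr0 : 0 < r := by positivity
  have hρ : ENNReal.ofReal r ≠ 0 := by simpa using hr0
  obtain ⟨E, hEm, hE, M, _, _, hEM⟩ := exists_modulus hC.isCompact hGm hGc one_pos hρ
  have huc : UniformContinuousOn (fun y => f (Real.exp y)) (Set.Icc (-(M + 1)) (M + 1)) :=
    isCompact_Icc.uniformContinuousOn_of_continuous
      (f.continuous.comp Real.continuous_exp).continuousOn
  obtain ⟨δ, hδ, hfδ⟩ := Metric.uniformContinuousOn_iff.1 huc (η / 4) (by positivity)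
  -- There are three errors of size `κ`: each forecast against its stationary solution, and the two
  -- stationary solutions against each other.
  obtain ⟨κ, hκ, hκ1, hκδ⟩ : ∃ κ > 0, κ ≤ 1 ∧ 3 * κ < δ :=
    ⟨min 1 (δ / 4), by positivity, min_le_left _ _, by
      have := min_le_right 1 (δ / 4); linarith⟩
  -- `E` served for the bound `M`, which had to come before `δ` and `κ`; `E'` serves for the modulus
  -- at the resulting `κ`.
  obtain ⟨E', hEm', hE', _, d, hd, hEd⟩ := exists_modulus hC.isCompact hGm hGc hκ hρ
  obtain ⟨B, hBm, hB0, hB⟩ := tendsto_measure_forecast_error hx hW hC hθ hk hκ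
  obtain ⟨B', hBm', hB0', hB'⟩ := tendsto_measure_forecast_error hx hW hC hθ' hk' hκ
  have hCm := hC.isCompact.isClosed.measurableSet
  have hA : ∀ n, MeasurableSet {ω | θ n ω ∉ C} := fun n => (hθ n hCm).compl
  have hA' : ∀ n, MeasurableSet {ω | θ' n ω ∉ C} := fun n => (hθ' n hCm).compl
  have hA0 := tendsto_measure_zero_of_eventually_notMem (P := μ) hA (by simpa using hmem)
  have hA0' := tendsto_measure_zero_of_eventually_notMem (P := μ) hA' (by simpa using hmem')
  have hD : ∀ n, MeasurableSet {ω | d ≤ ‖θ n ω - θ' n ω - 0‖} := fun n =>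
    measurableSet_le measurable_const (((hθ n).sub (hθ' n)).sub_const 0).norm
  have hD0 := tendstoInMeasure_iff_norm.1 hsub d hd
  have hq : Tendsto (fun p : ℕ × ℕ => μ {ω | θ p.2 ω ∉ C} + μ {ω | θ' p.2 ω ∉ C}
      + μ {ω | d ≤ ‖θ p.2 ω - θ' p.2 ω - 0‖} + μ (B p.1) + μ (B' p.1)) (atTop ×ˢ atTop) (𝓝 0) := by
    have := ((((hA0.comp tendsto_snd).add (hA0'.comp tendsto_snd)).add
      (hD0.comp tendsto_snd)).add (hB0.comp tendsto_fst)).add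
      (hB0'.comp (tendsto_fst (f := atTop) (g := (atTop : Filter ℕ))))
    simpa using this
  filter_upwards [hq.eventually (gt_mem_nhds (pos_iff_ne_zero.2 hρ))] with p hp
  obtain ⟨t, n⟩ := p
  dsimp only at hp ⊢
  -- The bad events for `statG` at time `t` are shifts of `E` and `E'`, so their probability does
  -- not depend on `t`. The estimators may depend on the path in any way, since the bounds off these
  -- events hold for all parameters in `C`.
  have hsh : MeasurePreserving (fun ω => shift t (W ω)) μ (iidLaw ν) :=
    (measurePreserving_shift ν t).comp hW
  set N := {ω | θ n ω ∉ C} ∪ {ω | θ' n ω ∉ C} ∪ {ω | d ≤ ‖θ n ω - θ' n ω - 0‖} ∪ B t ∪ B' t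
    ∪ (fun ω => shift t (W ω)) ⁻¹' E ∪ (fun ω => shift t (W ω)) ⁻¹' E' with hN
  have hNm : MeasurableSet N := (((((((hA n).union (hA' n)).union (hD n)).union (hBm t)).union
    (hBm' t)).union (hsh.measurable hEm)).union (hsh.measurable hEm'))
  have hμN : μ N ≤ ENNReal.ofReal (3 * r) := by
    have e1 := hsh.measure_preimage hEm.nullMeasurableSet
    have e2 := hsh.measure_preimage hEm'.nullMeasurableSet
    calc μ N ≤ μ {ω | θ n ω ∉ C} + μ {ω | θ' n ω ∉ C} + μ {ω | d ≤ ‖θ n ω - θ' n ω - 0‖}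
          + μ (B t) + μ (B' t) + μ ((fun ω => shift t (W ω)) ⁻¹' E)
          + μ ((fun ω => shift t (W ω)) ⁻¹' E') := by
          refine (measure_union_le _ _).trans (add_le_add_left ?_ _)
          refine (measure_union_le _ _).trans (add_le_add_left ?_ _)
          refine (measure_union_le _ _).trans (add_le_add_left ?_ _)
          refine (measure_union_le _ _).trans (add_le_add_left ?_ _)
          refine (measure_union_le _ _).trans (add_le_add_left ?_ _)
          exact measure_union_le _ _
      _ ≤ ENNReal.ofReal r + ENNReal.ofReal r + ENNReal.ofReal r := by
          rw [e1, e2]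
          exact add_le_add (add_le_add hp.le hE) hE'
      _ = ENNReal.ofReal (3 * r) := by
          rw [← ENNReal.ofReal_add hr0.le hr0.le, ← ENNReal.ofReal_add (by positivity) hr0.le]
          congr 1; ring
  have hfm : ∀ {k : Param → ℝ} {θ : ℕ → Ω → Param}, Continuous k → (∀ n, Measurable (θ n)) →
      Measurable fun ω => f (volHat (orbit x (W ω)) (θ n ω) (k (θ n ω)) t) := fun hk hθ =>
    (f.continuous.comp Real.continuous_exp).measurable.comp
      (measurable_volHat_orbit hx hW.measurable (hθ n) (hk.measurable.comp (hθ n)) t)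
  have key := abs_integral_sub_integral_le (P := μ) (η := η / 4) (b := ‖f‖) (r := 3 * r)
    (hfm hk hθ) (hfm hk' hθ') hNm (by positivity) (fun ω => f.norm_coe_le_norm _)
    (fun ω => f.norm_coe_le_norm _) ?_ (by positivity) hμN
  · rw [Real.dist_eq, sub_zero]
    refine key.trans_lt ?_
    have : 2 * ‖f‖ * (3 * r) ≤ η / 2 := by
      rw [hr]
      have : 2 * ‖f‖ * (3 * (η / (12 * (‖f‖ + 1)))) = (‖f‖ / (‖f‖ + 1)) * (η / 2) := by
        field_simp; ring
      rw [this]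
      have : ‖f‖ / (‖f‖ + 1) ≤ 1 := (div_le_one (by positivity)).2 (by linarith)
      nlinarith
    linarith
  · intro ω hω
    simp only [hN, Set.mem_union, not_or, Set.mem_ofPred_eq, not_not, not_le, Set.mem_preimage]
      at hω
    obtain ⟨⟨⟨⟨⟨⟨w1, w2⟩, w3⟩, w4⟩, w5⟩, w6⟩, w7⟩ := hω
    have b1 := hB t ω w4 n w1
    have b2 := hB' t ω w5 n w2
    have m1 := (hEM _ w6).1 _ w1
    have m2 := (hEM _ w6).1 _ w2
    rw [sub_zero, ← dist_eq_norm] at w3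
    have m3 := (hEd _ w7).2 _ w1 _ w2 w3
    rw [abs_le] at b1 b2 m1 m2 m3
    refine (hfδ _ ?_ _ ?_ ?_).le
    · constructor <;> linarith
    · constructor <;> linarith
    · rw [Real.dist_eq, abs_lt]; constructor <;> linarith

end Forecast

/-! ### Identification of the parameter from the stationary solution. -/

section Identification

variable {ν : Measure ℝ} {θ₀ θ : Param}

/-- If the law of the innovations is not concentrated on two points, then `1, y, |y|` are linearly
independent. -/
lemma IsStdLaw.eq_zero_of_ae (hν : IsStdLaw ν) (h2 : ∀ a b : ℝ, ¬ ∀ᵐ y ∂ν, y = a ∨ y = b)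
    {c d e : ℝ} (h : ∀ᵐ y ∂ν, c * y + d * |y| = e) : c = 0 ∧ d = 0 := by
  -- If one slope and `e` vanish, the law lives on a half-line; being centered, it would then be
  -- concentrated at `0`.
  have hpos : ∀ {g : ℝ → ℝ}, Integrable g ν → ∫ y, g y ∂ν = 0 → (∀ᵐ y ∂ν, 0 ≤ g y) →
      (∀ᵐ y ∂ν, g y = 0 → y = 0) → False := by
    intro g hg h0 hge hz
    have := (integral_eq_zero_iff_of_nonneg_ae hge hg).1 h0
    refine h2 0 0 ?_
    filter_upwards [this, hz] with y h1 h2 using Or.inl (h2 h1)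
  by_cases hp : c + d = 0 <;> by_cases hm : c - d = 0
  · constructor <;> linarith
  · exfalso
    by_cases he : e = 0
    · refine hpos hν.integrable hν.mean ?_ (ae_of_all _ fun y h => h)
      filter_upwards [h] with y hy
      by_contra! hlt
      rw [abs_of_neg hlt, he] at hy
      exact hm ((mul_eq_zero.1 (by linarith : (c - d) * y = 0)).resolve_right hlt.ne)
    · refine h2 (e / (c - d)) (e / (c - d)) ?_
      filter_upwards [h] with y hy
      rcases le_or_gt 0 y with h0 | h0
      · rw [abs_of_nonneg h0, ← add_mul, hp, zero_mul] at hy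
        exact absurd hy.symm he
      · rw [abs_of_neg h0] at hy
        left; rw [eq_div_iff hm]; linarith
  · exfalso
    by_cases he : e = 0
    · refine hpos hν.integrable.neg (by
        change ∫ y, -y ∂ν = 0
        rw [integral_neg, hν.mean, neg_zero]) ?_
        (ae_of_all _ fun y h => by simpa using h)
      filter_upwards [h] with y hy
      by_contra! hlt
      have hlt : 0 < y := by simpa using hlt
      rw [abs_of_pos hlt, he] at hy
      exact hp ((mul_eq_zero.1 (by linarith : (c + d) * y = 0)).resolve_right hlt.ne')
    · refine h2 (e / (c + d)) (e / (c + d)) ?_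
      filter_upwards [h] with y hy
      rcases le_or_gt 0 y with h0 | h0
      · rw [abs_of_nonneg h0] at hy
        left; rw [eq_div_iff hp]; linarith
      · rw [abs_of_neg h0] at hy
        have : (c - d) * y = e := by linarith
        rw [hm, zero_mul] at this
        exact absurd this.symm he
  · exfalso
    refine h2 (e / (c + d)) (e / (c - d)) ?_
    filter_upwards [h] with y hy
    rcases le_or_gt 0 y with h0 | h0
    · rw [abs_of_nonneg h0] at hy
      left; rw [eq_div_iff hp]; linarith
    · rw [abs_of_neg h0] at hy
      right; rw [eq_div_iff hm]; linarith

variable [IsProbabilityMeasure ν]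

lemma measurePreserving_past_prod {g : (ℤ → ℝ) → ℝ} (hg : Measurable g)
    (hp : ∀ z, g (past z) = g z) :
    MeasurePreserving (fun z => (g z, z 0)) (iidLaw ν) (((iidLaw ν).map g).prod ν) := by
  refine ⟨hg.prodMk (measurable_pi_apply 0), ?_⟩
  have h := (indepFun_iff_map_prod_eq_prod_map_map hg.aemeasurable
    (measurable_pi_apply (0 : ℤ)).aemeasurable).1 (indepFun_coord_zero (ν := ν) hg hp)
  rw [h]
  congr 1
  exact (measurePreserving_eval_infinitePi (fun _ : ℤ => ν) 0).map_eq

lemma ae_ae_of_past {g : (ℤ → ℝ) → ℝ} (hg : Measurable g) (hp : ∀ z, g (past z) = g z)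
    {p : ℝ × ℝ → Prop} (hpm : MeasurableSet {q | p q})
    (h : ∀ᵐ z ∂(iidLaw ν), p (g z, z 0)) : ∀ᵐ z ∂(iidLaw ν), ∀ᵐ y ∂ν, p (g z, y) := by
  have hΦ := measurePreserving_past_prod (ν := ν) hg hp
  have h1 : ∀ᵐ q ∂(((iidLaw ν).map g).prod ν), p q := by
    rw [← hΦ.map_eq]
    exact (ae_map_iff hΦ.measurable.aemeasurable hpm).2 h
  exact ae_of_ae_map hg.aemeasurable (Measure.ae_ae_of_ae_prod h1)

/-- The parameters are determined by the dynamics of the log-volatility. -/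
lemma eq_of_ae_affine (hν : IsStdLaw ν) (h2 : ∀ a b : ℝ, ¬ ∀ᵐ y ∂ν, y = a ∨ y = b)
    (hb : |beta θ₀| < 1) (hne : gamma θ₀ ≠ 0 ∨ delta θ₀ ≠ 0)
    (h : ∀ᵐ z ∂(iidLaw ν), alpha θ + beta θ * arVol θ₀ z + (gamma θ * z 0 + delta θ * |z 0|)
      = xi θ₀ (z 0) + beta θ₀ * arVol θ₀ z) : θ = θ₀ := by
  -- By Fubini the past is frozen while the innovation at time `0` varies. This leaves an affine
  -- relation among `1, y, |y|`.
  have h1 : ∀ᵐ z ∂(iidLaw ν), ∀ᵐ y ∂ν, alpha θ + beta θ * arVol θ₀ z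
      + (gamma θ * y + delta θ * |y|) = xi θ₀ y + beta θ₀ * arVol θ₀ z := by
    refine ae_ae_of_past (p := fun q => alpha θ + beta θ * q.1
      + (gamma θ * q.2 + delta θ * |q.2|) = xi θ₀ q.2 + beta θ₀ * q.1) measurable_arVol arVol_past
      (measurableSet_eq_fun (by fun_prop) ?_) h
    exact (measurable_xi.comp measurable_snd).add (measurable_fst.const_mul _)
  obtain ⟨z, hz⟩ := h1.exists
  have hcd := hν.eq_zero_of_ae h2 (c := gamma θ - gamma θ₀) (d := delta θ - delta θ₀)
    (e := alpha θ₀ - alpha θ + (beta θ₀ - beta θ) * arVol θ₀ z) (by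
      filter_upwards [hz] with y hy
      rw [xi] at hy
      linarith)
  have hc : gamma θ = gamma θ₀ := sub_eq_zero.1 hcd.1
  have hd : delta θ = delta θ₀ := sub_eq_zero.1 hcd.2
  have h3 : ∀ᵐ z ∂(iidLaw ν), (beta θ - beta θ₀) * arVol θ₀ z = alpha θ₀ - alpha θ := by
    filter_upwards [h] with z hz
    rw [xi, hc, hd] at hz
    linarith
  have hbeta : beta θ = beta θ₀ := by
    by_contra hne'
    have hb0 : beta θ - beta θ₀ ≠ 0 := sub_ne_zero.2 hne'
    have h4 : ∀ᵐ z ∂(iidLaw ν), arVol θ₀ z = (alpha θ₀ - alpha θ) / (beta θ - beta θ₀) := by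
      filter_upwards [h3] with z hz
      rw [eq_div_iff hb0, mul_comm]; exact hz
    -- A constant log-volatility would force the news term to be constant as well, which
    -- identifiability excludes.
    have h5 : ∀ᵐ z ∂(iidLaw ν), gamma θ₀ * z 0 + delta θ₀ * |z 0|
        = (1 - beta θ₀) * ((alpha θ₀ - alpha θ) / (beta θ - beta θ₀)) - alpha θ₀ := by
      filter_upwards [ae_all_shift h4, ae_arVol_shift hν hb] with z hz hr
      have := hr 0
      rw [hz, hz, xi] at this
      linarith
    have h6 : ∀ᵐ y ∂ν, gamma θ₀ * y + delta θ₀ * |y|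
        = (1 - beta θ₀) * ((alpha θ₀ - alpha θ) / (beta θ - beta θ₀)) - alpha θ₀ := by
      have hm := measurePreserving_eval_infinitePi (fun _ : ℤ => ν) 0
      rw [← hm.map_eq]
      refine (ae_map_iff hm.measurable.aemeasurable ?_).2 h5
      exact measurableSet_eq_fun (by fun_prop) measurable_const
    have := hν.eq_zero_of_ae h2 h6
    exact hne.elim (fun h => h this.1) fun h => h this.2
  have halpha : alpha θ = alpha θ₀ := by
    obtain ⟨z, hz⟩ := h3.exists
    rw [hbeta, sub_self, zero_mul] at hz
    linarith
  ext i
  fin_cases i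
  · exact halpha
  · exact hbeta
  · exact hc
  · exact hd

/-- The backward iterates at time `0` use observations up to time `-1` only. Hence the gap in
log-volatilities is independent of the current innovation. -/
lemma statG_past (z : ℤ → ℝ) : statG (obsOf θ₀) θ (past z) = statG (obsOf θ₀) θ z := by
  unfold statG
  congr 1
  ext n
  refine gHat_congr fun i hi => ?_
  have h1 : arVol θ₀ (shift (-n + i) (past z)) = arVol θ₀ (shift (-n + i) z) := by
    unfold arVol geoSum
    congr 1; ext k
    simp only [shift_shift]
    rw [shift_apply, shift_apply, past, if_pos (by omega)]
  rw [obsOf, obsOf, h1, shift_apply, shift_apply, past, if_pos (by omega)]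

/-- Twice the difference of the criteria at two log-volatilities that differ by `u`, at the
innovation `y`, up to an error `κ` in the log-volatilities. -/
def gap (κ u y : ℝ) : ℝ :=
  Real.exp (-2 * κ) * y ^ 2 * Real.exp u - Real.exp κ * y ^ 2 - u - 3 * κ

lemma measurable_gap {S : Type*} [MeasurableSpace S] (κ : ℝ) {f g : S → ℝ} (hf : Measurable f)
    (hg : Measurable g) : Measurable fun z => gap κ (f z) (g z) := by
  unfold gap; fun_prop

lemma continuous_gap (u y : ℝ) : Continuous fun κ => gap κ u y := by
  unfold gap; fun_prop

lemma le_gap {κ u y : ℝ} (h1 : κ ≤ 1) :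
    -(Real.exp 1 * y ^ 2) - u - 3 ≤ gap κ u y := by
  unfold gap
  have : Real.exp κ * y ^ 2 ≤ Real.exp 1 * y ^ 2 := by gcongr
  have : 0 ≤ Real.exp (-2 * κ) * y ^ 2 * Real.exp u := by positivity
  linarith

/-- Unit variance turns the conditional mean of the gap into `exp u - 1 - u`, the convexity defect
of `exp` at `0`. -/
lemma integral_gap_zero (hν : IsStdLaw ν) (u : ℝ) :
    Integrable (gap 0 u) ν ∧ ∫ y, gap 0 u y ∂ν = Real.exp u - 1 - u := by
  have e : gap 0 u = fun y => (Real.exp u - 1) * y ^ 2 - u := by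
    ext y; simp [gap]; ring
  rw [e]
  have hi := hν.integrable_sq.const_mul (Real.exp u - 1)
  refine ⟨hi.sub (integrable_const u), ?_⟩
  rw [integral_sub hi (integrable_const u), integral_const_mul, hν.var]
  simp

/-- If the truncated gaps do not have positive expectation, then there is no gap. -/
lemma ae_eq_zero_of_integral_min_gap_le (hν : IsStdLaw ν) {u : (ℤ → ℝ) → ℝ} (hu : Measurable u)
    (hp : ∀ z, u (past z) = u z) {b : (ℤ → ℝ) → ℝ} (hb : Integrable b (iidLaw ν))
    (hbg : ∀ᵐ z ∂(iidLaw ν), b z ≤ gap 0 (u z) (z 0)) (hb0 : ∀ z, b z ≤ 0)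
    (h : ∀ M : ℕ, ∫ z, min (gap 0 (u z) (z 0)) M ∂(iidLaw ν) ≤ 0) :
    ∀ᵐ z ∂(iidLaw ν), u z = 0 := by
  have hΦ := measurePreserving_past_prod (ν := ν) hu hp
  have hAm : Measurable fun z : ℤ → ℝ => gap 0 (u z) (z 0) :=
    measurable_gap 0 hu (measurable_pi_apply 0)
  have hmin : ∀ M : ℕ, Integrable (fun z => min (gap 0 (u z) (z 0)) M) (iidLaw ν) := by
    intro M
    have hmm : Measurable fun z : ℤ → ℝ => min (gap 0 (u z) (z 0)) (M : ℝ) :=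
      hAm.min measurable_const
    have hbM : Integrable (fun z => |b z| + (M : ℝ)) (iidLaw ν) :=
      hb.abs.add (integrable_const (M : ℝ))
    refine Integrable.mono' hbM hmm.aestronglyMeasurable ?_
    filter_upwards [hbg] with z hz
    rw [Real.norm_eq_abs]
    have hM : (0 : ℝ) ≤ M := M.cast_nonneg
    have h1 := neg_abs_le (b z)
    have h2 := abs_nonneg (b z)
    rw [abs_le]
    refine ⟨le_min (by linarith) (by linarith), (min_le_right _ _).trans (by linarith)⟩
  -- The gap contains `exp u` and is not known to be integrable. Fatou's lemma derives integrability
  -- from the bound on the truncated means and the integrable minorant `b`.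
  have hlint : ∫⁻ z, ENNReal.ofReal (gap 0 (u z) (z 0) - b z) ∂(iidLaw ν)
      ≤ ENNReal.ofReal (-∫ z, b z ∂(iidLaw ν)) := by
    have hlim : ∀ z, Tendsto (fun M : ℕ => ENNReal.ofReal (min (gap 0 (u z) (z 0)) M - b z)) atTop
        (𝓝 (ENNReal.ofReal (gap 0 (u z) (z 0) - b z))) := by
      intro z
      refine tendsto_const_nhds.congr' ?_
      filter_upwards [eventually_ge_atTop ⌈gap 0 (u z) (z 0)⌉₊] with M hM
      rw [min_eq_left ((Nat.le_ceil _).trans (by exact_mod_cast hM))]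
    have hfatou : ∫⁻ z, ENNReal.ofReal (gap 0 (u z) (z 0) - b z) ∂(iidLaw ν)
        ≤ liminf (fun M : ℕ => ∫⁻ z, ENNReal.ofReal (min (gap 0 (u z) (z 0)) M - b z)
            ∂(iidLaw ν)) atTop := by
      rw [lintegral_congr fun z => (hlim z).liminf_eq.symm]
      exact lintegral_liminf_le' fun M => ((hmin M).sub hb).aemeasurable.ennreal_ofReal
    refine hfatou.trans ?_
    refine liminf_le_of_le (by isBoundedDefault) fun c hc => ?_
    obtain ⟨M, hM⟩ := hc.exists
    refine hM.trans ?_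
    have hnn : 0 ≤ᵐ[iidLaw ν] fun z => min (gap 0 (u z) (z 0)) M - b z := by
      filter_upwards [hbg] with z hz
      have hM : (0 : ℝ) ≤ M := M.cast_nonneg
      exact sub_nonneg.2 (le_min hz ((hb0 z).trans hM))
    have hmb : Integrable (fun z => min (gap 0 (u z) (z 0)) (M : ℝ) - b z) (iidLaw ν) :=
      (hmin M).sub hb
    rw [← ofReal_integral_eq_lintegral_ofReal hmb hnn, integral_sub (hmin M) hb]
    exact ENNReal.ofReal_le_ofReal (by linarith [h M])
  have hAb : Integrable (fun z => gap 0 (u z) (z 0) - b z) (iidLaw ν) := by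
    refine ⟨hAm.aestronglyMeasurable.sub hb.aestronglyMeasurable, ?_⟩
    rw [hasFiniteIntegral_iff_ofReal]
    · exact hlint.trans_lt ENNReal.ofReal_lt_top
    · filter_upwards [hbg] with z hz using sub_nonneg.2 hz
  have hA : Integrable (fun z => gap 0 (u z) (z 0)) (iidLaw ν) := by
    refine (hAb.add hb).congr (ae_of_all _ fun z => ?_)
    exact sub_add_cancel _ _
  have hA0 : ∫ z, gap 0 (u z) (z 0) ∂(iidLaw ν) ≤ 0 := by
    have hlim : Tendsto (fun M : ℕ => ∫ z, min (gap 0 (u z) (z 0)) M ∂(iidLaw ν)) atTop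
        (𝓝 (∫ z, gap 0 (u z) (z 0) ∂(iidLaw ν))) := by
      refine tendsto_integral_of_dominated_convergence (fun z => |gap 0 (u z) (z 0)|)
        (fun M => (hmin M).aestronglyMeasurable) hA.abs (fun M => ae_of_all _ fun z => ?_)
        (ae_of_all _ fun z => ?_)
      · have hM : (0 : ℝ) ≤ M := M.cast_nonneg
        rw [Real.norm_eq_abs, abs_le]
        refine ⟨le_min (neg_abs_le _) ?_, (min_le_left _ _).trans (le_abs_self _)⟩
        exact (neg_nonpos.2 (abs_nonneg _)).trans hM
      · refine tendsto_const_nhds.congr' ?_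
        filter_upwards [eventually_ge_atTop ⌈gap 0 (u z) (z 0)⌉₊] with M hM
        rw [min_eq_left ((Nat.le_ceil _).trans (by exact_mod_cast hM))]
    exact le_of_tendsto' hlim h
  have hgm : Measurable fun q : ℝ × ℝ => gap 0 q.1 q.2 :=
    measurable_gap 0 measurable_fst measurable_snd
  have hprod : Integrable (fun q : ℝ × ℝ => gap 0 q.1 q.2) (((iidLaw ν).map u).prod ν) :=
    (hΦ.integrable_comp hgm.aestronglyMeasurable).1 hA
  have hint : Integrable (fun a => Real.exp a - 1 - a) ((iidLaw ν).map u) := by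
    simpa only [(integral_gap_zero hν _).2] using hprod.integral_prod_left
  have hval : ∫ a, (Real.exp a - 1 - a) ∂((iidLaw ν).map u) ≤ 0 := by
    have e1 : ∫ q, gap 0 q.1 q.2 ∂(((iidLaw ν).map u).prod ν)
        = ∫ z, gap 0 (u z) (z 0) ∂(iidLaw ν) := by
      rw [← hΦ.map_eq]
      exact integral_map hΦ.measurable.aemeasurable hgm.aestronglyMeasurable
    have e2 := integral_prod _ hprod
    simp only [(integral_gap_zero hν _).2] at e2
    rw [← e2, e1]
    exact hA0
  have hnn : ∀ a : ℝ, 0 ≤ Real.exp a - 1 - a := fun a => by linarith [Real.add_one_le_exp a]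
  have hz := (integral_eq_zero_iff_of_nonneg hnn hint).1 (le_antisymm hval (integral_nonneg hnn))
  filter_upwards [ae_of_ae_map hu.aemeasurable hz] with z hz
  by_contra hne
  have := Real.add_one_lt_exp hne
  have hz : Real.exp (u z) - 1 - u z = 0 := hz
  linarith

end Identification

/-! ### The criterion away from the true parameter. -/

section Consistency

variable {ν : Measure ℝ} [IsProbabilityMeasure ν] {θ₀ θs : Param} {C Θ : Set Param} {h : Param → ℝ}

/-- The sum of functions on a compact set that eventually dominate a divergent series is eventually
positive. -/
lemma eventually_sum_pos {D : ℕ → Param → ℝ} {K : Set Param} {p : ℕ → ℝ} (hC : IsCompact C)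
    (hKC : K ⊆ C) (hcont : ∀ t, Continuous (D t)) (hp : ∀ᶠ t in atTop, ∀ θ ∈ K, p t ≤ D t θ)
    (hsum : Tendsto (fun n => ∑ t ∈ Finset.Icc 1 n, p t) atTop atTop) :
    ∀ᶠ n in atTop, ∀ θ ∈ K, 0 < ∑ t ∈ Finset.Icc 1 n, D t θ := by
  obtain ⟨T, hT⟩ := eventually_atTop.1 hp
  choose c hc using fun t => hC.exists_bound_of_continuousOn (hcont t).continuousOn
  -- The finitely many terms before the comparison holds cost a bounded amount, uniformly over the
  -- compact set.
  set q : ℕ → ℝ := fun t => if t < T then |c t| + |p t| else 0 with hq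
  have hq0 : ∀ t, 0 ≤ q t := fun t => by
    simp only [hq]; split_ifs <;> positivity
  have hqsum : ∀ n, ∑ t ∈ Finset.Icc 1 n, q t ≤ ∑ t ∈ Finset.range T, q t := by
    intro n
    have h1 : ∑ t ∈ Finset.Icc 1 n, q t = ∑ t ∈ (Finset.Icc 1 n).filter (· < T), q t := by
      rw [Finset.sum_filter]
      refine Finset.sum_congr rfl fun t _ => ?_
      simp only [hq]; split_ifs <;> rfl
    rw [h1]
    exact Finset.sum_le_sum_of_subset_of_nonneg
      (fun t ht => Finset.mem_range.2 (Finset.mem_filter.1 ht).2) fun t _ _ => hq0 t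
  filter_upwards [hsum.eventually (eventually_gt_atTop (∑ t ∈ Finset.range T, q t))] with n hn θ hθ
  have h2 : ∑ t ∈ Finset.Icc 1 n, (p t - q t) ≤ ∑ t ∈ Finset.Icc 1 n, D t θ := by
    refine Finset.sum_le_sum fun t _ => ?_
    simp only [hq]
    split_ifs with ht
    · have h3 := hc t θ (hKC hθ)
      rw [Real.norm_eq_abs] at h3
      have := neg_abs_le (D t θ)
      linarith [le_abs_self (c t), le_abs_self (p t)]
    · rw [sub_zero]; exact hT t (not_lt.1 ht) θ hθ
  rw [Finset.sum_sub_distrib] at h2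
  linarith [hqsum n]

/-- The roles are: `g` the recursion at a nearby parameter, `G` and `Gs` the stationary solutions
there and at the center, `g₀` the recursion at the true parameter, `v` the true log-volatility. Thus
`g` is within `2 κ` of `Gs`, and the linear terms lose `3 κ`. -/
lemma gap_le {κ g g₀ G Gs v y : ℝ} (h1 : |g - G| ≤ κ) (h2 : |G - Gs| ≤ κ) (h3 : |g₀ - v| ≤ κ) :
    gap κ (v - Gs) y
      ≤ Real.exp v * y ^ 2 * Real.exp (-g) + g - (Real.exp v * y ^ 2 * Real.exp (-g₀) + g₀) := by
  rw [abs_le] at h1 h2 h3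
  have a1 : Real.exp (-2 * κ) * Real.exp (v - Gs) ≤ Real.exp v * Real.exp (-g) := by
    rw [← Real.exp_add, ← Real.exp_add]
    exact Real.exp_le_exp.2 (by linarith)
  have a2 : Real.exp v * Real.exp (-g₀) ≤ Real.exp κ := by
    rw [← Real.exp_add]
    exact Real.exp_le_exp.2 (by linarith)
  have b1 := mul_le_mul_of_nonneg_right a1 (sq_nonneg y)
  have b2 := mul_le_mul_of_nonneg_right a2 (sq_nonneg y)
  unfold gap
  linarith

/-- An integrable envelope for the negative parts of the gaps. -/
def envelope (θ₀ : Param) (c : ℝ) (z : ℤ → ℝ) : ℝ :=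
  Real.exp 1 * z 0 ^ 2 + |arVol θ₀ z| + |c| + 3

lemma envelope_nonneg (c : ℝ) (z : ℤ → ℝ) : 0 ≤ envelope θ₀ c z := by
  unfold envelope; positivity

lemma integrable_envelope (hν : IsStdLaw ν) (hb : |beta θ₀| < 1) (c : ℝ) :
    Integrable (envelope θ₀ c) (iidLaw ν) :=
  ((((integrable_comp_coord hν.integrable_sq 0).const_mul _).add
    (integrable_arVol hν hb).abs).add (integrable_const _)).add (integrable_const _)

lemma neg_envelope_le_gap {κ c G : ℝ} {z : ℤ → ℝ} (hκ : κ ≤ 1) (hG : -c ≤ G) :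
    -envelope θ₀ c z ≤ gap κ (arVol θ₀ z - G) (z 0) := by
  refine le_trans ?_ (le_gap hκ)
  unfold envelope
  linarith [le_abs_self (arVol θ₀ z), le_abs_self c]

/-- A crude substitute for `gap_le` on the event where the modulus of continuity fails; it needs no
comparison with the center. -/
lemma neg_envelope_le {κ c g g₀ G : ℝ} {z : ℤ → ℝ} (hκ : κ ≤ 1) (hG : -c ≤ G) (h1 : |g - G| ≤ κ)
    (h3 : |g₀ - arVol θ₀ z| ≤ κ) :
    -envelope θ₀ c z ≤ Real.exp (arVol θ₀ z) * z 0 ^ 2 * Real.exp (-g) + g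
      - (Real.exp (arVol θ₀ z) * z 0 ^ 2 * Real.exp (-g₀) + g₀) := by
  rw [abs_le] at h1 h3
  have a2 : Real.exp (arVol θ₀ z) * Real.exp (-g₀) ≤ Real.exp 1 := by
    rw [← Real.exp_add]
    exact Real.exp_le_exp.2 (by linarith)
  have b2 := mul_le_mul_of_nonneg_right a2 (sq_nonneg (z 0))
  have : 0 ≤ Real.exp (arVol θ₀ z) * z 0 ^ 2 * Real.exp (-g) := by positivity
  unfold envelope
  linarith [le_abs_self (arVol θ₀ z), le_abs_self c]

lemma obsOf_sq (z : ℤ → ℝ) : obsOf θ₀ z ^ 2 = Real.exp (arVol θ₀ z) * z 0 ^ 2 := by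
  rw [obsOf, mul_pow, ← Real.exp_nat_mul]
  congr 2
  push_cast; ring

lemma drive_obsOf_mul_exp (θ : Param) (z : ℤ → ℝ) :
    (gamma θ * obsOf θ₀ z + delta θ * |obsOf θ₀ z|) * Real.exp (-arVol θ₀ z / 2)
      = gamma θ * z 0 + delta θ * |z 0| := by
  have e : Real.exp (arVol θ₀ z / 2) * Real.exp (-arVol θ₀ z / 2) = 1 := by
    rw [← Real.exp_add, show arVol θ₀ z / 2 + -arVol θ₀ z / 2 = 0 by ring, Real.exp_zero]
  rw [obsOf, abs_mul, Real.abs_exp]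
  linear_combination (gamma θ * z 0 + delta θ * |z 0|) * e

/-- The log-volatility follows the inverted recursion at the true parameter. -/
lemma ae_arVol_eq_gHat (hν : IsStdLaw ν) (hb : |beta θ₀| < 1) :
    ∀ᵐ z ∂(iidLaw ν), ∀ n : ℕ,
      arVol θ₀ (shift n z) = gHat (orbit (obsOf θ₀) z) θ₀ (arVol θ₀ z) n := by
  filter_upwards [ae_arVol_shift hν hb] with z hz n
  induction n with
  | zero => simp [gHat]
  | succ n ih =>
    change _ = phi θ₀ (obsOf θ₀ (shift n z)) (gHat (orbit (obsOf θ₀) z) θ₀ (arVol θ₀ z) n)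
    rw [← ih, phi, drive_obsOf_mul_exp, shift_apply, zero_add]
    have := hz n
    rw [xi] at this
    push_cast
    linarith

variable (hν : IsStdLaw ν) (hb : |beta θ₀| < 1) (hC : IsContractive ν (obsOf θ₀) C)

include hν hb hC in
/-- Along almost every sample point, the recursion at the true parameter approximates the
log-volatility. -/
lemma ae_eventually_abs_gHat_sub_arVol_le (h₀ : θ₀ ∈ C) (s : ℝ) {κ : ℝ} (hκ : 0 < κ) :
    ∀ᵐ z ∂(iidLaw ν), ∀ᶠ n : ℕ in atTop,
      |gHat (orbit (obsOf θ₀) z) θ₀ s n - arVol θ₀ (shift n z)| ≤ κ := by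
  filter_upwards [ae_arVol_eq_gHat hν hb, hC.ae_contractsAt] with z hz hc
  filter_upwards [hc.forward |s| (κ / 2) (half_pos hκ),
    hc.forward |arVol θ₀ z| (κ / 2) (half_pos hκ)] with n h1 h2
  have h1 := h1 θ₀ h₀ s le_rfl
  have h2 := h2 θ₀ h₀ _ le_rfl
  rw [← hz n] at h2
  rw [abs_le] at *
  constructor <;> linarith

include hC in
lemma IsContractive.exists_neg_le_fixpt : ∃ c, ∀ θ ∈ C, -c ≤ fixpt θ := by
  obtain ⟨c, hc⟩ := hC.isCompact.exists_bound_of_continuousOn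
    (continuousOn_fixpt hC.beta_lt_one)
  exact ⟨c, fun θ hθ => (abs_le.1 (hc θ hθ)).1⟩

include hν hb hC in
-- Otherwise the true log-volatility would be the stationary solution at `θs`. It would then follow
-- both recursions, and identification would give `θs = θ₀`.
lemma exists_integral_min_gap_pos (h2 : ∀ a b : ℝ, ¬ ∀ᵐ y ∂ν, y = a ∨ y = b)
    (hne : gamma θ₀ ≠ 0 ∨ delta θ₀ ≠ 0) (hs : θs ∈ C) (hθ : θs ≠ θ₀) :
    ∃ M : ℕ, 0 < ∫ z, min (gap 0 (arVol θ₀ z - statG (obsOf θ₀) θs z) (z 0)) M ∂(iidLaw ν) := by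
  by_contra! hle
  have hGm : Measurable (statG (obsOf θ₀) θs) :=
    measurable_statG measurable_obsOf measurable_const measurable_id
  obtain ⟨c, hc⟩ := hC.exists_neg_le_fixpt
  have hz := ae_eq_zero_of_integral_min_gap_le hν (u := fun z => arVol θ₀ z
    - statG (obsOf θ₀) θs z) (measurable_arVol.sub hGm)
    (fun z => by rw [arVol_past, statG_past]) (integrable_envelope (θ₀ := θ₀) hν hb c).neg
    (by
      filter_upwards [hC.ae_contractsAt] with z hz
      have := hz.fixpt_le 0 θs hs
      rw [shift_zero] at this
      exact neg_envelope_le_gap zero_le_one ((hc θs hs).trans this))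
    (fun z => neg_nonpos.2 (envelope_nonneg c z)) hle
  refine hθ (eq_of_ae_affine hν h2 hb hne ?_)
  filter_upwards [ae_all_shift hz, hC.ae_contractsAt, ae_arVol_shift hν hb] with z h1 h3 h4
  have e0 := h1 0
  have e1 := h1 1
  have s0 := h3.step 0 θs hs
  have r0 := h4 0
  simp only [zero_add, shift_zero] at e0 e1 s0 r0
  rw [← r0, sub_eq_zero.1 e1, s0, ← sub_eq_zero.1 e0, phi, drive_obsOf_mul_exp]

include hν hb hC in
lemma integrable_min_gap {c κ : ℝ} (hc : ∀ θ ∈ C, -c ≤ fixpt θ) (hs : θs ∈ C) (hκ : κ ≤ 1) (M : ℕ) :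
    (∀ᵐ z ∂(iidLaw ν), |min (gap κ (arVol θ₀ z - statG (obsOf θ₀) θs z) (z 0)) M|
      ≤ envelope θ₀ c z + M) ∧
    Integrable (fun z => min (gap κ (arVol θ₀ z - statG (obsOf θ₀) θs z) (z 0)) M) (iidLaw ν) := by
  have hGm : Measurable (statG (obsOf θ₀) θs) :=
    measurable_statG measurable_obsOf measurable_const measurable_id
  have hm : Measurable fun z : ℤ → ℝ =>
      min (gap κ (arVol θ₀ z - statG (obsOf θ₀) θs z) (z 0)) (M : ℝ) :=
    (measurable_gap κ (measurable_arVol.sub hGm) (measurable_pi_apply 0)).min measurable_const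
  have hbd : ∀ᵐ z ∂(iidLaw ν), |min (gap κ (arVol θ₀ z - statG (obsOf θ₀) θs z) (z 0)) M|
      ≤ envelope θ₀ c z + M := by
    filter_upwards [hC.ae_contractsAt] with z hz
    have hf := hz.fixpt_le 0 θs hs
    rw [shift_zero] at hf
    have h1 := neg_envelope_le_gap (θ₀ := θ₀) (z := z) hκ ((hc θs hs).trans hf)
    have h2 := envelope_nonneg (θ₀ := θ₀) c z
    have hM : (0 : ℝ) ≤ M := M.cast_nonneg
    rw [abs_le]
    exact ⟨le_min (by linarith) (by linarith), (min_le_right _ _).trans (by linarith)⟩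
  exact ⟨hbd, ((integrable_envelope hν hb c).add (integrable_const (M : ℝ))).mono'
    hm.aestronglyMeasurable hbd⟩

include hν hb hC in
lemma exists_pos_integral_min_gap_pos (h2 : ∀ a b : ℝ, ¬ ∀ᵐ y ∂ν, y = a ∨ y = b)
    (hne : gamma θ₀ ≠ 0 ∨ delta θ₀ ≠ 0) (hs : θs ∈ C) (hθ : θs ≠ θ₀) :
    ∃ M : ℕ, ∃ κ > 0, κ ≤ 1 ∧
      0 < ∫ z, min (gap κ (arVol θ₀ z - statG (obsOf θ₀) θs z) (z 0)) M ∂(iidLaw ν) := by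
  obtain ⟨M, hM⟩ := exists_integral_min_gap_pos hν hb hC h2 hne hs hθ
  obtain ⟨c, hc⟩ := hC.exists_neg_le_fixpt
  have hκ1 : ∀ n : ℕ, 1 / ((n : ℝ) + 1) ≤ 1 := fun n =>
    div_le_one_of_le₀ (by linarith [n.cast_nonneg (α := ℝ)]) (by positivity)
  have hlim : Tendsto (fun n : ℕ => ∫ z, min (gap (1 / ((n : ℝ) + 1))
      (arVol θ₀ z - statG (obsOf θ₀) θs z) (z 0)) M ∂(iidLaw ν)) atTop
      (𝓝 (∫ z, min (gap 0 (arVol θ₀ z - statG (obsOf θ₀) θs z) (z 0)) M ∂(iidLaw ν))) := by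
    refine tendsto_integral_of_dominated_convergence (fun z => envelope θ₀ c z + M)
      (fun n => (integrable_min_gap hν hb hC hc hs (hκ1 n) M).2.aestronglyMeasurable)
      ((integrable_envelope hν hb c).add (integrable_const (M : ℝ)))
      (fun n => (integrable_min_gap hν hb hC hc hs (hκ1 n) M).1) (ae_of_all _ fun z => ?_)
    exact (((continuous_gap _ _).tendsto 0).comp
      tendsto_one_div_add_atTop_nhds_zero_nat).min tendsto_const_nhds
  obtain ⟨n, hn⟩ := (hlim.eventually (lt_mem_nhds hM)).exists
  exact ⟨M, 1 / ((n : ℝ) + 1), by positivity, hκ1 n, hn⟩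

include hν hb hC in
/-- Away from the true parameter, the criterion is eventually larger than at the true
parameter. -/
theorem exists_ball_QL_lt (h2 : ∀ a b : ℝ, ¬ ∀ᵐ y ∂ν, y = a ∨ y = b)
    (hne : gamma θ₀ ≠ 0 ∨ delta θ₀ ≠ 0) (h₀ : θ₀ ∈ C) (hs : θs ∈ C) (hθ : θs ≠ θ₀)
    (hh : Continuous h) :
    ∃ d > 0, ∀ᵐ z ∂(iidLaw ν), ∀ᶠ n in atTop, ∀ θ ∈ C ∩ Metric.ball θs d,
      QL h (orbit (obsOf θ₀) z) n θ₀ < QL h (orbit (obsOf θ₀) z) n θ := by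
  set x := obsOf θ₀ with hx
  obtain ⟨M, κ, hκ, hκ1, hpos⟩ := exists_pos_integral_min_gap_pos hν hb hC h2 hne hs hθ
  obtain ⟨c, hc⟩ := hC.exists_neg_le_fixpt
  have hGm : ∀ θ, Measurable (statG x θ) := fun θ =>
    measurable_statG measurable_obsOf measurable_const measurable_id
  have hGc : ∀ᵐ z ∂(iidLaw ν), ContinuousOn (fun θ => statG x θ z) C := by
    filter_upwards [hC.ae_contractsAt] with z hz
    simpa using hz.continuousOn 0
  set F : (ℤ → ℝ) → ℝ := fun z => min (gap κ (arVol θ₀ z - statG x θs z) (z 0)) M with hF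
  have hFm : Measurable F :=
    (measurable_gap κ (measurable_arVol.sub (hGm θs)) (measurable_pi_apply 0)).min measurable_const
  have hFi : Integrable F (iidLaw ν) := (integrable_min_gap hν hb hC hc hs hκ1 M).2
  set b : (ℤ → ℝ) → ℝ := fun z => envelope θ₀ c z + M with hbdef
  have hbm : Measurable b := by
    have := measurable_arVol (θ := θ₀)
    simp only [hbdef]; unfold envelope; fun_prop
  have hbi : Integrable b (iidLaw ν) := (integrable_envelope hν hb c).add (integrable_const _)
  have hb0 : ∀ z, 0 ≤ b z := fun z => add_nonneg (envelope_nonneg c z) M.cast_nonneg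
  -- Absolute continuity of the integral: on an event this small, the bound `b` costs less than the
  -- mean of `F`.
  obtain ⟨ρ, hρ, hρlt⟩ := exists_pos_setLIntegral_lt_of_measure_lt
    (f := fun z => ENNReal.ofReal (b z)) hbi.lintegral_lt_top.ne
    (ε := ENNReal.ofReal (∫ z, F z ∂(iidLaw ν))) (by simpa using hpos)
  obtain ⟨ρ', hρ', hρρ'⟩ := exists_between hρ
  obtain ⟨E, hEm, hE, _, d, hd, hEd⟩ := exists_modulus hC.isCompact hGm hGc hκ hρ'.ne'
  have hEb : ∫ z in E, b z ∂(iidLaw ν) < ∫ z, F z ∂(iidLaw ν) := by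
    have h1 := hρlt E (hE.trans_lt hρρ')
    rw [← ofReal_integral_eq_lintegral_ofReal hbi.integrableOn (ae_of_all _ hb0)] at h1
    exact (ENNReal.ofReal_lt_ofReal_iff hpos).1 h1
  -- A minorant of the criterion difference on the whole ball, with positive mean: the truncated
  -- gap, corrected on `E` so that it falls below the envelope bound there.
  set ψ : (ℤ → ℝ) → ℝ := fun z => F z - E.indicator b z with hψ
  have hψi : Integrable ψ (iidLaw ν) := hFi.sub (hbi.indicator hEm)
  have hψpos : 0 < ∫ z, ψ z ∂(iidLaw ν) := by
    rw [integral_sub hFi (hbi.indicator hEm), integral_indicator hEm]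
    linarith
  have hav := ae_all_shift (ae_tendsto_average_shift (hFm.sub (hbm.indicator hEm)) hψi)
  let D : (ℤ → ℝ) → ℕ → Param → ℝ := fun z t θ =>
    (orbit x z t ^ 2 * Real.exp (-gHat (orbit x z) θ (h θ) t) + gHat (orbit x z) θ (h θ) t)
    - (orbit x z t ^ 2 * Real.exp (-gHat (orbit x z) θ₀ (h θ₀) t) + gHat (orbit x z) θ₀ (h θ₀) t)
  obtain ⟨m, hm⟩ := hC.isCompact.exists_bound_of_continuousOn hh.continuousOn
  refine ⟨d, hd, ?_⟩
  filter_upwards [hav, hC.ae_contractsAt,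
    ae_eventually_abs_gHat_sub_arVol_le hν hb hC h₀ (h θ₀) hκ] with z hz hcon hg₀
  have hsum : Tendsto (fun n : ℕ => ∑ t ∈ Finset.Icc 1 n, ψ (shift t z)) atTop atTop := by
    simp_rw [sum_Icc_shift ψ]
    exact tendsto_atTop_of_average hψpos (hz 1)
  have hDc : ∀ t, Continuous (D z t) := by
    intro t
    have hg : Continuous fun θ => gHat (orbit x z) θ (h θ) t :=
      (continuous_gHat _ t).comp (continuous_id.prodMk hh)
    have := Real.continuous_exp.comp hg.neg
    exact ((continuous_const.mul this).add hg).sub continuous_const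
  have hdom : ∀ᶠ t : ℕ in atTop, ∀ θ ∈ C ∩ Metric.ball θs d, ψ (shift t z) ≤ D z t θ := by
    filter_upwards [hcon.forward m κ hκ, hg₀] with t ht ht₀ θ hθ'
    have e1 := ht θ hθ'.1 _ (hm θ hθ'.1)
    have e2 := (hc θ hθ'.1).trans (hcon.fixpt_le t θ hθ'.1)
    have e3 : orbit x z t ^ 2 = Real.exp (arVol θ₀ (shift t z)) * (shift t z) 0 ^ 2 :=
      obsOf_sq (shift t z)
    simp only [D, e3]
    by_cases hE' : shift t z ∈ E
    · refine le_trans ?_ (neg_envelope_le (z := shift t z) hκ1 e2 e1 ht₀)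
      simp only [hψ, Set.indicator_of_mem hE', hbdef]
      have : F (shift t z) ≤ M := min_le_right _ _
      linarith
    · refine le_trans ?_ (gap_le e1 ((hEd _ hE').2 θ hθ'.1 θs hs hθ'.2) ht₀)
      simp only [hψ, Set.indicator_of_notMem hE', sub_zero]
      exact min_le_left _ _
  filter_upwards [eventually_sum_pos hC.isCompact Set.inter_subset_left hDc hdom hsum]
    with n hn θ hθ'
  have := hn θ hθ'
  simp only [D, Finset.sum_sub_distrib] at this
  rw [QL, QL, ← Finset.mul_sum, ← Finset.mul_sum]
  linarith

include hν hb hC in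
-- Finitely many balls from `exists_ball_QL_lt` cover the compact set `C` minus a ball around the
-- true parameter.
lemma ae_eventually_QL_lt (h2 : ∀ a b : ℝ, ¬ ∀ᵐ y ∂ν, y = a ∨ y = b)
    (hne : gamma θ₀ ≠ 0 ∨ delta θ₀ ≠ 0) (h₀ : θ₀ ∈ C) (hh : Continuous h) {r : ℝ} (hr : 0 < r) :
    ∀ᵐ z ∂(iidLaw ν), ∀ᶠ n in atTop, ∀ θ ∈ C \ Metric.ball θ₀ r,
      QL h (orbit (obsOf θ₀) z) n θ₀ < QL h (orbit (obsOf θ₀) z) n θ := by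
  refine (hC.isCompact.diff Metric.isOpen_ball).induction_on (p := fun s => ∀ᵐ z ∂(iidLaw ν),
    ∀ᶠ n in atTop, ∀ θ ∈ s, QL h (orbit (obsOf θ₀) z) n θ₀ < QL h (orbit (obsOf θ₀) z) n θ)
    ?_ ?_ ?_ ?_
  · exact ae_of_all _ fun z => Eventually.of_forall fun n θ hθ => hθ.elim
  · intro s t hst ht
    filter_upwards [ht] with z hz
    filter_upwards [hz] with n hn θ hθ using hn θ (hst hθ)
  · intro s t hs ht
    filter_upwards [hs, ht] with z hz hz'
    filter_upwards [hz, hz'] with n hn hn' θ hθ using hθ.elim (hn θ) (hn' θ)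
  · intro θs hs
    have hθ : θs ≠ θ₀ := by
      rintro rfl
      exact hs.2 (Metric.mem_ball_self hr)
    obtain ⟨d, hd, hd'⟩ := exists_ball_QL_lt hν hb hC h2 hne h₀ hs.1 hθ hh
    refine ⟨C ∩ Metric.ball θs d, ?_, hd'⟩
    exact mem_nhdsWithin.2 ⟨_, Metric.isOpen_ball, Metric.mem_ball_self hd,
      fun θ hθ => ⟨hθ.2.1, hθ.1⟩⟩

/-- Under the condition `INV`, the true parameter eventually satisfies the empirical
constraint. -/
lemma ae_eventually_mem_stableSet {x : (ℤ → ℝ) → ℝ} {ε : ℝ} (hx : Measurable x)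
    (hi : Integrable (fun z => Real.log (1 + |x z|)) (iidLaw ν)) (hΘ : θ₀ ∈ Θ)
    (h0 : 0 ≤ beta θ₀) (hs : |gamma θ₀| ≤ delta θ₀)
    (h : ∫⁻ z, ENNReal.ofReal (Real.log (lipCoeff θ₀ (x z))) ∂(iidLaw ν)
      < ∫⁻ z, negLog (lipCoeff θ₀ (x z)) ∂(iidLaw ν)) :
    ∀ᵐ z ∂(iidLaw ν), ∀ᶠ n in atTop, θ₀ ∈ stableSet Θ ε (orbit x z) n := by
  have hLm : Measurable fun z => lipCoeff θ₀ (x z) := (measurable_lipCoeff θ₀).comp hx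
  obtain ⟨M, hM⟩ := exists_integral_log_max_neg hi hLm (fun z => le_max_of_le_left h0)
    (one_le_lipBound θ₀) (fun z => lipCoeff_le θ₀ (x z)) h
  set F : (ℤ → ℝ) → ℝ := fun z => Real.log (max (Real.exp (-M)) (lipCoeff θ₀ (x z))) with hF
  have hFi : Integrable F (iidLaw ν) := integrable_log_max hLm hi (one_le_lipBound θ₀)
    (fun z => lipCoeff_le θ₀ (x z)) M.cast_nonneg
  have hFm : Measurable F := Real.measurable_log.comp (measurable_const.max hLm)
  filter_upwards [ae_all_shift (ae_tendsto_average_shift hFm hFi)] with z hz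
  have hsum : Tendsto (fun n : ℕ => ∑ t ∈ Finset.Icc 1 n, F (shift t z)) atTop atBot := by
    simp_rw [sum_Icc_shift F]
    exact tendsto_atBot_of_average hM (hz 1)
  filter_upwards [hsum.eventually (eventually_le_atBot (-ε))] with n hn
  refine ⟨hΘ, hs, le_trans ?_ (EReal.coe_le_coe_iff.2 hn)⟩
  rw [coe_sum_eReal]
  exact Finset.sum_le_sum fun t _ =>
    logLip_le_of_le _ (lt_max_of_lt_left (Real.exp_pos _)) (le_max_right _ _)

end Consistency

/-! ### The theorem on the given probability space. -/

section Model

variable {Ω : Type*} [MeasurableSpace Ω] {μ : Measure Ω}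
  {Z V : ℤ → Ω → ℝ} {θ₀ : Param} {Θ C : Set Param} {ε : ℝ}

lemma IsSQMLE.ae_eventually_mem {h : Param → ℝ} {θhat : ℕ → Ω → Param}
    (hhat : IsSQMLE μ (path Z V) Θ ε h θhat)
    (hsub : ∀ᵐ ω ∂μ, ∀ᶠ n : ℕ in atTop, stableSet Θ ε (path Z V ω) n ⊆ C)
    (hne : ∀ᵐ ω ∂μ, ∀ᶠ n in atTop, (stableSet Θ ε (path Z V ω) n).Nonempty) :
    ∀ᵐ ω ∂μ, ∀ᶠ n in atTop, θhat n ω ∈ C := by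
  filter_upwards [hsub, hne, ae_all_iff.2 hhat.argmin] with ω h1 h2 h3
  filter_upwards [h1, h2] with n h1 h2
  exact h1 (h3 n h2).1

variable [IsProbabilityMeasure μ]

lemma IsEGARCH.ae_path_eq (hD : IsEGARCH μ Z V θ₀) :
    ∀ᵐ ω ∂μ, path Z V ω = orbit (obsOf θ₀) (innov Z ω) := by
  have := hD.innovation.isStdLaw.prob
  filter_upwards [hD.ae_obs_eq] with ω hω
  ext t
  exact hω t

/-- A compact set on which the recursions contract, and to which every stable estimator eventually
belongs. -/
lemma IsEGARCH.exists_isContractive (hD : IsEGARCH μ Z V θ₀) [IsProbabilityMeasure (μ.map (Z 0))]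
    (hΘ : IsCompact Θ) (hβ : ∀ θ ∈ Θ, 0 ≤ beta θ ∧ beta θ < 1) (hε : 0 < ε) :
    ∃ C, IsContractive (μ.map (Z 0)) (obsOf θ₀) C ∧
      ∀ᵐ ω ∂μ, ∀ᶠ n : ℕ in atTop, stableSet Θ ε (path Z V ω) n ⊆ C := by
  obtain ⟨C, hC, h⟩ := exists_isContractive_stableSet_subset (ν := μ.map (Z 0)) (ε := ε)
    (measurable_obsOf (θ := θ₀)) (integrable_log_obsOf hD.innovation.isStdLaw hD.abs_beta_lt_one)
    hΘ hβ hε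
  refine ⟨C, hC, ?_⟩
  filter_upwards [hD.ae_path_eq,
    hD.innovation.measurePreserving.quasiMeasurePreserving.ae h] with ω h1 h2
  rwa [h1]

/-- Strong consistency of the stable quasi maximum likelihood estimator. -/
theorem IsEGARCH.tendsto_of_isSQMLE (hD : IsEGARCH μ Z V θ₀) (hΘ : IsCompact Θ)
    (hβ : ∀ θ ∈ Θ, 0 ≤ beta θ ∧ beta θ < 1) (hε : 0 < ε)
    (h2 : ∀ a b : ℝ, ¬ ∀ᵐ ω ∂μ, Z 0 ω = a ∨ Z 0 ω = b)
    (hne : gamma θ₀ ≠ 0 ∨ delta θ₀ ≠ 0) (hinv : INV μ (obs Z V 0) θ₀) (h₀ : θ₀ ∈ Θ)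
    {h : Param → ℝ} {θhat : ℕ → Ω → Param} (hh : Continuous h)
    (hhat : IsSQMLE μ (path Z V) Θ ε h θhat) :
    ∀ᵐ ω ∂μ, Tendsto (fun n => θhat n ω) atTop (𝓝 θ₀) := by
  have hν := hD.innovation.isStdLaw
  have := hν.prob
  have hW := hD.innovation.measurePreserving
  have hlog := integrable_log_obsOf hν hD.abs_beta_lt_one
  have h2' : ∀ a b : ℝ, ¬ ∀ᵐ y ∂(μ.map (Z 0)), y = a ∨ y = b := fun a b hab =>
    h2 a b (ae_of_ae_map (hD.innovation.measurable 0).aemeasurable hab)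
  have hb0 := (hβ θ₀ h₀).1
  have hL : ∫⁻ z, ENNReal.ofReal (Real.log (lipCoeff θ₀ (obsOf θ₀ z))) ∂(iidLaw (μ.map (Z 0)))
      < ∫⁻ z, negLog (lipCoeff θ₀ (obsOf θ₀ z)) ∂(iidLaw (μ.map (Z 0))) := by
    have e : ∀ g : ℝ → ENNReal, Measurable g →
        ∫⁻ ω, g (obs Z V 0 ω) ∂μ = ∫⁻ z, g (obsOf θ₀ z) ∂(iidLaw (μ.map (Z 0))) := by
      intro g hg
      have hm : Measurable fun z => g (obsOf θ₀ z) := hg.comp measurable_obsOf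
      rw [← hW.lintegral_comp hm]
      refine lintegral_congr_ae ?_
      filter_upwards [hD.ae_obs_eq] with ω hω
      rw [hω 0, shift_zero]
    have hlm : Measurable (lipCoeff θ₀) := measurable_lipCoeff θ₀
    have hm2 : Measurable fun y => negLog (lipCoeff θ₀ y) :=
      measurable_negLog.comp hlm
    have := hinv.2
    simp_rw [toENNReal_logLip hb0, toENNReal_neg_logLip hb0] at this
    rwa [e (fun y => ENNReal.ofReal (Real.log (lipCoeff θ₀ y)))
      (Real.measurable_log.comp hlm).ennreal_ofReal, e _ hm2] at this
  have hmem := ae_eventually_mem_stableSet (Θ := Θ) (ε := ε) measurable_obsOf hlog h₀ hb0 hinv.1 hL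
  obtain ⟨C, hC, hsub⟩ := exists_isContractive_stableSet_subset (ν := μ.map (Z 0)) (ε := ε)
    (measurable_obsOf (θ := θ₀)) hlog hΘ hβ hε
  -- Membership is deterministic, so one sample point and one `n` at which the constraint set
  -- contains `θ₀` and lies in `C` are enough.
  have hθC : θ₀ ∈ C := by
    obtain ⟨z, hz, hz'⟩ := (hmem.and hsub).exists
    obtain ⟨n, hn, hn'⟩ := (hz.and hz').exists
    exact hn' hn
  -- Countably many radii, so that a single null set serves for all neighbourhoods of `θ₀`.
  have hQL := ae_all_iff.2 fun k : ℕ => ae_eventually_QL_lt hν hD.abs_beta_lt_one hC h2' hne hθC hh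
    (r := 1 / ((k : ℝ) + 1)) (by positivity)
  filter_upwards [hD.ae_path_eq, hW.quasiMeasurePreserving.ae hmem,
    hW.quasiMeasurePreserving.ae hsub, hW.quasiMeasurePreserving.ae hQL,
    ae_all_iff.2 hhat.argmin] with ω hω h1 h3 h4 h5
  rw [Metric.tendsto_nhds]
  intro r hr
  obtain ⟨k, hk⟩ := exists_nat_one_div_lt hr
  filter_upwards [h1, h3, h4 k] with n h1 h3 h4
  rw [hω] at h5
  obtain ⟨h6, h7⟩ := h5 n ⟨θ₀, h1⟩
  by_contra! hfar
  refine absurd (h4 (θhat n ω) ⟨h3 h6, fun hball => ?_⟩) (not_lt.2 (h7 h1))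
  exact absurd (Metric.mem_ball.1 hball) (not_lt.2 (hk.le.trans hfar))

end Model

end EGARCH

end

theorem mainTheorem4 {Ω : Type*} [MeasurableSpace Ω] (μ : Measure Ω) [IsProbabilityMeasure μ]
    (Z V : ℤ → Ω → ℝ) (θ₀ : EGARCH.Param) (hDGP : EGARCH.IsEGARCH μ Z V θ₀)
    (Θ : Set EGARCH.Param) (hΘ : IsCompact Θ)
    (hβ : ∀ θ ∈ Θ, 0 ≤ EGARCH.beta θ ∧ EGARCH.beta θ < 1)
    (ε : ℝ) (hε : 0 < ε) :
    -- strong consistency, for an identifiable model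
    ((∀ a b : ℝ, ¬ ∀ᵐ ω ∂μ, Z 0 ω = a ∨ Z 0 ω = b) →
      (EGARCH.gamma θ₀ ≠ 0 ∨ EGARCH.delta θ₀ ≠ 0) →
      EGARCH.INV μ (EGARCH.obs Z V 0) θ₀ → θ₀ ∈ Θ →
      ∀ (h : EGARCH.Param → ℝ) (θhat : ℕ → Ω → EGARCH.Param), Continuous h →
        EGARCH.IsSQMLE μ (EGARCH.path Z V) Θ ε h θhat →
        ∀ᵐ ω ∂μ, Tendsto (fun n => θhat n ω) atTop (𝓝 θ₀)) ∧
    -- the asymptotic law of the volatility forecast, whether or not `INV(θ₀)` holds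
    ((∀ᵐ ω ∂μ, ∀ᶠ n in atTop,
        (EGARCH.stableSet Θ ε (EGARCH.path Z V ω) n).Nonempty) →
      -- a limit law, the same for all initial values, at the value of the estimator
      (∃ π : EGARCH.Param → ProbabilityMeasure ℝ,
        ∀ (h : EGARCH.Param → ℝ) (θhat : ℕ → Ω → EGARCH.Param), Continuous h →
          EGARCH.IsSQMLE μ (EGARCH.path Z V) Θ ε h θhat →
          ∀ᵐ ω ∂μ, ∀ᶠ n in atTop, ∀ s : ℝ,
            TendstoInDistribution
              (fun (t : ℕ) (ω' : Ω) => EGARCH.volHat (EGARCH.path Z V ω') (θhat n ω) s t)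
              atTop (id : ℝ → ℝ) (fun _ => μ) (π (θhat n ω) : Measure ℝ)) ∧
      -- the laws of the forecasts at the random estimator merge for all pairs of initial values
      (∀ (h h' : EGARCH.Param → ℝ) (θhat θhat' : ℕ → Ω → EGARCH.Param),
        Continuous h → Continuous h' →
        EGARCH.IsSQMLE μ (EGARCH.path Z V) Θ ε h θhat →
        EGARCH.IsSQMLE μ (EGARCH.path Z V) Θ ε h' θhat' →
        TendstoInMeasure μ (fun n ω => θhat n ω - θhat' n ω) atTop (fun _ => 0) →
        ∀ k k' : EGARCH.Param → ℝ, Continuous k → Continuous k' →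
          ∀ f : BoundedContinuousFunction ℝ ℝ,
            Tendsto
              (fun p : ℕ × ℕ =>
                (∫ ω, f (EGARCH.volHat (EGARCH.path Z V ω) (θhat p.2 ω) (k (θhat p.2 ω)) p.1) ∂μ)
                - ∫ ω, f (EGARCH.volHat (EGARCH.path Z V ω) (θhat' p.2 ω) (k' (θhat' p.2 ω)) p.1)
                    ∂μ)
              (atTop ×ˢ atTop) (𝓝 0))) := by
  have hν := hDGP.innovation.isStdLaw
  have := hν.prob
  have hW := hDGP.innovation.measurePreserving
  have hx := EGARCH.measurable_obsOf (θ := θ₀)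
  refine ⟨fun h2 hne hinv h₀ h θhat hh hhat =>
    hDGP.tendsto_of_isSQMLE hΘ hβ hε h2 hne hinv h₀ hh hhat, fun hnonempty => ?_⟩
  obtain ⟨C, hC, hsub⟩ := hDGP.exists_isContractive hΘ hβ hε
  refine ⟨⟨EGARCH.limitLaw (μ.map (Z 0)) (EGARCH.obsOf θ₀) hx, fun h θhat _ hhat => ?_⟩, ?_⟩
  · filter_upwards [hhat.ae_eventually_mem hsub hnonempty] with ω hω
    -- Only membership of the realized estimate in `C` is kept; the convergence in law then holds at
    -- that value as a fixed parameter, with a separate sample point `ω'`.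
    filter_upwards [hω] with n hn s
    refine (EGARCH.tendstoInDistribution_volHat hx hW hC hn s).congr (fun t => ?_) .rfl
    filter_upwards [hDGP.ae_path_eq] with ω' hω'
    rw [hω']
  · intro h h' θhat θhat' _ _ hhat hhat' hdiff k k' hk hk' f
    refine (EGARCH.tendsto_integral_volHat_sub hx hW hC hhat.measurable hhat'.measurable
      (hhat.ae_eventually_mem hsub hnonempty) (hhat'.ae_eventually_mem hsub hnonempty) hdiff hk hk'
      f).congr fun p => ?_
    congr 1 <;>
    · refine integral_congr_ae ?_
      filter_upwards [hDGP.ae_path_eq] with ω hω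
      rw [hω]
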